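/- **Setup.** For each sample size $n$ let $p=p_n$ satisfy $\tau\le p/n\le 1/\tau$ for a fixed $\tau\in(0,1)$. Let $X_1,\dots,X_n$ be i.i.d. random vectors in $\mathbb{R}^p$ with $E[X_i]=0$ and $E[X_iX_i^\top]=\Sigma/n$, $\Sigma=\Sigma_n$ positive definite, and let $G_1,\dots,G_n$ be i.i.d. $N(0,\Sigma/n)$; write $\mathbf X,\mathbf G\in\mathbb{R}^{n\times p}$ for the matrices with these rows. Let $\xi=(\xi_1,\dots,\xi_n)$ be a (possibly random) noise vector that is independent of $\mathbf X$ and independent of $\mathbf G$. Let $\ell_0$ be one of the squared loss $\ell_0(u)=u^2$, the absolute loss $\ell_0(u)=|u|$, or the Huber loss $\ell_0(u)=\tfrac12u^2\mathbf 1\{|u|\le\eta\}+(\eta|u|-\tfrac12\eta^2)\mathbf 1\{|u|>\eta\}$ with a fixed $\eta>0$, and put $\ell_i(z)=\ell_0(z-\xi_i)$. For a convex function $R=R_n:\mathbb{R}^p\to\mathbb{R}$ set $$H_\ell(w,\mathbf Z)=\frac1n\sum_{i=1}^n\ell_i(Z_i^\top w)+R(w),\qquad w\in\mathbb{R}^p,\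 \mathbf Z\in\{\mathbf X,\mathbf G\}.$$ **Assumptions.** (a) *Losses.* There are $q_0,q_1,q_2,q_3\ge0$, $\bar\rho\in(0,1]$, measurable functions $\mathcal M_\ell,\mathcal D_\ell:(0,\bar\rho)\to[0,\infty)$ with $\mathcal M_\ell\le1\le\mathcal D_\ell$, none of them depending on $n$ or $\xi$, and numbers $L_{\ell_i}\ge1$ (which may depend on $n$ and $\xi$) such that $\sup_x|\ell_i(x)|/(1+|x|^{q_0})\le L_{\ell_i}$ for all $i$, and for every $\rho\in(0,\bar\rho)$ and $i$ there is $\ell_{i;\rho}\in C^3(\mathbb{R})$, $\ell_{i;\rho}\ge0$, with $\|\ell_{i;\rho}-\ell_i\|_\infty\le\mathcal M_\ell(\rho)$ and $\sup_x|\ell_{i;\rho}^{(k)}(x)|/(1+|\ell_{i;\rho}(x)|^{q_k})\le\mathcal D_\ell(\rho)$ for $k=1,2,3$. Put $\mathbf q=\max\{3q_1,q_1+q_2,q_3\}$ and $\bar{\mathbf q}_0=2\lceil q_0\mathbf q/2\rceil$. Suppose $\bar{\mathbf q}_0\le6$ and $\frac1n\sum_{i=1}^nL_{\ell_i}^{\mathbf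 q}=O(1)$ (bounded in probability if $\xi$ is random). (b) *Moments.* There is a constant $M<\infty$, independent of $n$, such that $\|\sqrt n\,X_{i,j}\|_{q^*}\le M$ for all $i,j$, where $q^*=2^{(\bar{\mathbf q}_0+4)/2}$ and $\|\cdot\|_{q}=E[|\cdot|^{q}]^{1/q}$, and $\lambda_{\max}(\Sigma)\le M$. (c) *Block dependence.* For $d=d_n$, the index set $\{1,\dots,p\}$ has a partition $B_1,\dots,B_k$ (with $k\le p$) into cells of at most $d$ elements, the same for all $i$, such that for each $i$ the subvectors $(X_{i,j})_{j\in B_1},\dots,(X_{i,j})_{j\in B_k}$ are mutually independent. **Statement.** Let $\kappa\ge0$, $\alpha\in[0,1/(2\bar{\mathbf q}_0+6)]$, $L_n\ge1$, $L_n=O(n^\alpha\log^\kappa n)$, and $$d=o\!\left(\frac{n^{1/4-(\bar{\mathbf q}_0+3)\alpha/2}}{\log^{6+(2\bar{\mathbf q}_0+6)\kappa}n}\right)\qquad(n\to\infty).$$ Then for any nonempty sets $\mathcal S_n\subset[-L_n,L_n]^p$ and any $g\in C^3(\mathbb{R})$ with $g,g',g'',g'''$ bounded, the expectations below exist and $$\Bigl|E\Bigl[g\bigl(\min_{w\in\mathcal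 S_n}H_\ell(w,\mathbf X)\bigr)\Bigr]-E\Bigl[g\bigl(\min_{w\in\mathcal S_n}H_\ell(w,\mathbf G)\bigr)\Bigr]\Bigr|\longrightarrow0\qquad(n,p\to\infty),$$ where $\min$ denotes the infimum when it is not attained. In particular, for $\alpha=0$ it suffices that $d=o(n^{1/4})$ up to the logarithmic factor $\log^{6+(2\bar{\mathbf q}_0+6)\kappa}n$ in the denominator. -/

import Mathlib

open MeasureTheory ProbabilityTheory Filter Topology Asymptotics
open scoped NNReal ENNReal

noncomputable section

/-- Squared loss, as a function of the residual. -/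
def squaredLoss (u : ℝ) : ℝ := u ^ 2

/-- Absolute loss, as a function of the residual. -/
def absoluteLoss (u : ℝ) : ℝ := |u|

/-- Huber loss with threshold `η`, as a function of the residual. -/
def huberLoss (η : ℝ) (u : ℝ) : ℝ :=
  if |u| ≤ η then u ^ 2 / 2 else η * |u| - η ^ 2 / 2

/-- The loss is the squared loss, the absolute loss, or a Huber loss. -/
def IsExampleLoss (ell0 : ℝ → ℝ) : Prop :=
  ell0 = squaredLoss ∨ ell0 = absoluteLoss ∨ ∃ η : ℝ, 0 < η ∧ ell0 = huberLoss η

/-- The individual losses `ℓ_i(z) = ℓ₀(z - ξ_i)` attached to a noise vector `ξ`. -/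
def noisyLoss (ell0 : ℝ → ℝ) {n : ℕ} (ξ : Fin n → ℝ) (i : Fin n) (z : ℝ) : ℝ :=
  ell0 (z - ξ i)

/-- The regularity assumption on a family of losses `ℓ i`, with exponents `q 0, q 1, q 2, q 3`,
growth constants `Lc i`, and accuracy / derivative-bound functions `Mℓ`, `Dℓ` on `(0, ρbar)`. -/
structure LossAssumption {ι : Type*} (ℓ : ι → ℝ → ℝ) (q : Fin 4 → ℝ) (Lc : ι → ℝ)
    (ρbar : ℝ) (Dℓ Mℓ : Set.Ioo (0 : ℝ) ρbar → ℝ) : Prop where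
  q_nonneg : ∀ k, 0 ≤ q k
  ρbar_pos : 0 < ρbar
  ρbar_le_one : ρbar ≤ 1
  one_le_Lc : ∀ i, 1 ≤ Lc i
  measurable_D : Measurable Dℓ
  measurable_M : Measurable Mℓ
  M_nonneg : ∀ ρ, 0 ≤ Mℓ ρ
  M_le_one : ∀ ρ, Mℓ ρ ≤ 1
  one_le_D : ∀ ρ, 1 ≤ Dℓ ρ
  growth : ∀ i x, |ℓ i x| / (1 + |x| ^ q 0) ≤ Lc i
  approx : ∃ ℓs : Set.Ioo (0 : ℝ) ρbar → ι → ℝ → ℝ, ∀ ρ i,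
    (∀ x, 0 ≤ ℓs ρ i x) ∧
    ContDiff ℝ 3 (ℓs ρ i) ∧
    (∀ x, |ℓs ρ i x - ℓ i x| ≤ Mℓ ρ) ∧
    ∀ k : Fin 4, k ≠ 0 → ∀ x,
      |iteratedDeriv (k : ℕ) (ℓs ρ i) x| / (1 + |ℓs ρ i x| ^ q k) ≤ Dℓ ρ

/-- `𝐪 = max {3 q₁, q₁ + q₂, q₃}`. -/
def qBold (q : Fin 4 → ℝ) : ℝ := max (3 * q 1) (max (q 1 + q 2) (q 3))

/-- `q̄₀ = 2 ⌈q₀ 𝐪 / 2⌉`, an even natural number. -/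
def qBar (q : Fin 4 → ℝ) : ℕ := 2 * ⌈q 0 * qBold q / 2⌉₊

/-- The moment order `q* = 2 ^ ((q̄₀ + 4) / 2)`; `q̄₀` is even, so the division is exact. -/
def qStar (q : Fin 4 → ℝ) : ℕ := 2 ^ ((qBar q + 4) / 2)

/-- `Av(a) = (1/n) ∑ a_i`. -/
def Av {n : ℕ} (a : Fin n → ℝ) : ℝ := (1 / (n : ℝ)) * ∑ i, a i

/-- A random vector is `d`-block dependent: its coordinates can be split into `k ≤ p` cells
(the fibres of `c`) with at most `d` elements each, so that the subvectors belonging to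
different cells are mutually independent. The cells are shared by all vectors `X i`. -/
def BlockDependent {Ω ι : Type*} [MeasurableSpace Ω] (P : Measure Ω) {p : ℕ} (d : ℕ)
    (X : Ω → ι → Fin p → ℝ) : Prop :=
  ∃ k : ℕ, k ≤ p ∧ ∃ c : Fin p → Fin k,
    (∀ b, (Finset.univ.filter (fun j => c j = b)).card ≤ d) ∧
    ∀ i, iIndepFun (fun (b : Fin k) (ω : Ω) (j : {j : Fin p // c j = b}) => X ω i j) P

/-- The rows of the random matrix `X` are i.i.d., centred, with
`E[X_i X_iᵀ] = Sig / n`. -/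
structure IsCovariateDesign {Ω : Type*} [MeasurableSpace Ω] (P : Measure Ω) {n p : ℕ}
    (Sig : Matrix (Fin p) (Fin p) ℝ) (X : Ω → Fin n → Fin p → ℝ) : Prop where
  measurable : Measurable X
  indep : iIndepFun (fun i ω => X ω i) P
  ident : ∀ i i', IdentDistrib (fun ω => X ω i) (fun ω => X ω i') P P
  mean : ∀ i j, Integrable (fun ω => X ω i j) P ∧ ∫ ω, X ω i j ∂P = 0
  second : ∀ i j j', Integrable (fun ω => X ω i j * X ω i j') P ∧
    ∫ ω, X ω i j * X ω i j' ∂P = Sig j j' / n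

/-- The rows of the random matrix `G` are i.i.d. with law `N(0, Sig / n)`. -/
structure IsGaussianDesign {Ω : Type*} [MeasurableSpace Ω] (P : Measure Ω) {n p : ℕ}
    (Sig : Matrix (Fin p) (Fin p) ℝ) (G : Ω → Fin n → Fin p → ℝ) : Prop where
  measurable : Measurable G
  indep : iIndepFun (fun i ω => G ω i) P
  law : ∀ i, P.map (fun ω => WithLp.toLp 2 (G ω i)) =
    multivariateGaussian 0 ((1 / (n : ℝ)) • Sig)

/-- `H_ℓ(w, x) = (1/n) ∑ ℓ_i(x_iᵀ w) + R(w)`. -/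
def empRisk {n p : ℕ} (ℓ : Fin n → ℝ → ℝ) (R : (Fin p → ℝ) → ℝ)
    (x : Fin n → Fin p → ℝ) (w : Fin p → ℝ) : ℝ :=
  Av (fun i => ℓ i (∑ j, x i j * w j)) + R w

/-- The minimal (infimal) value of the empirical risk over `S`. -/
def minRisk {n p : ℕ} (ℓ : Fin n → ℝ → ℝ) (R : (Fin p → ℝ) → ℝ)
    (S : Set (Fin p → ℝ)) (x : Fin n → Fin p → ℝ) : ℝ :=
  ⨅ w : S, empRisk ℓ R x w

end

/-!
The infimum of the empirical risk is replaced by a function to which Lindeberg's method applies. A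
Lipschitz loss is averaged three times over windows of length `r`, which costs `O(r)` and makes it
`C³` (the squared loss is smooth already), and the infimum over `S` is replaced by the soft-min at
inverse temperature `β` over a finite `δ`-net `ι` of `S`, which costs `O(log |ι| / β)`. The rows of
`X` are then exchanged for those of `G` one cell of the partition at a time: the cells are
independent and the two designs have the same means and covariances, so in each exchange the Taylor
polynomial of order two has the same expectation under both designs, and only the third-order
remainder, cubic in the size of a cell, survives.

The remainder is controlled by Gibbs averages of powers of the derivative of the loss. For a
Lipschitz loss these are bounded outright. For the squared loss the Gibbs weight of `w` decreases in
the very term of the risk that is being averaged, so removing that term from the weight only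
increases the average (Chebyshev's association inequality); after the removal the weight is
independent of the row, whose moments are then available.

The noise is treated as a constant by conditioning on it, on an event where the averages of
`(1 + |ξᵢ|) ^ 3` are bounded in the case of the squared loss. The growth condition gives
`ξᵢ ^ 2 ≤ Lcᵢ`, and the bound of the derivative of a smoothed loss by a power of that loss forces
`q₁ ≥ 1 / 2`, so that `(1 + |ξᵢ|) ^ 3` is at most a multiple of `Lcᵢ ^ qBold q`. With
`r = 1 / log n`, `δ = n⁻³` and `β = n (log n) ^ 2` all the errors tend to zero.
-/

section Gibbs

variable {ι : Type*} [Fintype ι]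

/-- The probability weights on `ι` proportional to `exp (E w)`. -/
noncomputable def gibbsWeight (E : ι → ℝ) (w : ι) : ℝ :=
  Real.exp (E w) / ∑ v, Real.exp (E v)

/-- The average `⟨f⟩` of `f` under the Gibbs weights of `E`, as a linear functional of `f`. -/
noncomputable def gibbs (E : ι → ℝ) : (ι → ℝ) →ₗ[ℝ] ℝ :=
  ∑ w, gibbsWeight E w • LinearMap.proj w

/-- The covariance `⟨f f'⟩ - ⟨f⟩ ⟨f'⟩` under the Gibbs weights of `E`. -/
noncomputable def gibbsCov (E f f' : ι → ℝ) : ℝ :=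
  gibbs E (f * f') - gibbs E f * gibbs E f'

/-- The soft minimum of `H` at inverse temperature `β`. -/
noncomputable def softmin (β : ℝ) (H : ι → ℝ) : ℝ :=
  -(1 / β) * Real.log (∑ w, Real.exp (-β * H w))

lemma gibbs_apply (E f : ι → ℝ) : gibbs E f = ∑ w, gibbsWeight E w * f w := by
  simp [gibbs, LinearMap.sum_apply]

lemma gibbs_eq_div (E f : ι → ℝ) :
    gibbs E f = (∑ w, Real.exp (E w) * f w) / ∑ w, Real.exp (E w) := by
  simp only [gibbs_apply, gibbsWeight, Finset.sum_div, div_mul_eq_mul_div]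

lemma gibbsWeight_nonneg (E : ι → ℝ) (w : ι) : 0 ≤ gibbsWeight E w := by
  unfold gibbsWeight
  positivity

lemma gibbs_mono (E : ι → ℝ) : Monotone (gibbs E) := fun f f' h => by
  simp only [gibbs_apply]
  exact Finset.sum_le_sum fun w _ => mul_le_mul_of_nonneg_left (h w) (gibbsWeight_nonneg E w)

lemma gibbs_nonneg (E : ι → ℝ) {f : ι → ℝ} (h : 0 ≤ f) : 0 ≤ gibbs E f := by
  simpa using gibbs_mono E h

lemma abs_gibbs_le (E : ι → ℝ) {f a : ι → ℝ} (h : |f| ≤ a) : |gibbs E f| ≤ gibbs E a :=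
  abs_le'.2 ⟨gibbs_mono E ((le_abs_self f).trans h), by
    rw [← map_neg]
    exact gibbs_mono E ((neg_le_abs f).trans h)⟩

variable [Nonempty ι]

lemma sum_exp_pos (E : ι → ℝ) : 0 < ∑ w, Real.exp (E w) :=
  Finset.sum_pos (fun _ _ => Real.exp_pos _) Finset.univ_nonempty

lemma sum_gibbsWeight (E : ι → ℝ) : ∑ w, gibbsWeight E w = 1 := by
  simp only [gibbsWeight, ← Finset.sum_div, div_self (sum_exp_pos E).ne']

lemma gibbs_const (E : ι → ℝ) (c : ℝ) : gibbs E (fun _ => c) = c := by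
  rw [gibbs_apply, ← Finset.sum_mul, sum_gibbsWeight, one_mul]

omit [Nonempty ι] in
lemma softmin_le {β : ℝ} (hβ : 0 < β) (H : ι → ℝ) (w : ι) : softmin β H ≤ H w := by
  have : Nonempty ι := ⟨w⟩
  have hlog : -β * H w ≤ Real.log (∑ v, Real.exp (-β * H v)) :=
    (Real.le_log_iff_exp_le (sum_exp_pos _)).2 <|
      Finset.single_le_sum (f := fun v => Real.exp (-β * H v)) (fun v _ => (Real.exp_pos _).le)
        (Finset.mem_univ w)
  rw [softmin, neg_mul, neg_le, one_div, inv_mul_eq_div, le_div_iff₀ hβ]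
  linarith

lemma le_softmin {β : ℝ} (hβ : 0 < β) {H : ι → ℝ} {m : ℝ} (hm : ∀ w, m ≤ H w) :
    m - Real.log (Fintype.card ι) / β ≤ softmin β H := by
  have hsum : ∑ v, Real.exp (-β * H v) ≤ Fintype.card ι * Real.exp (-β * m) := by
    rw [← nsmul_eq_mul]
    exact Finset.sum_le_card_nsmul _ _ _ fun v _ => Real.exp_le_exp.2 <|
      mul_le_mul_of_nonpos_left (hm v) (neg_nonpos.2 hβ.le)
  have hlog := Real.log_le_log (sum_exp_pos fun w => -β * H w) hsum
  rw [Real.log_mul (by exact_mod_cast Fintype.card_ne_zero) (Real.exp_pos _).ne', Real.log_exp]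
    at hlog
  calc m - Real.log (Fintype.card ι) / β
      = -(1 / β) * (Real.log (Fintype.card ι) + -β * m) := by field_simp; ring
    _ ≤ softmin β H :=
        mul_le_mul_of_nonpos_left hlog (neg_nonpos.2 (one_div_pos.2 hβ).le)

/-- Chebyshev's association inequality: expand `∑ v, ∑ w, p v * p w * (f w - f v) * (g w - g v)`,
whose terms are all nonnegative. -/
lemma gibbs_mul_gibbs_le_of_monovary (E : ι → ℝ) {f g : ι → ℝ} (h : Monovary f g) :
    gibbs E f * gibbs E g ≤ gibbs E (f * g) := by
  set p := gibbsWeight E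
  have hterms : 0 ≤ ∑ v, ∑ w, p v * p w * ((f w - f v) * (g w - g v)) :=
    Finset.sum_nonneg fun v _ => Finset.sum_nonneg fun w _ =>
      mul_nonneg (mul_nonneg (gibbsWeight_nonneg E v) (gibbsWeight_nonneg E w))
        (monovary_iff_forall_mul_nonneg.1 h v w)
  have hsplit : ∑ v, ∑ w, p v * p w * ((f w - f v) * (g w - g v))
      = (∑ v, p v) * (∑ w, p w * (f w * g w)) + (∑ v, p v * (f v * g v)) * (∑ w, p w)
        - (∑ v, p v * f v) * (∑ w, p w * g w) - (∑ v, p v * g v) * (∑ w, p w * f w) := by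
    simp only [Finset.sum_mul_sum, ← Finset.sum_add_distrib, ← Finset.sum_sub_distrib]
    refine Finset.sum_congr rfl fun v _ => Finset.sum_congr rfl fun w _ => by ring
  rw [hsplit, sum_gibbsWeight] at hterms
  simp only [gibbs_apply, Pi.mul_apply]
  linarith

lemma gibbs_mul_le_of_nonneg (E : ι → ℝ) {a : ι → ℝ} (ha : 0 ≤ a) (k : ℕ) :
    gibbs E (a ^ k) * gibbs E a ≤ gibbs E (a ^ (k + 1)) := by
  rw [pow_succ]
  exact gibbs_mul_gibbs_le_of_monovary E fun v _ hvw =>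
    pow_le_pow_left₀ (ha v) hvw.le k

lemma gibbs_pow_le (E : ι → ℝ) {a : ι → ℝ} (ha : 0 ≤ a) (k : ℕ) :
    gibbs E a ^ k ≤ gibbs E (a ^ k) := by
  induction k with
  | zero =>
    rw [pow_zero, pow_zero]
    exact (gibbs_const E 1).ge
  | succ k ih =>
    rw [pow_succ]
    exact (mul_le_mul_of_nonneg_right ih (gibbs_nonneg E ha)).trans
      (gibbs_mul_le_of_nonneg E ha k)

lemma gibbs_sub_eq_div (E u f : ι → ℝ) :
    gibbs (E - u) f
      = gibbs E (f * fun w => Real.exp (-u w)) / gibbs E (fun w => Real.exp (-u w)) := by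
  have hexp : ∀ w, Real.exp ((E - u) w) = Real.exp (E w) * Real.exp (-u w) := fun w => by
    rw [← Real.exp_add, Pi.sub_apply, sub_eq_add_neg]
  simp only [gibbs_eq_div, Pi.mul_apply, hexp]
  rw [div_div_div_cancel_right₀ (sum_exp_pos E).ne']
  congr 1
  exact Finset.sum_congr rfl fun w _ => by ring

/-- The tilt `exp (-u)` and `f` are negatively correlated. -/
lemma gibbs_sub_le_of_monovary (E : ι → ℝ) {u f : ι → ℝ} (h : Monovary f u) :
    gibbs (E - u) f ≤ gibbs E f := by
  have htilt : 0 < gibbs E (fun w => Real.exp (-u w)) := by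
    simp only [gibbs_eq_div, ← Real.exp_add]
    exact div_pos (sum_exp_pos _) (sum_exp_pos E)
  rw [gibbs_sub_eq_div, div_le_iff₀ htilt]
  have hcheb := gibbs_mul_gibbs_le_of_monovary E (f := -f) (g := fun w => Real.exp (-u w))
    fun v w hvw => neg_le_neg (h (by simpa using hvw))
  rw [neg_mul, map_neg, map_neg, neg_mul] at hcheb
  linarith

lemma hasDerivAt_gibbs {E f : ℝ → ι → ℝ} {E' f' : ι → ℝ} {t : ℝ} (hE : HasDerivAt E E' t)
    (hf : HasDerivAt f f' t) :
    HasDerivAt (fun t => gibbs (E t) (f t)) (gibbs (E t) f' + gibbsCov (E t) (f t) E') t := by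
  have hE := hasDerivAt_pi.1 hE
  have hf := hasDerivAt_pi.1 hf
  have hden : HasDerivAt (fun t => ∑ w, Real.exp (E t w)) (∑ w, Real.exp (E t w) * E' w) t :=
    HasDerivAt.fun_sum fun w _ => (hE w).exp
  have hnum : HasDerivAt (fun t => ∑ w, Real.exp (E t w) * f t w)
      (∑ w, (Real.exp (E t w) * E' w * f t w + Real.exp (E t w) * f' w)) t :=
    HasDerivAt.fun_sum fun w _ => (hE w).exp.mul (hf w)
  have hsplit : ∑ w, (Real.exp (E t w) * E' w * f t w + Real.exp (E t w) * f' w)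
      = ∑ w, Real.exp (E t w) * (f t w * E' w) + ∑ w, Real.exp (E t w) * f' w := by
    rw [← Finset.sum_add_distrib]
    exact Finset.sum_congr rfl fun w _ => by ring
  have hden0 := (sum_exp_pos (E t)).ne'
  simp only [gibbsCov, gibbs_eq_div, Pi.mul_apply]
  refine (hnum.div hden hden0).congr_deriv ?_
  rw [hsplit]
  field_simp
  ring

lemma hasDerivAt_softmin {β : ℝ} (hβ : β ≠ 0) {H : ℝ → ι → ℝ} {H' : ι → ℝ} {t : ℝ}
    (hH : HasDerivAt H H' t) :
    HasDerivAt (fun t => softmin β (H t)) (gibbs (-β • H t) H') t := by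
  have hsum : HasDerivAt (fun t => ∑ w, Real.exp (-β * H t w))
      (∑ w, Real.exp (-β * H t w) * (-β * H' w)) t :=
    HasDerivAt.fun_sum fun w _ => ((hasDerivAt_pi.1 hH w).const_mul (-β)).exp
  have hsum0 := (sum_exp_pos (-β • H t)).ne'
  refine ((hsum.log hsum0).const_mul (-(1 / β))).congr_deriv ?_
  simp only [gibbs_eq_div, Pi.smul_apply, smul_eq_mul, mul_left_comm _ (-β), ← Finset.mul_sum]
  field_simp

end Gibbs

section Jets

/-- `f k` is the `k`-th derivative of `f 0` for `k ≤ r`; the entries beyond `r` are irrelevant. -/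
def IsJet {F : Type*} [NormedAddCommGroup F] [NormedSpace ℝ F] (r : ℕ) (f : ℕ → ℝ → F) : Prop :=
  ∀ k < r, ∀ t, HasDerivAt (f k) (f (k + 1) t) t

/-- The derivatives of `g 0 ∘ u 0` (Faà di Bruno's formula), for jets `g` and `u`, up to order
three; the entries beyond are `0`. -/
def compJet (g u : ℕ → ℝ → ℝ) : ℕ → ℝ → ℝ
  | 0, t => g 0 (u 0 t)
  | 1, t => g 1 (u 0 t) * u 1 t
  | 2, t => g 2 (u 0 t) * u 1 t ^ 2 + g 1 (u 0 t) * u 2 t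
  | 3, t => g 3 (u 0 t) * u 1 t ^ 3 + 3 * (g 2 (u 0 t) * (u 1 t * u 2 t)) + g 1 (u 0 t) * u 3 t
  | _, _ => 0

lemma IsJet.continuous {F : Type*} [NormedAddCommGroup F] [NormedSpace ℝ F] {r : ℕ} {f : ℕ → ℝ → F}
    (hf : IsJet r f) (hr : 1 ≤ r) : Continuous (f 0) :=
  continuous_iff_continuousAt.2 fun t => (hf 0 hr t).continuousAt

lemma IsJet.compJet {g u : ℕ → ℝ → ℝ} (hg : IsJet 3 g) (hu : IsJet 3 u) :
    IsJet 3 (compJet g u) := by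
  have dg : ∀ k < 3, ∀ t, HasDerivAt (fun t => g k (u 0 t)) (g (k + 1) (u 0 t) * u 1 t) t :=
    fun k hk t => (hg k hk _).comp t (hu 0 (by norm_num) t)
  intro k hk t
  have du1 := hu 1 (by norm_num) t
  have du2 := hu 2 (by norm_num) t
  interval_cases k
  · exact dg 0 (by norm_num) t
  · exact ((dg 1 (by norm_num) t).mul du1).congr_deriv (by simp only [_root_.compJet]; ring)
  · refine (((dg 2 (by norm_num) t).mul (du1.pow 2)).add
      ((dg 1 (by norm_num) t).mul du2)).congr_deriv ?_
    simp only [_root_.compJet, Pi.pow_apply]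
    push_cast
    ring

lemma IsJet.abs_taylor_two_le {Φ : ℕ → ℝ → ℝ} (hΦ : IsJet 3 Φ) {B : ℝ}
    (hB : ∀ t ∈ Set.Icc (0 : ℝ) 1, |Φ 3 t| ≤ B) :
    |Φ 0 1 - Φ 0 0 - (Φ 1 0 + Φ 2 0 / 2)| ≤ B := by
  have hB0 : 0 ≤ B := (abs_nonneg _).trans (hB 0 (by simp))
  have integrate : ∀ {ψ ψ' : ℝ → ℝ}, (∀ t, HasDerivAt ψ (ψ' t) t) → ψ 0 = 0 →
      (∀ t ∈ Set.Icc (0 : ℝ) 1, |ψ' t| ≤ B) → ∀ t ∈ Set.Icc (0 : ℝ) 1, |ψ t| ≤ B := by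
    intro ψ ψ' hd h00 hb t ht
    have := norm_image_sub_le_of_norm_deriv_le_segment' (f := ψ) (f' := ψ') (a := 0) (b := 1)
      (C := B) (fun x _ => (hd x).hasDerivWithinAt) (fun x hx => hb x ⟨hx.1, hx.2.le⟩) t ht
    rw [h00, sub_zero, sub_zero, Real.norm_eq_abs] at this
    exact this.trans (mul_le_of_le_one_right hB0 ht.2)
  have rem2 := integrate (ψ := fun t => Φ 2 t - Φ 2 0)
    (fun t => (hΦ 2 (by norm_num) t).sub_const _) (by simp) hB
  have rem1 := integrate (ψ := fun t => Φ 1 t - Φ 1 0 - Φ 2 0 * t) (ψ' := fun t => Φ 2 t - Φ 2 0)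
    (fun t => (((hΦ 1 (by norm_num) t).sub_const _).sub
      ((hasDerivAt_id t).const_mul (Φ 2 0))).congr_deriv (by simp)) (by simp) rem2
  have rem0 := integrate (ψ := fun t => Φ 0 t - Φ 0 0 - Φ 1 0 * t - Φ 2 0 / 2 * t ^ 2)
    (ψ' := fun t => Φ 1 t - Φ 1 0 - Φ 2 0 * t)
    (fun t => ((((hΦ 0 (by norm_num) t).sub_const _).sub
      ((hasDerivAt_id t).const_mul (Φ 1 0))).sub
      ((hasDerivAt_pow 2 t).const_mul (Φ 2 0 / 2))).congr_deriv (by simp; ring)) (by simp) rem1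
  convert rem0 1 (by simp) using 2
  ring

end Jets

section SoftminJet

variable {ι : Type*} [Fintype ι]

/-- The third cumulant of `f` under the Gibbs weights of `E`. -/
noncomputable def gibbsCumulant (E f : ι → ℝ) : ℝ :=
  gibbs E (f ^ 3) - 3 * (gibbs E (f ^ 2) * gibbs E f) + 2 * gibbs E f ^ 3

/-- The derivatives of `t ↦ softmin β (H 0 t)`, for a jet `H`, up to order
three; the entries beyond are `0`. -/
noncomputable def softminJet (β : ℝ) (H : ℕ → ℝ → ι → ℝ) : ℕ → ℝ → ℝ
  | 0, t => softmin β (H 0 t)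
  | 1, t => gibbs (-β • H 0 t) (H 1 t)
  | 2, t => gibbs (-β • H 0 t) (H 2 t) - β * gibbsCov (-β • H 0 t) (H 1 t) (H 1 t)
  | 3, t => gibbs (-β • H 0 t) (H 3 t) - 3 * β * gibbsCov (-β • H 0 t) (H 2 t) (H 1 t)
      + β ^ 2 * gibbsCumulant (-β • H 0 t) (H 1 t)
  | _, _ => 0

variable [Nonempty ι]

lemma isJet_softminJet {β : ℝ} (hβ : β ≠ 0) {H : ℕ → ℝ → ι → ℝ} (hH : IsJet 3 H) :
    IsJet 3 (softminJet β H) := by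
  have dgibbs : ∀ {u : ℝ → ι → ℝ} {u' : ι → ℝ} {t : ℝ}, HasDerivAt u u' t →
      HasDerivAt (fun t => gibbs (-β • H 0 t) (u t))
        (gibbs (-β • H 0 t) u' - β * gibbsCov (-β • H 0 t) (u t) (H 1 t)) t := fun {u u' t} hu => by
    refine (hasDerivAt_gibbs ((hH 0 (by norm_num) t).const_smul (-β)) hu).congr_deriv ?_
    simp only [gibbsCov, mul_smul_comm, map_smul, smul_eq_mul, Pi.smul_apply]
    ring
  have d1 := fun t => dgibbs (hH 1 (by norm_num) t)
  intro k hk t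
  interval_cases k
  · exact hasDerivAt_softmin hβ (hH 0 (by norm_num) t)
  · exact d1 t
  · have dsq := dgibbs ((hH 1 (by norm_num) t).mul (hH 1 (by norm_num) t))
    refine ((dgibbs (hH 2 (by norm_num) t)).sub
      ((dsq.sub ((d1 t).mul (d1 t))).const_mul β)).congr_deriv ?_
    simp only [softminJet, gibbsCov, gibbsCumulant, map_add, mul_comm (H 1 t) (H 2 t), pow_succ,
      pow_zero, one_mul, Pi.mul_apply]
    ring

lemma abs_gibbsCov_le (E : ι → ℝ) {f f' a a' : ι → ℝ} (hf : |f| ≤ a) (hf' : |f'| ≤ a')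
    (ha : Monovary a a') : |gibbsCov E f f'| ≤ 2 * gibbs E (a * a') := by
  have hprod : |gibbs E (f * f')| ≤ gibbs E (a * a') := abs_gibbs_le E fun w => by
    rw [Pi.abs_apply, Pi.mul_apply, abs_mul]
    exact mul_le_mul (hf w) (hf' w) (abs_nonneg _) ((abs_nonneg _).trans (hf w))
  have hsep : |gibbs E f * gibbs E f'| ≤ gibbs E (a * a') := by
    rw [abs_mul]
    exact (mul_le_mul (abs_gibbs_le E hf) (abs_gibbs_le E hf') (abs_nonneg _)
      (gibbs_nonneg E ((abs_nonneg f).trans hf))).trans (gibbs_mul_gibbs_le_of_monovary E ha)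
  rw [gibbsCov, two_mul]
  exact (abs_sub _ _).trans (add_le_add hprod hsep)

lemma abs_gibbsCumulant_le (E : ι → ℝ) {f a : ι → ℝ} (hf : |f| ≤ a) :
    |gibbsCumulant E f| ≤ 6 * gibbs E (a ^ 3) := by
  have ha : 0 ≤ a := (abs_nonneg f).trans hf
  have hpow : ∀ k : ℕ, |gibbs E (f ^ k)| ≤ gibbs E (a ^ k) := fun k => abs_gibbs_le E fun w => by
    rw [Pi.abs_apply, Pi.pow_apply, abs_pow]
    exact pow_le_pow_left₀ (abs_nonneg _) (hf w) k
  have hmean := abs_gibbs_le E hf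
  have hsq : |gibbs E (f ^ 2) * gibbs E f| ≤ gibbs E (a ^ 3) := by
    rw [abs_mul]
    exact (mul_le_mul (hpow 2) hmean (abs_nonneg _) (gibbs_nonneg E (pow_nonneg ha 2))).trans
      (gibbs_mul_le_of_nonneg E ha 2)
  have hcube : |gibbs E f ^ 3| ≤ gibbs E (a ^ 3) := by
    rw [abs_pow]
    exact (pow_le_pow_left₀ (abs_nonneg _) hmean 3).trans (gibbs_pow_le E ha 3)
  have h3 := abs_le.1 (hpow 3)
  rw [abs_le] at hsq hcube
  rw [gibbsCumulant, abs_le]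
  constructor <;> linarith

section Bounds

variable {β r D : ℝ} {H : ℕ → ℝ → ι → ℝ} {t : ℝ} {b : ι → ℝ}

omit [Nonempty ι] in
lemma abs_softminJet_one_le (h1 : |H 1 t| ≤ r • b) :
    |softminJet β H 1 t| ≤ r * gibbs (-β • H 0 t) b := by
  rw [← smul_eq_mul, ← map_smul]
  exact abs_gibbs_le _ h1

lemma abs_softminJet_two_le (hβ : 0 ≤ β) (hD : 1 ≤ D) (hb : 0 ≤ b) (h1 : |H 1 t| ≤ r • b)
    (h2 : |H 2 t| ≤ (D * β * r ^ 2) • b ^ 2) :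
    |softminJet β H 2 t| ≤ 3 * D * β * r ^ 2 * gibbs (-β • H 0 t) (b ^ 2) := by
  have hmean := abs_gibbs_le (-β • H 0 t) h2
  have hcov := abs_gibbsCov_le (-β • H 0 t) h1 h1 (monovary_self _)
  rw [smul_mul_smul_comm, ← sq b, map_smul, smul_eq_mul] at hcov
  rw [map_smul, smul_eq_mul] at hmean
  have hB := gibbs_nonneg (-β • H 0 t) (pow_nonneg hb 2)
  calc |softminJet β H 2 t|
      ≤ D * β * r ^ 2 * gibbs (-β • H 0 t) (b ^ 2)
        + β * (2 * (r * r * gibbs (-β • H 0 t) (b ^ 2))) := by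
        refine (abs_sub _ _).trans (add_le_add hmean ?_)
        rw [abs_mul, abs_of_nonneg hβ]
        exact mul_le_mul_of_nonneg_left hcov hβ
    _ = (D + 2) * (β * r ^ 2 * gibbs (-β • H 0 t) (b ^ 2)) := by ring
    _ ≤ (3 * D) * (β * r ^ 2 * gibbs (-β • H 0 t) (b ^ 2)) := by
        gcongr
        linarith
    _ = _ := by ring

lemma abs_softminJet_three_le (hβ : 0 ≤ β) (hr : 0 ≤ r) (hD : 1 ≤ D) (hb : 0 ≤ b)
    (h1 : |H 1 t| ≤ r • b) (h2 : |H 2 t| ≤ (D * β * r ^ 2) • b ^ 2)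
    (h3 : |H 3 t| ≤ (D * β ^ 2 * r ^ 3) • b ^ 3) :
    |softminJet β H 3 t| ≤ 13 * D * (β ^ 2 * r ^ 3) * gibbs (-β • H 0 t) (b ^ 3) := by
  have hmean := abs_gibbs_le (-β • H 0 t) h3
  have hcov := abs_gibbsCov_le (-β • H 0 t) h2 h1 fun v w hvw => by
    simp only [Pi.smul_apply, smul_eq_mul, Pi.pow_apply] at hvw ⊢
    exact mul_le_mul_of_nonneg_left
      (pow_le_pow_left₀ (hb v) (lt_of_mul_lt_mul_left hvw hr).le 2) (by positivity)
  have hcum := abs_gibbsCumulant_le (-β • H 0 t) h1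
  rw [smul_mul_smul_comm, ← pow_succ, map_smul, smul_eq_mul] at hcov
  rw [smul_pow, map_smul, smul_eq_mul] at hcum
  rw [map_smul, smul_eq_mul] at hmean
  have hB := gibbs_nonneg (-β • H 0 t) (pow_nonneg hb 3)
  calc |softminJet β H 3 t|
      ≤ D * β ^ 2 * r ^ 3 * gibbs (-β • H 0 t) (b ^ 3)
        + 3 * β * (2 * (D * β * r ^ 2 * r * gibbs (-β • H 0 t) (b ^ 3)))
        + β ^ 2 * (6 * (r ^ 3 * gibbs (-β • H 0 t) (b ^ 3))) := by
        refine (abs_add_le _ _).trans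
          (add_le_add ((abs_sub _ _).trans (add_le_add hmean ?_)) ?_)
        · rw [abs_mul, abs_of_nonneg (by positivity : 0 ≤ 3 * β)]
          exact mul_le_mul_of_nonneg_left hcov (by positivity)
        · rw [abs_mul, abs_of_nonneg (by positivity : 0 ≤ β ^ 2)]
          exact mul_le_mul_of_nonneg_left hcum (by positivity)
    _ = (7 * D + 6) * (β ^ 2 * r ^ 3 * gibbs (-β • H 0 t) (b ^ 3)) := by ring
    _ ≤ (13 * D) * (β ^ 2 * r ^ 3 * gibbs (-β • H 0 t) (b ^ 3)) := by
        gcongr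
        linarith
    _ = _ := by ring

lemma abs_softminJet_one_pow_three_le (hr : 0 ≤ r) (hb : 0 ≤ b) (h1 : |H 1 t| ≤ r • b) :
    |softminJet β H 1 t| ^ 3 ≤ r ^ 3 * gibbs (-β • H 0 t) (b ^ 3) :=
  calc |softminJet β H 1 t| ^ 3 ≤ (r * gibbs (-β • H 0 t) b) ^ 3 :=
        pow_le_pow_left₀ (abs_nonneg _) (abs_softminJet_one_le h1) 3
    _ = r ^ 3 * gibbs (-β • H 0 t) b ^ 3 := mul_pow _ _ _
    _ ≤ r ^ 3 * gibbs (-β • H 0 t) (b ^ 3) := by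
      gcongr
      exact gibbs_pow_le _ hb 3

lemma abs_softminJet_one_mul_two_le (hβ : 0 ≤ β) (hr : 0 ≤ r) (hD : 1 ≤ D) (hb : 0 ≤ b)
    (h1 : |H 1 t| ≤ r • b) (h2 : |H 2 t| ≤ (D * β * r ^ 2) • b ^ 2) :
    |softminJet β H 1 t| * |softminJet β H 2 t|
      ≤ 3 * D * β * r ^ 3 * gibbs (-β • H 0 t) (b ^ 3) := by
  have hone := gibbs_nonneg (-β • H 0 t) hb
  calc |softminJet β H 1 t| * |softminJet β H 2 t|
      ≤ (r * gibbs (-β • H 0 t) b) * (3 * D * β * r ^ 2 * gibbs (-β • H 0 t) (b ^ 2)) :=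
        mul_le_mul (abs_softminJet_one_le h1) (abs_softminJet_two_le hβ hD hb h1 h2)
          (abs_nonneg _) (mul_nonneg hr hone)
    _ = 3 * D * β * r ^ 3 * (gibbs (-β • H 0 t) (b ^ 2) * gibbs (-β • H 0 t) b) := by ring
    _ ≤ 3 * D * β * r ^ 3 * gibbs (-β • H 0 t) (b ^ 3) := by
      gcongr
      exact gibbs_mul_le_of_nonneg _ hb 2

lemma abs_compJet_softminJet_three_le (hβ : 1 ≤ β) (hr : 0 ≤ r) (hD : 1 ≤ D) (hb : 0 ≤ b)
    (h1 : |H 1 t| ≤ r • b) (h2 : |H 2 t| ≤ (D * β * r ^ 2) • b ^ 2)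
    (h3 : |H 3 t| ≤ (D * β ^ 2 * r ^ 3) • b ^ 3)
    {g : ℕ → ℝ → ℝ} {K : ℝ} (hg : ∀ k ≤ 3, ∀ x, |g k x| ≤ K) :
    |compJet g (softminJet β H) 3 t|
      ≤ 23 * K * D * (β ^ 2 * r ^ 3) * gibbs (-β • H 0 t) (b ^ 3) := by
  set u := softminJet β H
  set M := gibbs (-β • H 0 t) (b ^ 3)
  have hM : 0 ≤ M := gibbs_nonneg _ (pow_nonneg hb 3)
  have hK : 0 ≤ K := (abs_nonneg _).trans (hg 0 (by norm_num) 0)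
  have hDβ : 1 ≤ D * β ^ 2 := one_le_mul_of_one_le_of_one_le hD (one_le_pow₀ hβ)
  have hcube : |g 3 (u 0 t) * u 1 t ^ 3| ≤ K * (D * β ^ 2 * (r ^ 3 * M)) := by
    rw [abs_mul, abs_pow]
    exact mul_le_mul (hg 3 le_rfl _) ((abs_softminJet_one_pow_three_le hr hb h1).trans
      (le_mul_of_one_le_left (by positivity) hDβ)) (by positivity) hK
  have hmixed : |g 2 (u 0 t) * (u 1 t * u 2 t)| ≤ K * (3 * D * β ^ 2 * r ^ 3 * M) := by
    rw [abs_mul, abs_mul]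
    refine mul_le_mul (hg 2 (by norm_num) _)
      ((abs_softminJet_one_mul_two_le (by positivity) hr hD hb h1 h2).trans ?_) (by positivity) hK
    gcongr
    exact le_self_pow₀ hβ two_ne_zero
  have hlast : |g 1 (u 0 t) * u 3 t| ≤ K * (13 * D * (β ^ 2 * r ^ 3) * M) := by
    rw [abs_mul]
    exact mul_le_mul (hg 1 (by norm_num) _)
      (abs_softminJet_three_le (by positivity) hr hD hb h1 h2 h3) (abs_nonneg _) hK
  rw [abs_le] at hcube hmixed hlast
  rw [compJet, abs_le]
  constructor <;> linarith

end Bounds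

end SoftminJet

section RowTaylor

variable {ι : Type*}

/-- The risk `c w + f (z w) / n` of the parameter `w`, as a function of the prediction `z w` for a
single row; `c` collects the regularizer and the losses of the other rows. -/
noncomputable def rowRisk (n : ℝ) (f : ℝ → ℝ) (c z : ι → ℝ) (w : ι) : ℝ :=
  c w + f (z w) / n

/-- The derivatives of `t ↦ rowRisk n (f 0) c (v + t • y)`, for a jet `f`. -/
noncomputable def rowRiskJet (n : ℝ) (f : ℕ → ℝ → ℝ) (c v y : ι → ℝ) : ℕ → ℝ → ι → ℝ
  | 0, t => rowRisk n (f 0) c (v + t • y)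
  | k + 1, t => fun w => f (k + 1) ((v + t • y) w) * y w ^ (k + 1) / n

/-- The polynomials in `y : ι → ℝ` that are sums of a linear and a quadratic form. -/
def quadratics (ι : Type*) : Submodule ℝ ((ι → ℝ) → ℝ) :=
  Submodule.span ℝ
    (Set.range (fun w y => y w) ∪ Set.range (fun w : ι × ι => fun y => y w.1 * y w.2))

section Quadratics

lemma linearMap_eq_sum_smul [Fintype ι] [DecidableEq ι] (L : (ι → ℝ) →ₗ[ℝ] ℝ) :
    ⇑L = ∑ w, L (Pi.single w 1) • fun y => y w := by
  funext y
  conv_lhs => rw [← Finset.univ_sum_single y]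
  simp only [map_sum, Finset.sum_apply, Pi.smul_apply, smul_eq_mul, mul_comm _ (y _)]
  refine Finset.sum_congr rfl fun w _ => ?_
  rw [← smul_eq_mul, ← map_smul, ← Pi.single_smul, smul_eq_mul, mul_one]

variable [Finite ι]

lemma linearMap_mem_quadratics (L : (ι → ℝ) →ₗ[ℝ] ℝ) : ⇑L ∈ quadratics ι := by
  classical
  cases nonempty_fintype ι
  rw [linearMap_eq_sum_smul L]
  exact sum_mem fun w _ => Submodule.smul_mem _ _ (Submodule.subset_span (Or.inl ⟨w, rfl⟩))

lemma linearMap_mul_mem_quadratics (L L' : (ι → ℝ) →ₗ[ℝ] ℝ) : ⇑L * ⇑L' ∈ quadratics ι := by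
  classical
  cases nonempty_fintype ι
  rw [linearMap_eq_sum_smul L, linearMap_eq_sum_smul L', Finset.sum_mul_sum]
  refine sum_mem fun w _ => sum_mem fun w' _ => ?_
  rw [smul_mul_smul_comm]
  exact Submodule.smul_mem _ _ (Submodule.subset_span (Or.inr ⟨(w, w'), rfl⟩))

end Quadratics

variable [Fintype ι]

lemma isJet_rowRiskJet {r : ℕ} {f : ℕ → ℝ → ℝ} (hf : IsJet r f) (n : ℝ) (c v y : ι → ℝ) :
    IsJet r (rowRiskJet n f c v y) := by
  have dz : ∀ w t, HasDerivAt (fun t : ℝ => (v + t • y) w) (y w) t := fun w t =>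
    (((hasDerivAt_id t).mul_const (y w)).const_add (v w)).congr_deriv (one_mul _)
  intro k hk t
  rw [hasDerivAt_pi]
  intro w
  have df := (hf k hk _).comp t (dz w t)
  cases k with
  | zero => exact ((df.div_const n).const_add (c w)).congr_deriv (by simp [rowRiskJet])
  | succ k =>
    refine ((df.mul_const (y w ^ (k + 1))).div_const n).congr_deriv ?_
    simp only [rowRiskJet]
    ring

lemma gibbs_mul_sq_mem_quadratics (E a : ι → ℝ) :
    (fun y : ι → ℝ => gibbs E (a * y ^ 2)) ∈ quadratics ι := by
  have hsum : (fun y : ι → ℝ => gibbs E (a * y ^ 2))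
      = ∑ w, (gibbsWeight E w * a w) • fun y : ι → ℝ => y w * y w := by
    funext y
    simp only [gibbs_apply, Finset.sum_apply, Pi.smul_apply, smul_eq_mul, Pi.mul_apply, sq,
      mul_assoc]
  rw [hsum]
  exact sum_mem fun w _ => Submodule.smul_mem _ _ (Submodule.subset_span (Or.inr ⟨(w, w), rfl⟩))

lemma compJet_softminJet_rowRiskJet_mem_quadratics (n β : ℝ) (f g : ℕ → ℝ → ℝ) (c v : ι → ℝ) :
    (fun y => compJet g (softminJet β (rowRiskJet n f c v y)) 1 0
      + compJet g (softminJet β (rowRiskJet n f c v y)) 2 0 / 2) ∈ quadratics ι := by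
  set E := -β • rowRisk n (f 0) c v
  set G := fun k => g k (softmin β (rowRisk n (f 0) c v))
  set a := fun k w => f k (v w) / n
  set L := (gibbs E).comp (LinearMap.mulLeft ℝ (a 1))
  have hexpand : (fun y => compJet g (softminJet β (rowRiskJet n f c v y)) 1 0
      + compJet g (softminJet β (rowRiskJet n f c v y)) 2 0 / 2)
      = G 1 • ⇑L + ((G 2 + β * G 1) / 2) • (⇑L * ⇑L)
        + (G 1 / 2) • (fun y : ι → ℝ => gibbs E ((a 2 - β • a 1 ^ 2) * y ^ 2)) := by
    funext y
    have hjet0 : rowRiskJet n f c v y 0 0 = rowRisk n (f 0) c v := by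
      simp only [rowRiskJet, zero_smul, add_zero]
    have hjet : ∀ k, rowRiskJet n f c v y (k + 1) 0 = a (k + 1) * y ^ (k + 1) := fun k => by
      funext w
      simp only [rowRiskJet, zero_smul, add_zero, a, Pi.mul_apply, Pi.pow_apply]
      ring
    have hjet1 : rowRiskJet n f c v y 1 0 = a 1 * y := (hjet 0).trans (by rw [zero_add, pow_one])
    have hjet2 : rowRiskJet n f c v y 2 0 = a 2 * y ^ 2 := hjet 1
    simp only [compJet, softminJet, gibbsCov, hjet0, hjet1, hjet2, ← sq, mul_pow, sub_mul,
      map_sub, smul_mul_assoc, map_smul, Pi.add_apply, Pi.smul_apply, Pi.pow_apply, smul_eq_mul]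
    simp only [L, LinearMap.comp_apply, LinearMap.mulLeft_apply, G, E]
    ring
  rw [hexpand]
  exact add_mem (add_mem (Submodule.smul_mem _ _ (linearMap_mem_quadratics L))
    (Submodule.smul_mem _ _ (linearMap_mul_mem_quadratics L L)))
    (Submodule.smul_mem _ _ (gibbs_mul_sq_mem_quadratics _ _))

omit [Fintype ι] in
lemma abs_rowRiskJet_succ_le {n lam A Y : ℝ} (hn : 0 < n) (hlam : 1 ≤ lam) {f : ℕ → ℝ → ℝ}
    {c v y : ι → ℝ} {k : ℕ} {t : ℝ} {w : ι} (hA : |f (k + 1) ((v + t • y) w)| ≤ A)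
    (hY : |y w| ≤ Y) :
    |rowRiskJet n f c v y (k + 1) t w| ≤ A * ((n * lam) ^ k * (Y / n) ^ (k + 1)) := by
  have hA0 : 0 ≤ A := (abs_nonneg _).trans hA
  have hY0 : 0 ≤ Y := (abs_nonneg _).trans hY
  calc |rowRiskJet n f c v y (k + 1) t w|
      = |f (k + 1) ((v + t • y) w)| * (|y w| ^ (k + 1) / n) := by
        rw [rowRiskJet, abs_div, abs_mul, abs_pow, abs_of_pos hn, mul_div_assoc]
    _ ≤ A * (Y ^ (k + 1) / n) := by gcongr
    _ ≤ A * (lam ^ k * (Y ^ (k + 1) / n)) := by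
        gcongr
        exact le_mul_of_one_le_left (by positivity) (one_le_pow₀ hlam)
    _ = A * ((n * lam) ^ k * (Y / n) ^ (k + 1)) := by
        rw [mul_pow, div_pow, pow_succ n]
        field_simp

variable [Nonempty ι]

lemma abs_compJet_softminJet_rowRiskJet_three_le {n lam D K : ℝ} (hn : 1 ≤ n) (hlam : 1 ≤ lam)
    (hD : 1 ≤ D) {f g : ℕ → ℝ → ℝ} (hf2 : ∀ x, |f 2 x| ≤ D) (hf3 : ∀ x, |f 3 x| ≤ D)
    (hgK : ∀ k ≤ 3, ∀ x, |g k x| ≤ K) (c v : ι → ℝ) {y : ι → ℝ} {Y : ℝ} (hy : ∀ w, |y w| ≤ Y)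
    (t : ℝ) :
    |compJet g (softminJet (n * lam) (rowRiskJet n f c v y)) 3 t|
      ≤ 23 * K * D * lam ^ 2 * (Y ^ 3 / n) * gibbs (-(n * lam) • rowRisk n (f 0) c (v + t • y))
          (fun w => (1 + |f 1 ((v + t • y) w)|) ^ 3) := by
  set β := n * lam
  have hn0 : 0 < n := by positivity
  have hβ : 1 ≤ β := one_le_mul_of_one_le_of_one_le hn hlam
  have hY : 0 ≤ Y := (abs_nonneg _).trans (hy (Classical.arbitrary ι))
  set b : ι → ℝ := fun w => 1 + |f 1 ((v + t • y) w)|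
  have hb : ∀ w, 1 ≤ b w := fun w => le_add_of_nonneg_right (abs_nonneg _)
  have hDb : ∀ w (k : ℕ), D ≤ D * b w ^ k := fun w k =>
    le_mul_of_one_le_right (by positivity) (one_le_pow₀ (hb w))
  have hthree := abs_compJet_softminJet_three_le hβ (by positivity : 0 ≤ Y / n) hD
    (fun w => zero_le_one.trans (hb w)) (H := rowRiskJet n f c v y) (t := t)
    (fun w => (abs_rowRiskJet_succ_le hn0 hlam
      (le_add_of_nonneg_left zero_le_one : _ ≤ b w) (hy w)).trans_eq (by simp [b, mul_comm]))
    (fun w => (abs_rowRiskJet_succ_le hn0 hlam ((hf2 _).trans (hDb w 2)) (hy w)).trans_eq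
      (by simp [β]; ring))
    (fun w => (abs_rowRiskJet_succ_le hn0 hlam ((hf3 _).trans (hDb w 3)) (hy w)).trans_eq
      (by simp [β]; ring)) hgK
  calc _ ≤ 23 * K * D * (β ^ 2 * (Y / n) ^ 3) * gibbs (-β • rowRiskJet n f c v y 0 t) (b ^ 3) :=
        hthree
    _ = 23 * K * D * lam ^ 2 * (Y ^ 3 / n) * gibbs (-β • rowRiskJet n f c v y 0 t) (b ^ 3) := by
        simp only [β]
        field_simp
    _ = _ := rfl

theorem exists_quadratic_approx_softmin {n lam D K : ℝ} (hn : 1 ≤ n) (hlam : 1 ≤ lam) (hD : 1 ≤ D)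
    {f : ℕ → ℝ → ℝ} (hf : IsJet 3 f) (hf2 : ∀ x, |f 2 x| ≤ D) (hf3 : ∀ x, |f 3 x| ≤ D)
    {g : ℕ → ℝ → ℝ} (hg : IsJet 3 g) (hgK : ∀ k ≤ 3, ∀ x, |g k x| ≤ K) (c v : ι → ℝ) :
    ∃ q ∈ quadratics ι, ∀ (y : ι → ℝ) (Y Q : ℝ), (∀ w, |y w| ≤ Y) →
      (∀ t ∈ Set.Icc (0 : ℝ) 1, gibbs (-(n * lam) • rowRisk n (f 0) c (v + t • y))
          (fun w => (1 + |f 1 ((v + t • y) w)|) ^ 3) ≤ Q) →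
      |g 0 (softmin (n * lam) (rowRisk n (f 0) c (v + y)))
        - g 0 (softmin (n * lam) (rowRisk n (f 0) c v)) - q y|
        ≤ 23 * K * D * lam ^ 2 * (Y ^ 3 / n) * Q := by
  refine ⟨_, compJet_softminJet_rowRiskJet_mem_quadratics n (n * lam) f g c v,
    fun y Y Q hy hQ => ?_⟩
  have hY : 0 ≤ Y := (abs_nonneg _).trans (hy (Classical.arbitrary ι))
  have hK : 0 ≤ K := (abs_nonneg _).trans (hgK 0 (by norm_num) 0)
  have hΦ : IsJet 3 (compJet g (softminJet (n * lam) (rowRiskJet n f c v y))) :=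
    hg.compJet (isJet_softminJet (by positivity) (isJet_rowRiskJet hf n c v y))
  have hthird : ∀ t ∈ Set.Icc (0 : ℝ) 1,
      |compJet g (softminJet (n * lam) (rowRiskJet n f c v y)) 3 t|
        ≤ 23 * K * D * lam ^ 2 * (Y ^ 3 / n) * Q := fun t ht =>
    (abs_compJet_softminJet_rowRiskJet_three_le hn hlam hD hf2 hf3 hgK c v hy t).trans <| by
      gcongr
      exact hQ t ht
  have htaylor := hΦ.abs_taylor_two_le hthird
  simp only [compJet, softminJet, rowRiskJet, zero_smul, one_smul, add_zero] at htaylor ⊢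
  exact htaylor

end RowTaylor

section Lindeberg

variable {J E : Type*} [MeasurableSpace E]

/-- The functions integrated to the same value by `μ` and `ν`: the part of a Taylor expansion which
does not contribute when a random vector is replaced by another one. -/
def matchedFunctions (μ ν : Measure E) : Submodule ℝ (E → ℝ) where
  carrier := {T | Integrable T μ ∧ Integrable T ν ∧ ∫ y, T y ∂μ = ∫ y, T y ∂ν}
  zero_mem' := ⟨integrable_zero _ _ _, integrable_zero _ _ _, by simp⟩
  add_mem' := by
    rintro S T ⟨hSμ, hSν, hS⟩ ⟨hTμ, hTν, hT⟩
    exact ⟨hSμ.add hTμ, hSν.add hTν, by rw [integral_add' hSμ hTμ, integral_add' hSν hTν, hS, hT]⟩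
  smul_mem' := by
    rintro c T ⟨hTμ, hTν, hT⟩
    exact ⟨hTμ.smul c, hTν.smul c, by simp only [Pi.smul_apply, integral_smul, hT]⟩

lemma integrable_of_measurable_of_abs_le {μ : Measure E} [IsFiniteMeasure μ] {f : E → ℝ}
    (hf : Measurable f) {K : ℝ} (hK : ∀ x, |f x| ≤ K) : Integrable f μ :=
  .of_bound hf.aestronglyMeasurable K (Eventually.of_forall hK)

lemma abs_integral_sub_const_sub_integral_le {μ : Measure E} [IsProbabilityMeasure μ]
    {F T r : E → ℝ} {c : ℝ} (hF : Integrable F μ) (hT : Integrable T μ) (hr : Integrable r μ)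
    (h : ∀ y, |F y - c - T y| ≤ r y) :
    |∫ y, F y ∂μ - c - ∫ y, T y ∂μ| ≤ ∫ y, r y ∂μ := by
  have hc : ∫ y, (F y - c - T y) ∂μ = ∫ y, F y ∂μ - c - ∫ y, T y ∂μ := by
    rw [integral_sub (by exact hF.sub (integrable_const c)) hT,
      integral_sub hF (integrable_const c)]
    simp
  rw [← hc]
  exact abs_integral_le_integral_abs.trans (integral_mono_of_nonneg
    (Eventually.of_forall fun y => abs_nonneg _) hr (Eventually.of_forall h))

lemma abs_integral_sub_le_of_mem_matchedFunctions {μ ν : Measure E} [IsProbabilityMeasure μ]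
    [IsProbabilityMeasure ν] {F T r : E → ℝ} {c : ℝ} (hFμ : Integrable F μ) (hFν : Integrable F ν)
    (hT : T ∈ matchedFunctions μ ν) (hrμ : Integrable r μ) (hrν : Integrable r ν)
    (h : ∀ y, |F y - c - T y| ≤ r y) :
    |∫ y, F y ∂μ - ∫ y, F y ∂ν| ≤ ∫ y, r y ∂μ + ∫ y, r y ∂ν := by
  obtain ⟨hTμ, hTν, hTeq⟩ := hT
  have hμ := abs_integral_sub_const_sub_integral_le hFμ hTμ hrμ h
  have hν := abs_integral_sub_const_sub_integral_le hFν hTν hrν h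
  rw [hTeq] at hμ
  rw [abs_le] at hμ hν ⊢
  constructor <;> linarith

variable [DecidableEq J]

instance isProbabilityMeasure_update (κ : J → Measure E) [∀ j, IsProbabilityMeasure (κ j)] (a : J)
    (μ : Measure E) [IsProbabilityMeasure μ] (j : J) :
    IsProbabilityMeasure (Function.update κ a μ j) := by
  obtain rfl | h := eq_or_ne j a
  · rwa [Function.update_self]
  · rw [Function.update_of_ne h]
    infer_instance

variable [Fintype J]

lemma map_update_pi (κ : J → Measure E) [∀ j, IsProbabilityMeasure (κ j)] (a : J)
    (μ : Measure E) [IsProbabilityMeasure μ] :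
    ((Measure.pi κ).prod μ).map (fun z => Function.update z.1 a z.2)
      = Measure.pi (Function.update κ a μ) := by
  refine (Measure.pi_eq fun s hs => ?_).symm
  have hpre : (fun z : (J → E) × E => Function.update z.1 a z.2) ⁻¹' (Set.univ.pi s)
      = (Set.univ.pi (Function.update s a Set.univ)) ×ˢ (s a) := by
    ext z
    simp only [Set.mem_preimage, Set.mem_univ_pi, Set.mem_prod,
      Function.forall_update_iff s fun j t => z.1 j ∈ t,
      Function.forall_update_iff z.1 fun j x => x ∈ s j]
    simp [and_comm]
  rw [Measure.map_apply measurable_update' (MeasurableSet.univ_pi hs), hpre, Measure.prod_prod,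
    Measure.pi_pi, Fintype.prod_eq_mul_prod_compl a, Fintype.prod_eq_mul_prod_compl a]
  simp only [Function.update_self, measure_univ, one_mul]
  rw [mul_comm]
  congr 1
  refine Finset.prod_congr rfl fun j hj => ?_
  have hja : j ≠ a := by simpa using hj
  rw [Function.update_of_ne hja, Function.update_of_ne hja]

lemma integral_pi_update (κ : J → Measure E) [∀ j, IsProbabilityMeasure (κ j)] (a : J)
    (μ : Measure E) [IsProbabilityMeasure μ] {f : (J → E) → ℝ}
    (hf : Integrable f (Measure.pi (Function.update κ a μ))) :
    ∫ x, f x ∂(Measure.pi (Function.update κ a μ))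
      = ∫ x, ∫ y, f (Function.update x a y) ∂μ ∂(Measure.pi κ) := by
  rw [← map_update_pi] at hf ⊢
  rw [integral_map measurable_update'.aemeasurable hf.1]
  exact integral_prod _ (hf.comp_measurable measurable_update')

lemma abs_integral_pi_update_sub_le (κ : J → Measure E) [∀ j, IsProbabilityMeasure (κ j)] (a : J)
    {μ ν : Measure E} [IsProbabilityMeasure μ] [IsProbabilityMeasure ν]
    {f : (J → E) → ℝ} (hf : Measurable f) {K : ℝ} (hK : ∀ x, |f x| ≤ K)
    {U W : E → ℝ} {V : (J → E) → ℝ} {v : ℝ} (hU : 0 ≤ U)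
    (hUμ : Integrable U μ) (hUν : Integrable U ν) (hWμ : Integrable W μ) (hWν : Integrable W ν)
    (hV : Integrable V (Measure.pi κ)) (hVv : ∫ x, V x ∂(Measure.pi κ) ≤ v)
    (hT : ∀ x, ∃ T ∈ matchedFunctions μ ν, ∃ c, ∀ y,
      |f (Function.update x a y) - c - T y| ≤ U y * V x + W y) :
    |∫ x, f x ∂(Measure.pi (Function.update κ a μ))
        - ∫ x, f x ∂(Measure.pi (Function.update κ a ν))|
      ≤ (∫ y, U y ∂μ + ∫ y, U y ∂ν) * v + (∫ y, W y ∂μ + ∫ y, W y ∂ν) := by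
  have hrow (ρ : Measure E) [IsProbabilityMeasure ρ] (x : J → E) :
      Integrable (fun y => f (Function.update x a y)) ρ :=
    integrable_of_measurable_of_abs_le (hf.comp (measurable_update x)) fun y => hK _
  have houter (ρ : Measure E) [IsProbabilityMeasure ρ] :
      Integrable (fun x => ∫ y, f (Function.update x a y) ∂ρ) (Measure.pi κ) :=
    (integrable_of_measurable_of_abs_le (hf.comp measurable_update')
      fun z => hK _ : Integrable _ ((Measure.pi κ).prod ρ)).integral_prod_left
  have hinner (x : J → E) :
      |∫ y, f (Function.update x a y) ∂μ - ∫ y, f (Function.update x a y) ∂ν|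
        ≤ (∫ y, U y ∂μ + ∫ y, U y ∂ν) * V x + (∫ y, W y ∂μ + ∫ y, W y ∂ν) := by
    obtain ⟨T, hTm, c, hc⟩ := hT x
    refine (abs_integral_sub_le_of_mem_matchedFunctions (hrow μ x) (hrow ν x) hTm
      ((hUμ.mul_const _).add hWμ) ((hUν.mul_const _).add hWν) hc).trans_eq ?_
    simp only [Pi.add_apply]
    rw [integral_add (hUμ.mul_const _) hWμ, integral_add (hUν.mul_const _) hWν,
      integral_mul_const, integral_mul_const]
    ring
  rw [integral_pi_update κ a μ (integrable_of_measurable_of_abs_le hf hK),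
    integral_pi_update κ a ν (integrable_of_measurable_of_abs_le hf hK),
    ← integral_sub (houter μ) (houter ν)]
  calc _ ≤ ∫ x, ((∫ y, U y ∂μ + ∫ y, U y ∂ν) * V x + (∫ y, W y ∂μ + ∫ y, W y ∂ν))
        ∂(Measure.pi κ) :=
      abs_integral_le_integral_abs.trans (integral_mono_of_nonneg
        (Eventually.of_forall fun x => abs_nonneg _)
        ((hV.const_mul _).add (integrable_const _)) (Eventually.of_forall hinner))
    _ = (∫ y, U y ∂μ + ∫ y, U y ∂ν) * ∫ x, V x ∂(Measure.pi κ)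
        + (∫ y, W y ∂μ + ∫ y, W y ∂ν) := by
      rw [integral_add (hV.const_mul _) (integrable_const _), integral_const_mul, integral_const]
      simp
    _ ≤ _ := by
      have hU0 : 0 ≤ ∫ y, U y ∂μ + ∫ y, U y ∂ν :=
        add_nonneg (integral_nonneg hU) (integral_nonneg hU)
      gcongr

/-- **Lindeberg's replacement principle**: exchange the factors of `Measure.pi μ` for those of
`Measure.pi ν` one at a time. -/
theorem abs_integral_pi_sub_le (μ ν : J → Measure E) [∀ j, IsProbabilityMeasure (μ j)]
    [∀ j, IsProbabilityMeasure (ν j)] {f : (J → E) → ℝ} (hf : Measurable f) {K : ℝ}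
    (hK : ∀ x, |f x| ≤ K) {U W : J → E → ℝ} {V : J → (J → E) → ℝ} {v : J → ℝ} (hU : 0 ≤ U)
    (hUμ : ∀ a, Integrable (U a) (μ a)) (hUν : ∀ a, Integrable (U a) (ν a))
    (hWμ : ∀ a, Integrable (W a) (μ a)) (hWν : ∀ a, Integrable (W a) (ν a))
    (hV : ∀ (κ : J → Measure E), (∀ j, IsProbabilityMeasure (κ j)) → (∀ j, κ j = μ j ∨ κ j = ν j) →
      ∀ a, Integrable (V a) (Measure.pi κ) ∧ ∫ x, V a x ∂(Measure.pi κ) ≤ v a)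
    (hT : ∀ a x, ∃ T ∈ matchedFunctions (μ a) (ν a), ∃ c, ∀ y,
      |f (Function.update x a y) - c - T y| ≤ U a y * V a x + W a y) :
    |∫ x, f x ∂(Measure.pi μ) - ∫ x, f x ∂(Measure.pi ν)|
      ≤ ∑ a, ((∫ y, U a y ∂(μ a) + ∫ y, U a y ∂(ν a)) * v a
        + (∫ y, W a y ∂(μ a) + ∫ y, W a y ∂(ν a))) := by
  suffices h : ∀ s : Finset J,
      |∫ x, f x ∂(Measure.pi μ) - ∫ x, f x ∂(Measure.pi (s.piecewise ν μ))|
        ≤ ∑ a ∈ s, ((∫ y, U a y ∂(μ a) + ∫ y, U a y ∂(ν a)) * v a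
          + (∫ y, W a y ∂(μ a) + ∫ y, W a y ∂(ν a))) by
    simpa using h Finset.univ
  intro s
  induction s using Finset.induction_on with
  | empty => simp
  | insert a s ha ih =>
    have hprob (j : J) : IsProbabilityMeasure (s.piecewise ν μ j) :=
      s.piecewise_cases ν μ (IsProbabilityMeasure ·) inferInstance inferInstance
    obtain ⟨hVint, hVle⟩ := hV (s.piecewise ν μ) hprob
      (fun j => s.piecewise_cases ν μ (fun ρ => ρ = μ j ∨ ρ = ν j) (.inr rfl) (.inl rfl)) a
    have hstep := abs_integral_pi_update_sub_le (s.piecewise ν μ) a hf hK (hU a) (hUμ a) (hUν a)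
      (hWμ a) (hWν a) hVint hVle (hT a)
    have hμ : Function.update (s.piecewise ν μ) a (μ a) = s.piecewise ν μ := by
      rw [← s.piecewise_eq_of_notMem ν μ ha, Function.update_eq_self]
    rw [hμ] at hstep
    rw [Finset.sum_insert ha, Finset.piecewise_insert, add_comm]
    exact (abs_sub_le _ _ _).trans (add_le_add ih hstep)

end Lindeberg

section FourthMoment

variable {Ω : Type*} [MeasurableSpace Ω] {P : Measure Ω}

lemma integrable_pow_of_memLp [IsFiniteMeasure P] {f : Ω → ℝ} {m k : ℕ} (hf : MemLp f m P)
    (hk : k ≤ m) : Integrable (fun ω => f ω ^ k) P := by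
  have hfk : MemLp f k P := hf.mono_exponent (by exact_mod_cast hk)
  refine (integrable_norm_iff (hfk.aestronglyMeasurable.pow k)).1 ?_
  simpa only [Pi.pow_apply, norm_pow] using hfk.integrable_norm_pow'

lemma integral_add_pow_of_indepFun [IsFiniteMeasure P] {X Y : Ω → ℝ} (h : X ⟂ᵢ[P] Y) {m : ℕ}
    (hX : MemLp X m P) (hY : MemLp Y m P) :
    ∫ ω, (X ω + Y ω) ^ m ∂P = ∑ k ∈ Finset.range (m + 1),
      (∫ ω, X ω ^ k ∂P) * (∫ ω, Y ω ^ (m - k) ∂P) * m.choose k := by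
  have hXY (k : ℕ) : (fun ω => X ω ^ k) ⟂ᵢ[P] (fun ω => Y ω ^ (m - k)) :=
    h.comp (measurable_id.pow_const k) (measurable_id.pow_const (m - k))
  simp only [add_pow]
  rw [integral_finsetSum]
  · refine Finset.sum_congr rfl fun k _ => ?_
    rw [integral_mul_const, (hXY k).integral_fun_mul_eq_mul_integral
      (hX.aestronglyMeasurable.pow k) (hY.aestronglyMeasurable.pow (m - k))]
  · exact fun k hk => ((hXY k).integrable_mul
      (integrable_pow_of_memLp hX (Nat.lt_succ_iff.1 (Finset.mem_range.1 hk)))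
      (integrable_pow_of_memLp hY (m.sub_le k))).mul_const _

variable [IsProbabilityMeasure P] {J : Type*} {X : J → Ω → ℝ}

lemma integral_sum_sq_of_iIndepFun (hX : iIndepFun X P) (hm : ∀ j, Measurable (X j))
    (hL : ∀ j, MemLp (X j) (2 : ℕ) P) (h0 : ∀ j, ∫ ω, X j ω ∂P = 0) (s : Finset J) :
    ∫ ω, (∑ j ∈ s, X j ω) ^ 2 ∂P = ∑ j ∈ s, ∫ ω, X j ω ^ 2 ∂P := by
  classical
  induction s using Finset.induction_on with
  | empty => simp
  | insert a s ha ih =>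
    have hind := (hX.indepFun_finsetSum_of_notMem hm ha).symm
    simp only [Finset.sum_fn] at hind
    simp only [Finset.sum_insert ha]
    rw [integral_add_pow_of_indepFun hind (hL a) (memLp_finsetSum s fun j _ => hL j), ← ih]
    simp [Finset.sum_range_succ, h0, add_comm]

lemma integral_sum_pow_four_le_of_iIndepFun (hX : iIndepFun X P) (hm : ∀ j, Measurable (X j))
    (hL : ∀ j, MemLp (X j) (4 : ℕ) P) (h0 : ∀ j, ∫ ω, X j ω ∂P = 0) (s : Finset J) :
    ∫ ω, (∑ j ∈ s, X j ω) ^ 4 ∂P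
      ≤ ∑ j ∈ s, ∫ ω, X j ω ^ 4 ∂P + 3 * (∑ j ∈ s, ∫ ω, X j ω ^ 2 ∂P) ^ 2 := by
  classical
  induction s using Finset.induction_on with
  | empty => simp
  | insert a s ha ih =>
    have hind := (hX.indepFun_finsetSum_of_notMem hm ha).symm
    simp only [Finset.sum_fn] at hind
    have hS0 : ∫ ω, ∑ j ∈ s, X j ω ∂P = 0 := by
      rw [integral_finsetSum _ fun j _ => by
        simpa using integrable_pow_of_memLp (hL j) (show 1 ≤ 4 by norm_num)]
      exact Finset.sum_eq_zero fun j _ => h0 j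
    have hS2 := integral_sum_sq_of_iIndepFun hX hm
      (fun j => (hL j).mono_exponent (by norm_num)) h0 s
    have hfour : ∫ ω, (X a ω + ∑ j ∈ s, X j ω) ^ 4 ∂P
        = ∫ ω, X a ω ^ 4 ∂P + ∫ ω, (∑ j ∈ s, X j ω) ^ 4 ∂P
          + 6 * ((∫ ω, X a ω ^ 2 ∂P) * ∑ j ∈ s, ∫ ω, X j ω ^ 2 ∂P) := by
      rw [integral_add_pow_of_indepFun hind (hL a) (memLp_finsetSum s fun j _ => hL j)]
      simp [Finset.sum_range_succ, Nat.choose, h0, hS0, hS2]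
      ring
    simp only [Finset.sum_insert ha]
    rw [hfour]
    nlinarith [sq_nonneg (∫ ω, X a ω ^ 2 ∂P)]

end FourthMoment

section BlockReplacement

lemma indepFun_pi_of_dependsOn {J E β γ : Type*} [Fintype J] [MeasurableSpace E]
    [MeasurableSpace β] [MeasurableSpace γ] [Nonempty E] (κ : J → Measure E)
    [∀ j, IsProbabilityMeasure (κ j)] {F : (J → E) → β} {G : (J → E) → γ} (hF : Measurable F)
    (hG : Measurable G) {S T : Finset J} (hST : Disjoint S T) (hFS : DependsOn F S)
    (hGT : DependsOn G T) : F ⟂ᵢ[Measure.pi κ] G := by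
  classical
  have hcoord : iIndepFun (fun j (x : J → E) => x j) (Measure.pi κ) :=
    iIndepFun_pi (X := fun _ y => y) fun _ => aemeasurable_id
  let x₀ : J → E := fun _ => Classical.arbitrary E
  have hind := (hcoord.indepFun_finset S T hST measurable_pi_apply).comp
    (hF.comp (measurable_updateFinset (x := x₀))) (hG.comp (measurable_updateFinset (x := x₀)))
  convert hind using 1 <;> funext x
  · exact hFS fun j hj => by simp_all [Function.updateFinset]
  · exact hGT fun j hj => by simp_all [Function.updateFinset]

section GibbsMeasurability

variable {ι F : Type*} [Fintype ι] [MeasurableSpace F] {H : F → ι → ℝ}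

lemma measurable_gibbsWeight (hH : Measurable H) (v : ι) :
    Measurable fun x => gibbsWeight (H x) v := by
  rw [measurable_pi_iff] at hH
  exact (hH v).exp.div (Finset.measurable_fun_sum _ fun v _ => (hH v).exp)

lemma measurable_softmin (β : ℝ) (hH : Measurable H) : Measurable fun x => softmin β (H x) := by
  rw [measurable_pi_iff] at hH
  exact ((Finset.measurable_fun_sum _ fun v _ => ((hH v).const_mul (-β)).exp).log).const_mul _

lemma integral_gibbs_le_of_indepFun [Nonempty ι] {P : Measure F} [IsProbabilityMeasure P]
    {f : F → ι → ℝ} (hH : Measurable H) (hHf : H ⟂ᵢ[P] f)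
    (hf : ∀ v, Integrable (fun x => f x v) P) {Z : ℝ} (hZ : ∀ v, ∫ x, f x v ∂P ≤ Z) :
    Integrable (fun x => gibbs (H x) (f x)) P ∧ ∫ x, gibbs (H x) (f x) ∂P ≤ Z := by
  have hw (v : ι) : Integrable (fun x => gibbsWeight (H x) v) P :=
    integrable_of_measurable_of_abs_le (measurable_gibbsWeight hH v) (K := 1) fun x => by
      rw [abs_of_nonneg (gibbsWeight_nonneg _ _), ← sum_gibbsWeight (H x)]
      exact Finset.single_le_sum (fun v _ => gibbsWeight_nonneg (H x) v) (Finset.mem_univ v)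
  have hind (v : ι) : (fun x => gibbsWeight (H x) v) ⟂ᵢ[P] (fun x => f x v) :=
    hHf.comp (φ := fun E => gibbsWeight E v) (measurable_gibbsWeight measurable_id v)
      (measurable_pi_apply v)
  have hint (v : ι) : Integrable (fun x => gibbsWeight (H x) v * f x v) P :=
    (hind v).integrable_mul (hw v) (hf v)
  simp only [gibbs_apply]
  refine ⟨integrable_finsetSum _ fun v _ => hint v, ?_⟩
  calc ∫ x, ∑ v, gibbsWeight (H x) v * f x v ∂P
      = ∑ v, (∫ x, gibbsWeight (H x) v ∂P) * ∫ x, f x v ∂P := by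
        rw [integral_finsetSum _ fun v _ => hint v]
        exact Finset.sum_congr rfl fun v _ =>
          (hind v).integral_fun_mul_eq_mul_integral (hw v).1 (hf v).1
    _ ≤ ∑ v, (∫ x, gibbsWeight (H x) v ∂P) * Z := by
        gcongr with v
        · exact integral_nonneg fun x => gibbsWeight_nonneg _ _
        · exact hZ v
    _ = Z := by
        rw [← Finset.sum_mul, ← integral_finsetSum _ fun v _ => hw v]
        simp [sum_gibbsWeight]

end GibbsMeasurability

/-- Losses given with three derivatives, of which the second and third are bounded by `D`, while
the first is dominated by an increasing function `Dom i` of the loss itself. This monotonicity makes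
Gibbs averages of `Dom i` over the risk at most those over the risk of the other rows; `m` is the
growth exponent of `Dom i`. -/
structure SmoothLosses {I : Type*} (ℓ : I → ℕ → ℝ → ℝ) (Dom : I → ℝ → ℝ) (D : ℝ) (m : ℕ)
    (A : I → ℝ) : Prop where
  isJet : ∀ i, IsJet 3 (ℓ i)
  abs_two_le : ∀ i x, |ℓ i 2 x| ≤ D
  abs_three_le : ∀ i x, |ℓ i 3 x| ≤ D
  pow_le : ∀ i x, (1 + |ℓ i 1 x|) ^ 3 ≤ Dom i x
  monovary : ∀ i, Monovary (Dom i) (ℓ i 0)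
  le : ∀ i x, Dom i x ≤ A i * (1 + |x| ^ m)

lemma SmoothLosses.nonneg {I : Type*} {ℓ : I → ℕ → ℝ → ℝ} {Dom : I → ℝ → ℝ} {D : ℝ} {m : ℕ}
    {A : I → ℝ} (hℓ : SmoothLosses ℓ Dom D m A) (i : I) : 0 ≤ A i := by
  have h : 0 ≤ A i * (1 + |0| ^ m) :=
    (by positivity : (0 : ℝ) ≤ (1 + |ℓ i 1 0|) ^ 3).trans ((hℓ.pow_le i 0).trans (hℓ.le i 0))
  exact nonneg_of_mul_nonneg_left h (by positivity)

lemma SmoothLosses.measurable {I : Type*} {ℓ : I → ℕ → ℝ → ℝ} {Dom : I → ℝ → ℝ} {D : ℝ} {m : ℕ}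
    {A : I → ℝ} (hℓ : SmoothLosses ℓ Dom D m A) (i : I) : Measurable (ℓ i 0) :=
  ((hℓ.isJet i).continuous (by norm_num)).measurable

/-- Moment bounds for the law `κ` of the scores `y v` of a block: `t` and `t'` bound the moments of
orders `3` and `3 + m` of the largest score, `s₂` and `s₄` those of orders `2` and `4` of each
score. -/
structure BlockMoments {ι : Type*} [Fintype ι] (m : ℕ) (κ : Measure (ι → ℝ)) (t t' s₂ s₄ : ℝ) :
    Prop where
  integrable_three : Integrable (fun y => ‖y‖ ^ 3) κ
  integral_three_le : ∫ y, ‖y‖ ^ 3 ∂κ ≤ t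
  integrable_add : Integrable (fun y => ‖y‖ ^ (3 + m)) κ
  integral_add_le : ∫ y, ‖y‖ ^ (3 + m) ∂κ ≤ t'
  memLp_four : ∀ v, MemLp (fun y => y v) (4 : ℕ) κ
  integral_eq_zero : ∀ v, ∫ y, y v ∂κ = 0
  integral_sq_le : ∀ v, ∫ y, y v ^ 2 ∂κ ≤ s₂
  integral_pow_four_le : ∀ v, ∫ y, y v ^ 4 ∂κ ≤ s₄

variable {I B ι : Type*} [Fintype I] [Fintype B]

/-- The penalised empirical risk as a function of the scores `x (i, b) v`, the contribution of the
block `b` of the row `i` to the prediction of the parameter `v`. -/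
noncomputable def blockRisk (n : ℝ) (ℓ : I → ℝ → ℝ) (c : ι → ℝ) (x : I × B → ι → ℝ) (v : ι) : ℝ :=
  c v + (∑ i, ℓ i (∑ b, x (i, b) v)) / n

/-- The part of the risk that comes from the rows other than `i`. -/
noncomputable def restRisk [DecidableEq I] (n : ℝ) (ℓ : I → ℝ → ℝ) (c : ι → ℝ) (i : I)
    (x : I × B → ι → ℝ) (v : ι) : ℝ :=
  c v + (∑ i' ∈ Finset.univ.erase i, ℓ i' (∑ b, x (i', b) v)) / n

/-- The predictions for the row `a.1` without the contribution of its block `a.2`. -/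
def restRow {I B ι : Type*} [Fintype B] [DecidableEq B] (a : I × B) (x : I × B → ι → ℝ) (v : ι) :
    ℝ :=
  ∑ b ∈ Finset.univ.erase a.2, x (a.1, b) v

lemma blockRisk_update [DecidableEq I] [DecidableEq B] (n : ℝ) (ℓ : I → ℝ → ℝ) (c : ι → ℝ)
    (a : I × B) (x : I × B → ι → ℝ) (y : ι → ℝ) :
    blockRisk n ℓ c (Function.update x a y)
      = rowRisk n (ℓ a.1) (restRisk n ℓ c a.1 x) (restRow a x + y) := by
  obtain ⟨i, b⟩ := a
  have hother : ∀ v, ∑ i' ∈ Finset.univ.erase i,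
      ℓ i' (∑ b', Function.update x (i, b) y (i', b') v)
        = ∑ i' ∈ Finset.univ.erase i, ℓ i' (∑ b', x (i', b') v) := fun v =>
    Finset.sum_congr rfl fun i' hi' => by
      simp [Function.update_of_ne, Finset.ne_of_mem_erase hi']
  have hrow : ∀ v, ∑ b' ∈ Finset.univ.erase b, Function.update x (i, b) y (i, b') v
      = ∑ b' ∈ Finset.univ.erase b, x (i, b') v := fun v =>
    Finset.sum_congr rfl fun b' hb' => by
      simp [Function.update_of_ne, Finset.ne_of_mem_erase hb']
  funext v
  simp only [blockRisk, rowRisk, restRisk, restRow, Pi.add_apply]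
  rw [← Finset.sum_erase_add _ _ (Finset.mem_univ i),
    ← Finset.sum_erase_add _ _ (Finset.mem_univ b), hother, hrow, Function.update_self]
  ring

lemma measurable_blockRisk (n : ℝ) {ℓ : I → ℝ → ℝ} (hℓ : ∀ i, Measurable (ℓ i)) (c : ι → ℝ) :
    Measurable (blockRisk (B := B) n ℓ c) := by
  unfold blockRisk
  fun_prop

lemma measurable_restRisk [DecidableEq I] (n : ℝ) {ℓ : I → ℝ → ℝ} (hℓ : ∀ i, Measurable (ℓ i))
    (c : ι → ℝ) (i : I) : Measurable (restRisk (B := B) n ℓ c i) := by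
  unfold restRisk
  fun_prop

omit [Fintype I] in
lemma measurable_restRow [DecidableEq B] (a : I × B) : Measurable (restRow (ι := ι) a) := by
  unfold restRow
  fun_prop

lemma dependsOn_restRisk [DecidableEq I] (n : ℝ) (ℓ : I → ℝ → ℝ) (c : ι → ℝ) (i : I) :
    DependsOn (restRisk (B := B) n ℓ c i) (Finset.univ.filter fun j : I × B => j.1 ≠ i) := by
  intro x x' h
  funext v
  unfold restRisk
  congr 2
  refine Finset.sum_congr rfl fun i' hi' => ?_
  congr 1
  exact Finset.sum_congr rfl fun b _ => by rw [h (i', b) (by simpa using hi')]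

lemma dependsOn_restRow [DecidableEq I] [DecidableEq B] (a : I × B) :
    DependsOn (restRow (ι := ι) a) (Finset.univ.filter fun j : I × B => j.1 = a.1) := by
  intro x x' h
  funext v
  exact Finset.sum_congr rfl fun b _ => by rw [h (a.1, b) (by simp)]

variable [Fintype ι] [DecidableEq B] {κ : I × B → Measure (ι → ℝ)}
  [∀ j, IsProbabilityMeasure (κ j)] {m : ℕ} {t t' s₂ s₄ : I × B → ℝ}

lemma integral_restRow_pow_four_le (hκ : ∀ j, BlockMoments m (κ j) (t j) (t' j) (s₂ j) (s₄ j))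
    {Z : ℝ} (hZ : ∀ i, ∑ b, s₄ (i, b) + 3 * (∑ b, s₂ (i, b)) ^ 2 ≤ Z) (a : I × B) (v : ι) :
    Integrable (fun x => restRow a x v ^ 4) (Measure.pi κ) ∧
      ∫ x, restRow a x v ^ 4 ∂(Measure.pi κ) ≤ Z := by
  have hproj : Measurable fun y : ι → ℝ => y v := measurable_pi_apply v
  have hind : iIndepFun (fun b (x : I × B → ι → ℝ) => x (a.1, b) v) (Measure.pi κ) :=
    (iIndepFun_pi (μ := κ) (X := fun _ y => y v) fun j => hproj.aemeasurable).precomp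
      (Prod.mk_right_injective a.1)
  have heval (b : B) : MeasurePreserving (Function.eval (a.1, b)) (Measure.pi κ) (κ (a.1, b)) :=
    measurePreserving_eval κ (a.1, b)
  have hmoment (b : B) (k : ℕ) :
      ∫ x, x (a.1, b) v ^ k ∂(Measure.pi κ) = ∫ y, y v ^ k ∂(κ (a.1, b)) := by
    rw [← (heval b).map_eq, integral_map (heval b).measurable.aemeasurable
      (hproj.pow_const k).aestronglyMeasurable]
  have hL (b : B) : MemLp (fun x : I × B → ι → ℝ => x (a.1, b) v) (4 : ℕ) (Measure.pi κ) :=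
    ((hκ (a.1, b)).memLp_four v).comp_measurePreserving (heval b)
  refine ⟨integrable_pow_of_memLp (memLp_finsetSum _ fun b _ => hL b) le_rfl, ?_⟩
  calc ∫ x, restRow a x v ^ 4 ∂(Measure.pi κ)
      ≤ ∑ b ∈ Finset.univ.erase a.2, ∫ y, y v ^ 4 ∂(κ (a.1, b))
        + 3 * (∑ b ∈ Finset.univ.erase a.2, ∫ y, y v ^ 2 ∂(κ (a.1, b))) ^ 2 := by
        simpa only [restRow, hmoment] using integral_sum_pow_four_le_of_iIndepFun hind
          (fun b => hproj.comp (measurable_pi_apply (a.1, b))) hL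
          (fun b => by
            simpa [(hκ (a.1, b)).integral_eq_zero] using hmoment b 1) (Finset.univ.erase a.2)
    _ ≤ ∑ b, ∫ y, y v ^ 4 ∂(κ (a.1, b)) + 3 * (∑ b, ∫ y, y v ^ 2 ∂(κ (a.1, b))) ^ 2 := by
        gcongr
        · exact Finset.erase_subset _ _
        · exact Finset.erase_subset _ _
    _ ≤ ∑ b, s₄ (a.1, b) + 3 * (∑ b, s₂ (a.1, b)) ^ 2 := by
        gcongr with b _ b
        · exact (hκ _).integral_pow_four_le v
        · exact (hκ _).integral_sq_le v
    _ ≤ Z := hZ a.1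

lemma pow_four_mul_abs_pow_le {s : ℝ} (hs : 0 ≤ s) (hm : m ≤ 4) (z : ℝ) :
    s ^ 4 * |z| ^ m ≤ s ^ m * (s ^ 4 + z ^ 4) := by
  obtain h | h := le_total |z| s
  · calc s ^ 4 * |z| ^ m ≤ s ^ 4 * s ^ m := by gcongr
      _ ≤ s ^ m * (s ^ 4 + z ^ 4) := by
        rw [mul_comm]
        gcongr
        exact le_add_of_nonneg_right (by positivity)
  · calc s ^ 4 * |z| ^ m = s ^ m * (s ^ (4 - m) * |z| ^ m) := by
          rw [← mul_assoc, ← pow_add, Nat.add_sub_cancel' hm]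
      _ ≤ s ^ m * (|z| ^ (4 - m) * |z| ^ m) := by gcongr
      _ ≤ s ^ m * (s ^ 4 + z ^ 4) := by
        rw [← pow_add, Nat.sub_add_cancel hm, Even.pow_abs (by decide)]
        gcongr
        exact le_add_of_nonneg_left (by positivity)

lemma integral_restRow_pow_le (hκ : ∀ j, BlockMoments m (κ j) (t j) (t' j) (s₂ j) (s₄ j))
    (hm : m ≤ 4) {s : ℝ} (hs : 0 < s)
    (hss : ∀ i, ∑ b, s₄ (i, b) + 3 * (∑ b, s₂ (i, b)) ^ 2 ≤ s ^ 4) (a : I × B) (v : ι) :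
    Integrable (fun x => |restRow a x v| ^ m) (Measure.pi κ) ∧
      ∫ x, |restRow a x v| ^ m ∂(Measure.pi κ) ≤ 2 * s ^ m := by
  obtain ⟨hint, hle⟩ := integral_restRow_pow_four_le hκ hss a v
  have hdom : Integrable (fun x => s ^ m * (s ^ 4 + restRow a x v ^ 4)) (Measure.pi κ) :=
    ((integrable_const _).add hint).const_mul _
  have hmeas : Measurable fun x : I × B → ι → ℝ => restRow a x v :=
    (measurable_pi_apply v).comp (measurable_restRow a)
  have hmul : Integrable (fun x => s ^ 4 * |restRow a x v| ^ m) (Measure.pi κ) :=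
    hdom.mono' ((hmeas.abs.pow_const m).const_mul _).aestronglyMeasurable
      (.of_forall fun x => by
        rw [Real.norm_of_nonneg (by positivity)]
        exact pow_four_mul_abs_pow_le hs.le hm _)
  refine ⟨(integrable_const_mul_iff (by simp [hs.ne'] : IsUnit (s ^ 4)) _).1 hmul, ?_⟩
  refine le_of_mul_le_mul_left ?_ (by positivity : 0 < s ^ 4)
  calc s ^ 4 * ∫ x, |restRow a x v| ^ m ∂(Measure.pi κ)
      ≤ ∫ x, s ^ m * (s ^ 4 + restRow a x v ^ 4) ∂(Measure.pi κ) := by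
        rw [← integral_const_mul]
        exact integral_mono hmul hdom fun x => pow_four_mul_abs_pow_le hs.le hm _
    _ ≤ s ^ m * (s ^ 4 + s ^ 4) := by
        rw [integral_const_mul, integral_add (integrable_const _) hint]
        gcongr
        simp
    _ = s ^ 4 * (2 * s ^ m) := by ring

variable [Nonempty ι] [DecidableEq I]

lemma integral_gibbs_restRow_le (β n : ℝ) {ℓ : I → ℝ → ℝ} (hℓ : ∀ i, Measurable (ℓ i))
    (c : ι → ℝ) (a : I × B) {m : ℕ} {Z : ℝ}
    (hZ : ∀ v, Integrable (fun x => |restRow a x v| ^ m) (Measure.pi κ) ∧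
      ∫ x, |restRow a x v| ^ m ∂(Measure.pi κ) ≤ Z) :
    Integrable (fun x => gibbs (-β • restRisk n ℓ c a.1 x) (fun v => |restRow a x v| ^ m))
        (Measure.pi κ) ∧
      ∫ x, gibbs (-β • restRisk n ℓ c a.1 x) (fun v => |restRow a x v| ^ m) ∂(Measure.pi κ)
        ≤ Z := by
  have hrisk := measurable_restRisk (B := B) n hℓ c a.1
  have hind : restRisk n ℓ c a.1 ⟂ᵢ[Measure.pi κ] restRow a :=
    indepFun_pi_of_dependsOn κ hrisk (measurable_restRow a)
      (Finset.disjoint_filter_filter_not _ _ _).symm (dependsOn_restRisk n ℓ c a.1)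
      (dependsOn_restRow a)
  refine integral_gibbs_le_of_indepFun (hrisk.const_smul (-β)) ?_ (fun v => (hZ v).1)
    fun v => (hZ v).2
  exact hind.comp (φ := fun E => -β • E) (ψ := fun u v => |u v| ^ m)
    (measurable_id.const_smul (-β)) (by fun_prop)

omit [Fintype I] [DecidableEq I] in
lemma SmoothLosses.gibbs_rowRisk_le {ℓ : I → ℕ → ℝ → ℝ} {Dom : I → ℝ → ℝ} {D : ℝ} {m : ℕ}
    {A : I → ℝ} (hℓ : SmoothLosses ℓ Dom D m A) {n lam : ℝ} (hn : 0 < n) (hlam : 0 ≤ lam) (i : I)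
    (c v y : ι → ℝ) :
    gibbs (-(n * lam) • rowRisk n (ℓ i 0) c (v + y)) (fun w => (1 + |ℓ i 1 ((v + y) w)|) ^ 3)
      ≤ A i * (1 + 2 ^ m * (gibbs (-(n * lam) • c) (fun w => |v w| ^ m) + ‖y‖ ^ m)) := by
  have hsplit : -(n * lam) • rowRisk n (ℓ i 0) c (v + y)
      = -(n * lam) • c - fun w => lam * ℓ i 0 ((v + y) w) := by
    funext w
    simp only [rowRisk, Pi.smul_apply, Pi.sub_apply, smul_eq_mul]
    field_simp
    ring
  have hmono : Monovary (fun w => Dom i ((v + y) w)) fun w => lam * ℓ i 0 ((v + y) w) :=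
    fun w w' h => hℓ.monovary i (lt_of_mul_lt_mul_left h hlam)
  have hpow (w : ι) : |(v + y) w| ^ m ≤ 2 ^ m * (|v w| ^ m + ‖y‖ ^ m) := by
    calc |(v + y) w| ^ m ≤ (|v w| + ‖y‖) ^ m := by
          gcongr
          exact (abs_add_le _ _).trans (by gcongr; exact norm_le_pi_norm y w)
      _ ≤ 2 ^ (m - 1) * (|v w| ^ m + ‖y‖ ^ m) := add_pow_le (abs_nonneg _) (norm_nonneg _) m
      _ ≤ 2 ^ m * (|v w| ^ m + ‖y‖ ^ m) := by gcongr <;> [norm_num; omega]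
  rw [hsplit]
  calc gibbs (-(n * lam) • c - fun w => lam * ℓ i 0 ((v + y) w))
        (fun w => (1 + |ℓ i 1 ((v + y) w)|) ^ 3)
      ≤ gibbs (-(n * lam) • c - fun w => lam * ℓ i 0 ((v + y) w)) (fun w => Dom i ((v + y) w)) :=
        gibbs_mono _ fun w => hℓ.pow_le i _
    _ ≤ gibbs (-(n * lam) • c) (fun w => Dom i ((v + y) w)) := gibbs_sub_le_of_monovary _ hmono
    _ ≤ gibbs (-(n * lam) • c) ((fun _ => A i * (1 + 2 ^ m * ‖y‖ ^ m))
          + (A i * 2 ^ m) • fun w => |v w| ^ m) := gibbs_mono _ fun w => by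
        have h := (hℓ.le i ((v + y) w)).trans
          (mul_le_mul_of_nonneg_left (add_le_add_right (hpow w) 1) (hℓ.nonneg i))
        simp only [Pi.add_apply, Pi.smul_apply, smul_eq_mul] at h ⊢
        linarith
    _ = A i * (1 + 2 ^ m * (gibbs (-(n * lam) • c) (fun w => |v w| ^ m) + ‖y‖ ^ m)) := by
        rw [map_add, map_smul, gibbs_const, smul_eq_mul]
        ring

lemma SmoothLosses.exists_approx_update {ℓ : I → ℕ → ℝ → ℝ} {Dom : I → ℝ → ℝ} {D : ℝ}
    {m : ℕ} {A : I → ℝ} (hℓ : SmoothLosses ℓ Dom D m A) {n lam K : ℝ} (hn : 1 ≤ n)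
    (hlam : 1 ≤ lam) (hD : 1 ≤ D) {g : ℕ → ℝ → ℝ} (hg : IsJet 3 g)
    (hgK : ∀ k ≤ 3, ∀ x, |g k x| ≤ K) (c : ι → ℝ) (a : I × B) (x : I × B → ι → ℝ) :
    ∃ T ∈ quadratics ι, ∃ r, ∀ y,
      |g 0 (softmin (n * lam) (blockRisk n (fun i => ℓ i 0) c (Function.update x a y))) - r - T y|
        ≤ 23 * K * D * lam ^ 2 / n * A a.1 * ‖y‖ ^ 3
            * (1 + 2 ^ m * gibbs (-(n * lam) • restRisk n (fun i => ℓ i 0) c a.1 x)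
              (fun w => |restRow a x w| ^ m))
          + 23 * K * D * lam ^ 2 / n * A a.1 * 2 ^ m * ‖y‖ ^ (3 + m) := by
  obtain ⟨T, hT, happrox⟩ := exists_quadratic_approx_softmin hn hlam hD (hℓ.isJet a.1)
    (hℓ.abs_two_le a.1) (hℓ.abs_three_le a.1) hg hgK
    (restRisk n (fun i => ℓ i 0) c a.1 x) (restRow a x)
  refine ⟨T, hT, g 0 (softmin (n * lam) (rowRisk n (ℓ a.1 0)
    (restRisk n (fun i => ℓ i 0) c a.1 x) (restRow a x))), fun y => ?_⟩
  have hgibbs : ∀ t ∈ Set.Icc (0 : ℝ) 1, gibbs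
      (-(n * lam) • rowRisk n (ℓ a.1 0) (restRisk n (fun i => ℓ i 0) c a.1 x)
        (restRow a x + t • y)) (fun w => (1 + |ℓ a.1 1 ((restRow a x + t • y) w)|) ^ 3)
      ≤ A a.1 * (1 + 2 ^ m * (gibbs (-(n * lam) • restRisk n (fun i => ℓ i 0) c a.1 x)
        (fun w => |restRow a x w| ^ m) + ‖y‖ ^ m)) := fun t ht => by
    refine (hℓ.gibbs_rowRisk_le (by linarith) (by linarith) a.1 _ _ (t • y)).trans ?_
    have hty : ‖t • y‖ ≤ ‖y‖ := by
      rw [norm_smul, Real.norm_of_nonneg ht.1]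
      exact mul_le_of_le_one_left (norm_nonneg y) ht.2
    have := hℓ.nonneg a.1
    gcongr
  rw [blockRisk_update]
  refine (happrox y ‖y‖ _ (norm_le_pi_norm y) hgibbs).trans_eq ?_
  ring

omit [DecidableEq B] [DecidableEq I] in
theorem abs_integral_softmin_blockRisk_sub_le (μ ν : I × B → Measure (ι → ℝ))
    [∀ a, IsProbabilityMeasure (μ a)] [∀ a, IsProbabilityMeasure (ν a)]
    (hmatch : ∀ a, quadratics ι ≤ matchedFunctions (μ a) (ν a)) {n lam D K s : ℝ} (hn : 1 ≤ n)
    (hlam : 1 ≤ lam) (hD : 1 ≤ D) {ℓ : I → ℕ → ℝ → ℝ} {Dom : I → ℝ → ℝ} {A : I → ℝ}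
    (hℓ : SmoothLosses ℓ Dom D m A) (hm : m ≤ 4) {g : ℕ → ℝ → ℝ} (hg : IsJet 3 g)
    (hgK : ∀ k ≤ 3, ∀ x, |g k x| ≤ K) (c : ι → ℝ)
    (hμ : ∀ a, BlockMoments m (μ a) (t a) (t' a) (s₂ a) (s₄ a))
    (hν : ∀ a, BlockMoments m (ν a) (t a) (t' a) (s₂ a) (s₄ a)) (hs : 0 < s)
    (hss : ∀ i, ∑ b, s₄ (i, b) + 3 * (∑ b, s₂ (i, b)) ^ 2 ≤ s ^ 4) :
    |∫ x, g 0 (softmin (n * lam) (blockRisk n (fun i => ℓ i 0) c x)) ∂(Measure.pi μ)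
        - ∫ x, g 0 (softmin (n * lam) (blockRisk n (fun i => ℓ i 0) c x)) ∂(Measure.pi ν)|
      ≤ 46 * K * D * lam ^ 2 / n
        * ∑ a, A a.1 * (t a * (1 + 2 ^ m * (2 * s ^ m)) + 2 ^ m * t' a) := by
  classical
  set C : ℝ := 23 * K * D * lam ^ 2 / n with hC
  have hC0 : 0 ≤ C := by
    have := (abs_nonneg _).trans (hgK 0 (by norm_num) 0)
    positivity
  have hA := hℓ.nonneg
  have hlin := abs_integral_pi_sub_le μ ν
    ((hg.continuous (by norm_num)).measurable.comp
      (measurable_softmin (n * lam) (measurable_blockRisk n hℓ.measurable c)))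
    (fun x => hgK 0 (by norm_num) _)
    (U := fun a y => C * A a.1 * ‖y‖ ^ 3) (W := fun a y => C * A a.1 * 2 ^ m * ‖y‖ ^ (3 + m))
    (V := fun a x => 1 + 2 ^ m * gibbs (-(n * lam) • restRisk n (fun i => ℓ i 0) c a.1 x)
      (fun w => |restRow a x w| ^ m)) (v := fun _ => 1 + 2 ^ m * (2 * s ^ m))
    (fun a y => by have := hA a.1; positivity)
    (fun a => (hμ a).integrable_three.const_mul _) (fun a => (hν a).integrable_three.const_mul _)
    (fun a => (hμ a).integrable_add.const_mul _) (fun a => (hν a).integrable_add.const_mul _)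
    (fun κ _ hhyb a => ?_)
    (fun a x => let ⟨T, hT, r, h⟩ := hℓ.exists_approx_update hn hlam hD hg hgK c a x
      ⟨T, hmatch a hT, r, h⟩)
  · refine hlin.trans ?_
    rw [show 46 * K * D * lam ^ 2 / n = 2 * C by rw [hC]; ring, Finset.mul_sum]
    refine Finset.sum_le_sum fun a _ => ?_
    have h3 := add_le_add (hμ a).integral_three_le (hν a).integral_three_le
    have hadd := add_le_add (hμ a).integral_add_le (hν a).integral_add_le
    simp only [integral_const_mul]
    calc _ = C * A a.1 * ((∫ y, ‖y‖ ^ 3 ∂(μ a) + ∫ y, ‖y‖ ^ 3 ∂(ν a))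
            * (1 + 2 ^ m * (2 * s ^ m))
          + 2 ^ m * (∫ y, ‖y‖ ^ (3 + m) ∂(μ a) + ∫ y, ‖y‖ ^ (3 + m) ∂(ν a))) := by ring
      _ ≤ C * A a.1 * ((t a + t a) * (1 + 2 ^ m * (2 * s ^ m)) + 2 ^ m * (t' a + t' a)) := by
          have := hA a.1
          gcongr
      _ = _ := by ring
  · obtain ⟨hint, hle⟩ := integral_gibbs_restRow_le (n * lam) n hℓ.measurable c a
      (integral_restRow_pow_le (fun j => (hhyb j).elim (· ▸ hμ j) (· ▸ hν j)) hm hs hss a)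
    refine ⟨(integrable_const 1).add (hint.const_mul _), ?_⟩
    rw [integral_add (integrable_const 1) (hint.const_mul _), integral_const_mul]
    simpa using hle

end BlockReplacement

section Discretisation

lemma bddBelow_image_of_convexOn {p : ℕ} {R : (Fin p → ℝ) → ℝ} (hR : ConvexOn ℝ Set.univ R)
    {S : Set (Fin p → ℝ)} {L : ℝ} (hS : ∀ w ∈ S, ∀ j, w j ∈ Set.Icc (-L) L) :
    BddBelow (R '' S) := by
  have hbox : S ⊆ Set.Icc (fun _ => -L) (fun _ => L) :=
    fun w hw => ⟨fun j => (hS w hw j).1, fun j => (hS w hw j).2⟩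
  exact (isCompact_Icc.bddBelow_image hR.locallyLipschitz.continuous.continuousOn).mono
    (Set.image_mono hbox)

lemma abs_iInf_add_sub_softmin_le {S ι : Type*} [Nonempty S] [Fintype ι] {cell : S → ι}
    {w : ι → S} (hw : ∀ v, cell (w v) = v) {R h : S → ℝ} (hR : BddBelow (Set.range R))
    (h0 : 0 ≤ h) {η ε β : ℝ} (hβ : 0 < β) (hη : ∀ u u', cell u = cell u' → |h u - h u'| ≤ η)
    {h' : ι → ℝ} (hε : ∀ v, |h' v - h (w v)| ≤ ε) :
    |(⨅ u, (h u + R u)) - softmin β (fun v => (⨅ u : {u // cell u = v}, R u) + h' v)|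
      ≤ η + ε + Real.log (Fintype.card ι) / β := by
  have : Nonempty ι := .map cell inferInstance
  set c : ι → ℝ := fun v => ⨅ u : {u // cell u = v}, R u
  have hbdd : BddBelow (Set.range fun u => h u + R u) := by
    obtain ⟨m, hm⟩ := hR
    exact ⟨m, Set.forall_mem_range.2 fun u =>
      (hm ⟨u, rfl⟩).trans (le_add_of_nonneg_left (h0 u))⟩
  have hcR (u : S) : c (cell u) ≤ R u :=
    ciInf_le (hR.mono (Set.range_comp_subset_range _ R)) (⟨u, rfl⟩ : {u' // cell u' = cell u})
  have hlower (v : ι) : (⨅ u, (h u + R u)) - η - ε ≤ c v + h' v := by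
    have : Nonempty {u // cell u = v} := ⟨w v, hw v⟩
    suffices (⨅ u, (h u + R u)) - η - h (w v) ≤ c v by linarith [(abs_le.1 (hε v)).1]
    refine le_ciInf fun ⟨u, hu⟩ => ?_
    linarith [ciInf_le hbdd u, (abs_le.1 (hη u (w v) (hu.trans (hw v).symm))).2]
  have hupper (u : S) : softmin β (fun v => c v + h' v) - η - ε ≤ h u + R u := by
    linarith [softmin_le hβ (fun v => c v + h' v) (cell u), hcR u, (abs_le.1 (hε (cell u))).2,
      (abs_le.1 (hη (w (cell u)) u (hw _))).2]
  have hcard : 0 ≤ Real.log (Fintype.card ι) / β :=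
    div_nonneg (Real.log_natCast_nonneg _) hβ.le
  rw [abs_le]
  constructor
  · linarith [le_ciInf hupper]
  · linarith [le_softmin hβ hlower]

lemma card_Icc_floor_le {L : ℝ} (hL : 0 ≤ L) :
    ((Finset.Icc ⌊-L⌋ ⌊L⌋).card : ℝ) ≤ 2 * L + 2 := by
  have hle : ⌊-L⌋ ≤ ⌊L⌋ := Int.floor_le_floor (by linarith)
  have hcast : ((⌊L⌋ + 1 - ⌊-L⌋).toNat : ℝ) = ((⌊L⌋ + 1 - ⌊-L⌋ : ℤ) : ℝ) := by
    rw [← Int.cast_natCast, Int.toNat_of_nonneg (by omega)]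
  rw [Int.card_Icc, hcast]
  push_cast
  linarith [Int.floor_le L, Int.lt_floor_add_one (-L)]

lemma exists_finite_cells {p : ℕ} {S : Set (Fin p → ℝ)} (hSne : S.Nonempty) {L : ℝ} (hL : 0 ≤ L)
    (hS : ∀ w ∈ S, ∀ j, w j ∈ Set.Icc (-L) L) {δ : ℝ} (hδ : 0 < δ) :
    ∃ T : Finset (Fin p → ℤ), ∃ cell : S → T, Function.Surjective cell ∧
      (∀ u u', cell u = cell u' → ∀ j, |(u : Fin p → ℝ) j - (u' : Fin p → ℝ) j| ≤ δ) ∧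
      Real.log T.card ≤ p * Real.log (2 * (L / δ) + 2) := by
  classical
  let cell : S → Fin p → ℤ := fun u j => ⌊(u : Fin p → ℝ) j / δ⌋
  let box : Finset (Fin p → ℤ) := Fintype.piFinset fun _ => Finset.Icc ⌊-(L / δ)⌋ ⌊L / δ⌋
  have hbox (u : S) : cell u ∈ box := by
    refine Fintype.mem_piFinset.2 fun j => Finset.mem_Icc.2
      ⟨Int.floor_le_floor ?_, Int.floor_le_floor ?_⟩
    · rw [← neg_div]
      gcongr
      exact (hS u u.2 j).1
    · gcongr
      exact (hS u u.2 j).2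
  let T : Finset (Fin p → ℤ) := box.filter fun v => ∃ u, cell u = v
  have hTcard : (T.card : ℝ) ≤ (2 * (L / δ) + 2) ^ p :=
    calc (T.card : ℝ) ≤ box.card := by exact_mod_cast Finset.card_filter_le _ _
      _ = ((Finset.Icc ⌊-(L / δ)⌋ ⌊L / δ⌋).card : ℝ) ^ p := by simp [box]
      _ ≤ (2 * (L / δ) + 2) ^ p := by
        gcongr
        exact card_Icc_floor_le (by positivity)
  refine ⟨T, fun u => ⟨cell u, Finset.mem_filter.2 ⟨hbox u, u, rfl⟩⟩, ?_, ?_, ?_⟩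
  · rintro ⟨v, hv⟩
    obtain ⟨u, hu⟩ := (Finset.mem_filter.1 hv).2
    exact ⟨u, Subtype.ext hu⟩
  · intro u u' h j
    have hfloor : |(u : Fin p → ℝ) j / δ - (u' : Fin p → ℝ) j / δ| < 1 :=
      Int.abs_sub_lt_one_of_floor_eq_floor (congrFun (congrArg Subtype.val h) j)
    rw [← sub_div, abs_div, abs_of_pos hδ, div_lt_one hδ] at hfloor
    exact hfloor.le
  · have hTne : T.Nonempty :=
      let ⟨u, hu⟩ := hSne
      ⟨cell ⟨u, hu⟩, Finset.mem_filter.2 ⟨hbox _, _, rfl⟩⟩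
    rw [← Real.log_pow]
    exact Real.log_le_log (by exact_mod_cast hTne.card_pos) hTcard

lemma measurable_minRisk {n p : ℕ} {ell0 : ℝ → ℝ} (hc : Continuous ell0) (h0 : 0 ≤ ell0)
    {R : (Fin p → ℝ) → ℝ} {S : Set (Fin p → ℝ)} (hSne : S.Nonempty) (hRS : BddBelow (R '' S)) :
    Measurable fun z : (Fin n → Fin p → ℝ) × (Fin n → ℝ) =>
      minRisk (noisyLoss ell0 z.2) R S z.1 := by
  have : Nonempty S := hSne.to_subtype
  have hbdd (z : (Fin n → Fin p → ℝ) × (Fin n → ℝ)) :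
      BddBelow (Set.range fun w : S => empRisk (noisyLoss ell0 z.2) R z.1 w) := by
    obtain ⟨m, hm⟩ := hRS
    exact ⟨m, Set.forall_mem_range.2 fun w => (hm ⟨w, w.2, rfl⟩).trans (le_add_of_nonneg_left
      (mul_nonneg (by positivity) (Finset.sum_nonneg fun i _ => h0 _)))⟩
  refine measurable_of_Iio fun a => ?_
  have hpre : (fun z : (Fin n → Fin p → ℝ) × (Fin n → ℝ) =>
      minRisk (noisyLoss ell0 z.2) R S z.1) ⁻¹' Set.Iio a
        = ⋃ w : S, {z | empRisk (noisyLoss ell0 z.2) R z.1 w < a} := by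
    ext z
    simpa [minRisk] using ciInf_lt_iff (hbdd z)
  rw [hpre]
  refine (isOpen_iUnion fun w => isOpen_lt ?_ continuous_const).measurableSet
  unfold empRisk Av noisyLoss
  fun_prop

end Discretisation

section BlockLaws

open scoped Matrix

variable {J B ι : Type*} [DecidableEq B]

section

variable [Fintype J]

/-- The scores `v ↦ ⟨u, w v⟩` of the family of weight vectors `w`, with the sum over the
coordinates of `u` restricted to the cell `b` of the partition into fibres of `c`. -/
def blockScore (c : J → B) (w : ι → J → ℝ) (b : B) (u : J → ℝ) (v : ι) : ℝ :=
  ∑ j with c j = b, u j * w v j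

lemma measurable_blockScore (c : J → B) (w : ι → J → ℝ) (b : B) :
    Measurable (blockScore c w b) :=
  measurable_pi_lambda _ fun _ => Finset.measurable_fun_sum _ fun j _ =>
    (measurable_pi_apply j).mul_const _

lemma sum_blockScore [Fintype B] (c : J → B) (w : ι → J → ℝ) (u : J → ℝ) (v : ι) :
    ∑ b, blockScore c w b u v = ∑ j, u j * w v j :=
  Finset.sum_fiberwise _ _ _

lemma blockScore_eq_dotProduct (c : J → B) (w : ι → J → ℝ) (b : B) (u : J → ℝ) (v : ι) :
    blockScore c w b u v = u ⬝ᵥ fun j => if c j = b then w v j else 0 := by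
  simp only [blockScore, dotProduct, Finset.sum_filter, mul_ite, mul_zero]

lemma abs_blockScore_le {w : ι → J → ℝ} {v : ι} {L : ℝ} (hw : ∀ j, |w v j| ≤ L) (c : J → B)
    (b : B) (u : J → ℝ) : |blockScore c w b u v| ≤ L * ∑ j with c j = b, |u j| := by
  rw [Finset.mul_sum]
  refine (Finset.abs_sum_le_sum_abs _ _).trans (Finset.sum_le_sum fun j _ => ?_)
  rw [abs_mul, mul_comm]
  exact mul_le_mul_of_nonneg_right (hw j) (abs_nonneg _)

lemma sum_card_fibre [Fintype B] (c : J → B) :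
    ∑ b, ({j | c j = b} : Finset J).card = Fintype.card J := by
  simpa using (Finset.card_eq_sum_card_fiberwise (f := c) (s := Finset.univ) (t := Finset.univ)
    fun _ _ => Finset.mem_coe.2 (Finset.mem_univ _)).symm

end

variable {Ω : Type*} [MeasurableSpace Ω] {P : Measure Ω}

lemma map_blockScore_eq_pi {I : Type*} [Fintype I] [Fintype J] [Fintype B] [IsProbabilityMeasure P]
    {X : Ω → I → J → ℝ} (hX : Measurable X) (hrow : iIndepFun (fun i ω => X ω i) P) (c : J → B)
    (hblk : ∀ i, iIndepFun (fun (b : B) (ω : Ω) (j : {j // c j = b}) => X ω i j) P)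
    (w : ι → J → ℝ) :
    P.map (fun ω (a : I × B) => blockScore c w a.2 (X ω a.1))
      = Measure.pi fun a : I × B => P.map fun ω => blockScore c w a.2 (X ω a.1) := by
  have hm : ∀ i b, Measurable fun ω => blockScore c w b (X ω i) := fun i b =>
    (measurable_blockScore c w b).comp ((measurable_pi_apply i).comp hX)
  have hrows : iIndepFun (fun i ω (b : B) => blockScore c w b (X ω i)) P :=
    hrow.comp (fun _ u b => blockScore c w b u) fun _ =>
      measurable_pi_lambda _ fun b => measurable_blockScore c w b
  have hcells : ∀ i, iIndepFun (fun (b : B) ω => blockScore c w b (X ω i)) P := by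
    intro i
    have := (hblk i).comp (fun b r (v : ι) => ∑ j : {j // c j = b}, r j * w v j) fun b =>
      measurable_pi_lambda _ fun v => Finset.measurable_fun_sum _ fun j _ =>
        (measurable_pi_apply j).mul_const _
    refine this.congr fun b => .of_forall fun ω => funext fun v => ?_
    exact (Finset.sum_subtype _ (by simp) fun j => X ω i j * w v j).symm
  have hall := iIndepFun_uncurry' (X := fun i b ω => blockScore c w b (X ω i)) hm hrows hcells
  exact (iIndepFun_iff_map_fun_eq_pi_map fun a : I × B => (hm a.1 a.2).aemeasurable).1 hall

lemma mem_matchedFunctions_map {E : Type*} [MeasurableSpace E] {Y Y' : Ω → E}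
    (hY : AEMeasurable Y P) (hY' : AEMeasurable Y' P) {T : E → ℝ} (hT : Measurable T)
    (hint : Integrable (fun ω => T (Y ω)) P) (hint' : Integrable (fun ω => T (Y' ω)) P)
    (h : ∫ ω, T (Y ω) ∂P = ∫ ω, T (Y' ω) ∂P) :
    T ∈ matchedFunctions (P.map Y) (P.map Y') := by
  refine ⟨(integrable_map_measure hT.aestronglyMeasurable hY).2 hint,
    (integrable_map_measure hT.aestronglyMeasurable hY').2 hint', ?_⟩
  rwa [integral_map hY hT.aestronglyMeasurable, integral_map hY' hT.aestronglyMeasurable]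

lemma quadratics_le_matchedFunctions_map [IsFiniteMeasure P] {Y Y' : Ω → ι → ℝ}
    (hY : AEMeasurable Y P) (hY' : AEMeasurable Y' P) (hL : ∀ v, MemLp (fun ω => Y ω v) 2 P)
    (hL' : ∀ v, MemLp (fun ω => Y' ω v) 2 P) (hone : ∀ v, ∫ ω, Y ω v ∂P = ∫ ω, Y' ω v ∂P)
    (htwo : ∀ v v', ∫ ω, Y ω v * Y ω v' ∂P = ∫ ω, Y' ω v * Y' ω v' ∂P) :
    quadratics ι ≤ matchedFunctions (P.map Y) (P.map Y') := by
  rw [quadratics, Submodule.span_le, Set.union_subset_iff, Set.range_subset_iff,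
    Set.range_subset_iff]
  exact ⟨fun v => mem_matchedFunctions_map hY hY' (measurable_pi_apply v)
      ((hL v).integrable one_le_two) ((hL' v).integrable one_le_two) (hone v),
    fun ⟨v, v'⟩ => mem_matchedFunctions_map hY hY'
      ((measurable_pi_apply v).mul (measurable_pi_apply v')) ((hL v).integrable_mul (hL v'))
      ((hL' v).integrable_mul (hL' v')) (htwo v v')⟩

/-- The random vector `u` is centred with covariance matrix `C`, and its coordinates have absolute
moments of order `k ≤ q` at most `a k`. -/
structure RowMoments (P : Measure Ω) (C : Matrix J J ℝ) (q : ℕ) (a : ℕ → ℝ) (u : Ω → J → ℝ) :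
    Prop where
  measurable : Measurable u
  mean : ∀ j, ∫ ω, u ω j ∂P = 0
  second : ∀ j k, ∫ ω, u ω j * u ω k ∂P = C j k
  memLp : ∀ j, MemLp (fun ω => u ω j) q P
  abs_pow_le : ∀ k ≤ q, ∀ j, ∫ ω, |u ω j| ^ k ∂P ≤ a k

namespace RowMoments

variable [IsProbabilityMeasure P] {C : Matrix J J ℝ} {q : ℕ} {a : ℕ → ℝ} {u : Ω → J → ℝ}

lemma integral_pow_sum_abs_le (hu : RowMoments P C q a u) {m d : ℕ} (hm : m + 1 ≤ q)
    {F : Finset J} (hF : F.card ≤ d) {L : ℝ} (hL : 0 ≤ L) :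
    Integrable (fun ω => (L * ∑ j ∈ F, |u ω j|) ^ (m + 1)) P ∧
      ∫ ω, (L * ∑ j ∈ F, |u ω j|) ^ (m + 1) ∂P
        ≤ L ^ (m + 1) * d ^ m * (F.card * a (m + 1)) := by
  have hS : ∀ ω, 0 ≤ ∑ j ∈ F, |u ω j| := fun ω => Finset.sum_nonneg fun j _ => abs_nonneg _
  have h0 : ∀ ω, 0 ≤ (L * ∑ j ∈ F, |u ω j|) ^ (m + 1) := fun ω =>
    pow_nonneg (mul_nonneg hL (hS ω)) _
  have holder : ∀ ω, (L * ∑ j ∈ F, |u ω j|) ^ (m + 1)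
      ≤ L ^ (m + 1) * d ^ m * ∑ j ∈ F, |u ω j| ^ (m + 1) := by
    intro ω
    rw [mul_pow, mul_assoc]
    gcongr
    refine (pow_sum_le_card_mul_sum_pow (fun j _ => abs_nonneg _) m).trans ?_
    gcongr
  have hint : ∀ j, Integrable (fun ω => |u ω j| ^ (m + 1)) P := fun j =>
    integrable_pow_of_memLp (hu.memLp j).abs hm
  have hbound : Integrable (fun ω => L ^ (m + 1) * d ^ m * ∑ j ∈ F, |u ω j| ^ (m + 1)) P :=
    (integrable_finsetSum _ fun j _ => hint j).const_mul _
  have hmeas : Measurable fun ω => (L * ∑ j ∈ F, |u ω j|) ^ (m + 1) :=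
    ((Finset.measurable_fun_sum _ fun j _ =>
      ((measurable_pi_apply j).comp hu.measurable).abs).const_mul L).pow_const _
  refine ⟨hbound.mono' hmeas.aestronglyMeasurable (.of_forall fun ω =>
    (Real.norm_of_nonneg (h0 ω)).trans_le (holder ω)), ?_⟩
  refine (integral_mono_of_nonneg (.of_forall h0) hbound (.of_forall holder)).trans ?_
  rw [integral_const_mul, integral_finsetSum _ fun j _ => hint j]
  gcongr
  exact (Finset.sum_le_sum fun j _ => hu.abs_pow_le _ hm j).trans_eq (by simp)

variable [Fintype J]

lemma memLp_dotProduct (hu : RowMoments P C q a u) {k : ℕ} (hk : k ≤ q) (w : J → ℝ) :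
    MemLp (fun ω => u ω ⬝ᵥ w) k P := by
  simp only [dotProduct, mul_comm _ (w _)]
  exact memLp_finsetSum _ fun j _ =>
    ((hu.memLp j).mono_exponent (by exact_mod_cast hk)).const_mul _

lemma integral_dotProduct (hu : RowMoments P C q a u) (hq : 1 ≤ q) (w : J → ℝ) :
    ∫ ω, u ω ⬝ᵥ w ∂P = 0 := by
  simp only [dotProduct]
  rw [integral_finsetSum _ fun j _ =>
    ((hu.memLp j).integrable (by exact_mod_cast hq)).mul_const _]
  exact Finset.sum_eq_zero fun j _ => by rw [integral_mul_const, hu.mean j, zero_mul]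

lemma integral_dotProduct_mul (hu : RowMoments P C q a u) (hq : 2 ≤ q) (w w' : J → ℝ) :
    ∫ ω, (u ω ⬝ᵥ w) * (u ω ⬝ᵥ w') ∂P = w ⬝ᵥ C *ᵥ w' := by
  have hint : ∀ j k, Integrable (fun ω => w j * w' k * (u ω j * u ω k)) P := fun j k =>
    (((hu.memLp j).mono_exponent (p := 2) (by exact_mod_cast hq)).integrable_mul
      ((hu.memLp k).mono_exponent (p := 2) (by exact_mod_cast hq))).const_mul _
  have expand : ∀ ω, (u ω ⬝ᵥ w) * (u ω ⬝ᵥ w') = ∑ j, ∑ k, w j * w' k * (u ω j * u ω k) := by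
    intro ω
    simp only [dotProduct, Finset.sum_mul_sum]
    exact Finset.sum_congr rfl fun j _ => Finset.sum_congr rfl fun k _ => by ring
  simp only [expand]
  rw [integral_finsetSum _ fun j _ => integrable_finsetSum _ fun k _ => hint j k]
  simp only [dotProduct, Matrix.mulVec, Finset.mul_sum]
  refine Finset.sum_congr rfl fun j _ => ?_
  rw [integral_finsetSum _ fun k _ => hint j k]
  exact Finset.sum_congr rfl fun k _ => by rw [integral_const_mul, hu.second j k]; ring

lemma integral_blockScore (hu : RowMoments P C q a u) (hq : 1 ≤ q) (c : J → B)
    (w : ι → J → ℝ) (b : B) (v : ι) : ∫ ω, blockScore c w b (u ω) v ∂P = 0 := by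
  simpa only [blockScore_eq_dotProduct] using hu.integral_dotProduct hq _

lemma memLp_blockScore (hu : RowMoments P C q a u) {k : ℕ} (hk : k ≤ q) (c : J → B)
    (w : ι → J → ℝ) (b : B) (v : ι) : MemLp (fun ω => blockScore c w b (u ω) v) k P := by
  simpa only [blockScore_eq_dotProduct] using hu.memLp_dotProduct hk _

lemma integral_blockScore_sq_le (hu : RowMoments P C q a u) (hq : 2 ≤ q) {σ : ℝ} (hσ : 0 ≤ σ)
    (hC : ∀ w : J → ℝ, w ⬝ᵥ C *ᵥ w ≤ σ * (w ⬝ᵥ w)) {w : ι → J → ℝ} {L : ℝ} (c : J → B) (b : B)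
    {v : ι} (hw : ∀ j, |w v j| ≤ L) :
    ∫ ω, blockScore c w b (u ω) v ^ 2 ∂P ≤ σ * (({j | c j = b} : Finset J).card * L ^ 2) := by
  simp only [blockScore_eq_dotProduct, sq (_ ⬝ᵥ _)]
  rw [hu.integral_dotProduct_mul hq]
  refine (hC _).trans (mul_le_mul_of_nonneg_left ?_ hσ)
  calc (fun j => if c j = b then w v j else 0) ⬝ᵥ (fun j => if c j = b then w v j else 0)
      = ∑ j with c j = b, |w v j| ^ 2 := by
        simp only [dotProduct, Finset.sum_filter, sq_abs]
        exact Finset.sum_congr rfl fun j _ => by split_ifs <;> ring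
    _ ≤ ∑ j with c j = b, L ^ 2 :=
        Finset.sum_le_sum fun j _ => pow_le_pow_left₀ (abs_nonneg _) (hw j) 2
    _ = _ := by rw [Finset.sum_const, nsmul_eq_mul]

lemma norm_blockScore_pow_le [Fintype ι] (hu : RowMoments P C q a u) {w : ι → J → ℝ} {L : ℝ}
    (hL : 0 ≤ L) (hw : ∀ v j, |w v j| ≤ L) (c : J → B) (b : B) {d : ℕ}
    (hd : ({j | c j = b} : Finset J).card ≤ d) {m : ℕ} (hm : m + 1 ≤ q) :
    Integrable (fun ω => ‖blockScore c w b (u ω)‖ ^ (m + 1)) P ∧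
      ∫ ω, ‖blockScore c w b (u ω)‖ ^ (m + 1) ∂P
        ≤ L ^ (m + 1) * d ^ m * (({j | c j = b} : Finset J).card * a (m + 1)) := by
  obtain ⟨hint, hle⟩ := hu.integral_pow_sum_abs_le hm hd hL
  have hpt : ∀ ω, ‖blockScore c w b (u ω)‖ ^ (m + 1)
      ≤ (L * ∑ j with c j = b, |u ω j|) ^ (m + 1) := fun ω =>
    pow_le_pow_left₀ (norm_nonneg _) ((pi_norm_le_iff_of_nonneg (mul_nonneg hL
      (Finset.sum_nonneg fun _ _ => abs_nonneg _))).2 fun v => abs_blockScore_le (hw v) c b _) _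
  refine ⟨hint.mono' ?_ (.of_forall fun ω => ?_), ?_⟩
  · exact (((measurable_blockScore c w b).comp hu.measurable).norm.pow_const _).aestronglyMeasurable
  · rw [Real.norm_of_nonneg (by positivity)]
    exact hpt ω
  · exact (integral_mono_of_nonneg (.of_forall fun ω => by positivity) hint
      (.of_forall hpt)).trans hle

lemma blockMoments [Fintype ι] (hu : RowMoments P C q a u) {σ : ℝ} (hσ : 0 ≤ σ)
    (hC : ∀ w : J → ℝ, w ⬝ᵥ C *ᵥ w ≤ σ * (w ⬝ᵥ w)) {w : ι → J → ℝ} {L : ℝ} (hL : 0 ≤ L)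
    (hw : ∀ v j, |w v j| ≤ L) (c : J → B) (b : B) {d : ℕ}
    (hd : ({j | c j = b} : Finset J).card ≤ d) {m : ℕ} (hm : 3 + m ≤ q) (hq : 4 ≤ q) :
    BlockMoments m (P.map fun ω => blockScore c w b (u ω))
      (L ^ 3 * d ^ 2 * (({j | c j = b} : Finset J).card * a 3))
      (L ^ (3 + m) * d ^ (2 + m) * (({j | c j = b} : Finset J).card * a (3 + m)))
      (σ * (({j | c j = b} : Finset J).card * L ^ 2))
      (L ^ 4 * d ^ 3 * (({j | c j = b} : Finset J).card * a 4)) := by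
  have hY : AEMeasurable (fun ω => blockScore c w b (u ω)) P :=
    ((measurable_blockScore c w b).comp hu.measurable).aemeasurable
  have hcoord : ∀ v (k : ℕ), AEStronglyMeasurable (fun y : ι → ℝ => y v ^ k)
      (P.map fun ω => blockScore c w b (u ω)) := fun v k =>
    ((measurable_pi_apply v).pow_const k).aestronglyMeasurable
  have hnorm : ∀ k : ℕ, AEStronglyMeasurable (fun y : ι → ℝ => ‖y‖ ^ k)
      (P.map fun ω => blockScore c w b (u ω)) := fun k =>
    (measurable_norm.pow_const k).aestronglyMeasurable
  obtain ⟨hint3, hle3⟩ := hu.norm_blockScore_pow_le hL hw c b hd (m := 2) (by omega)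
  obtain ⟨hint4, hle4⟩ := hu.norm_blockScore_pow_le hL hw c b hd (m := 3) hq
  obtain ⟨hint', hle'⟩ := hu.norm_blockScore_pow_le hL hw c b hd (m := 2 + m) (by omega)
  rw [show 2 + m + 1 = 3 + m by omega] at hint' hle'
  refine ⟨(integrable_map_measure (hnorm 3) hY).2 hint3, ?_,
    (integrable_map_measure (hnorm _) hY).2 hint', ?_, fun v => ?_, fun v => ?_, fun v => ?_,
    fun v => ?_⟩
  · rwa [integral_map hY (hnorm 3)]
  · rwa [integral_map hY (hnorm _)]
  · exact (memLp_map_measure_iff (measurable_pi_apply v).aestronglyMeasurable hY).2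
      (hu.memLp_blockScore hq c w b v)
  · rw [integral_map hY (measurable_pi_apply v).aestronglyMeasurable]
    exact hu.integral_blockScore (by omega) c w b v
  · rw [integral_map hY (hcoord v 2)]
    exact hu.integral_blockScore_sq_le (by omega) hσ hC c b (hw v)
  · rw [integral_map hY (hcoord v 4)]
    refine (integral_mono_of_nonneg (.of_forall fun ω => by positivity) hint4
      (.of_forall fun ω => ?_)).trans hle4
    rw [← Even.pow_abs (by decide)]
    exact pow_le_pow_left₀ (abs_nonneg _) (norm_le_pi_norm (blockScore c w b (u ω)) v) 4

lemma quadratics_le_matchedFunctions {a' : ℕ → ℝ} {u' : Ω → J → ℝ}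
    (hu : RowMoments P C q a u) (hu' : RowMoments P C q a' u') (hq : 2 ≤ q) (c : J → B)
    (w : ι → J → ℝ) (b : B) :
    quadratics ι ≤ matchedFunctions (P.map fun ω => blockScore c w b (u ω))
      (P.map fun ω => blockScore c w b (u' ω)) := by
  refine quadratics_le_matchedFunctions_map
    ((measurable_blockScore c w b).comp hu.measurable).aemeasurable
    ((measurable_blockScore c w b).comp hu'.measurable).aemeasurable
    (hu.memLp_blockScore hq c w b) (hu'.memLp_blockScore hq c w b) (fun v => ?_) fun v v' => ?_
  · rw [hu.integral_blockScore (by omega), hu'.integral_blockScore (by omega)]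
  · simp only [blockScore_eq_dotProduct]
    rw [hu.integral_dotProduct_mul hq, hu'.integral_dotProduct_mul hq]

end RowMoments
end BlockLaws

section Designs

open scoped Matrix

lemma dotProduct_mulVec_le_of_eigenvalues_le {J : Type*} [Fintype J] [DecidableEq J]
    {A : Matrix J J ℝ} (hA : A.IsHermitian) {M : ℝ} (h : ∀ j, hA.eigenvalues j ≤ M)
    (w : J → ℝ) : w ⬝ᵥ A *ᵥ w ≤ M * (w ⬝ᵥ w) := by
  open scoped MatrixOrder in
  have hle : A ≤ algebraMap ℝ _ M := by
    refine le_algebraMap_of_spectrum_le (fun x hx => ?_) hA.isSelfAdjoint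
    rw [hA.spectrum_real_eq_range_eigenvalues] at hx
    obtain ⟨j, rfl⟩ := hx
    exact h j
  have hw := (Matrix.le_iff.1 hle).dotProduct_mulVec_nonneg w
  simp only [star_trivial, Matrix.sub_mulVec, dotProduct_sub, Algebra.algebraMap_eq_smul_one,
    Matrix.smul_mulVec, Matrix.one_mulVec, dotProduct_smul, smul_eq_mul] at hw
  linarith

variable {Ω : Type*} [MeasurableSpace Ω] {P : Measure Ω}

lemma integral_abs_pow_le_of_eLpNorm_le [IsProbabilityMeasure P] {f : Ω → ℝ}
    (hf : AEStronglyMeasurable f P) {q k : ℕ} (hk : k ≤ q) {M : ℝ} (hM : 0 ≤ M)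
    (h : eLpNorm f q P ≤ ENNReal.ofReal M) : ∫ ω, |f ω| ^ k ∂P ≤ M ^ k := by
  obtain rfl | hk0 := eq_or_ne k 0
  · simp
  have hle : eLpNorm f k P ≤ ENNReal.ofReal M :=
    (eLpNorm_le_eLpNorm_of_exponent_le (by exact_mod_cast hk) hf).trans h
  rw [MemLp.eLpNorm_eq_integral_rpow_norm (by exact_mod_cast hk0) (by simp)
    ⟨hf, hle.trans_lt ENNReal.ofReal_lt_top⟩, ENNReal.ofReal_le_ofReal_iff hM] at hle
  simp only [ENNReal.toReal_natCast, Real.rpow_natCast, Real.norm_eq_abs] at hle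
  have h0 : 0 ≤ ∫ ω, |f ω| ^ k ∂P := integral_nonneg fun ω => by positivity
  calc ∫ ω, |f ω| ^ k ∂P = ((∫ ω, |f ω| ^ k ∂P) ^ (k : ℝ)⁻¹) ^ k :=
        (Real.rpow_inv_natCast_pow h0 hk0).symm
    _ ≤ M ^ k := pow_le_pow_left₀ (by positivity) hle k

/-- The `k`-th absolute moment of the standard Gaussian law. -/
noncomputable def gaussianAbsMoment (k : ℕ) : ℝ := ∫ x, |x| ^ k ∂(gaussianReal 0 1)

lemma gaussianAbsMoment_nonneg (k : ℕ) : 0 ≤ gaussianAbsMoment k :=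
  integral_nonneg fun _ => by positivity

lemma gaussianAbsMoment_zero : gaussianAbsMoment 0 = 1 := by
  simp [gaussianAbsMoment]

lemma integral_abs_pow_gaussianReal (v : ℝ≥0) (k : ℕ) :
    ∫ x, |x| ^ k ∂(gaussianReal 0 v) = √(v : ℝ) ^ k * gaussianAbsMoment k := by
  have h : (gaussianReal 0 1).map (√(v : ℝ) * ·) = gaussianReal 0 v := by
    rw [gaussianReal_map_const_mul]
    congr 1
    · simp
    · ext
      simp [Real.sq_sqrt]
  rw [← h, integral_map (by fun_prop) (by fun_prop)]
  simp only [abs_mul, mul_pow, abs_of_nonneg (Real.sqrt_nonneg _)]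
  rw [integral_const_mul, gaussianAbsMoment]

/-- A common bound for the absolute moments of order at most `q` of `√n` times an entry of either
design, when `M` bounds both the `q`-th moment norm of the covariates and the spectrum of the
covariance matrix. -/
noncomputable def momentBound (q : ℕ) (M : ℝ) : ℝ :=
  max 1 M ^ q * ∑ k ∈ Finset.range (q + 1), gaussianAbsMoment k

lemma pow_mul_gaussianAbsMoment_le_momentBound {q j k : ℕ} (hj : j ≤ q) (hk : k ≤ q) (M : ℝ) :
    max 1 M ^ j * gaussianAbsMoment k ≤ momentBound q M := by
  refine mul_le_mul (pow_le_pow_right₀ (le_max_left _ _) hj) ?_ (gaussianAbsMoment_nonneg k)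
    (by positivity)
  exact Finset.single_le_sum (f := gaussianAbsMoment) (fun k _ => gaussianAbsMoment_nonneg k)
    (Finset.mem_range.2 (Nat.lt_succ_of_le hk))

lemma one_le_momentBound (q : ℕ) (M : ℝ) : 1 ≤ momentBound q M := by
  simpa [gaussianAbsMoment_zero] using
    pow_mul_gaussianAbsMoment_le_momentBound (Nat.zero_le q) (Nat.zero_le q) M

variable {n p : ℕ} {Sig : Matrix (Fin p) (Fin p) ℝ}

lemma IsCovariateDesign.measurable_row {X : Ω → Fin n → Fin p → ℝ}
    (hX : IsCovariateDesign P Sig X) (i : Fin n) : Measurable fun ω => X ω i :=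
  (measurable_pi_apply i).comp hX.measurable

lemma IsCovariateDesign.rowMoments [IsProbabilityMeasure P] {X : Ω → Fin n → Fin p → ℝ}
    (hX : IsCovariateDesign P Sig X) {M : ℝ} {q : ℕ} (i : Fin n)
    (hmom : ∀ j, eLpNorm (fun ω => √(n : ℝ) * X ω i j) q P ≤ ENNReal.ofReal M) :
    RowMoments P ((1 / (n : ℝ)) • Sig) q (fun k => momentBound q M / √n ^ k) fun ω => X ω i := by
  have hsn : 0 < √(n : ℝ) := Real.sqrt_pos.2 (by exact_mod_cast i.pos)
  have hm : ∀ j, AEStronglyMeasurable (fun ω => √(n : ℝ) * X ω i j) P := fun j =>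
    (((measurable_pi_apply j).comp (hX.measurable_row i)).const_mul _).aestronglyMeasurable
  refine ⟨hX.measurable_row i, fun j => (hX.mean i j).2, fun j k => ?_, fun j => ?_,
    fun k hk j => ?_⟩
  · rw [(hX.second i j k).2, Matrix.smul_apply, smul_eq_mul, one_div_mul_eq_div]
  · have hL : MemLp (fun ω => √(n : ℝ) * X ω i j) q P :=
      ⟨hm j, (hmom j).trans_lt ENNReal.ofReal_lt_top⟩
    simpa [← mul_assoc, hsn.ne'] using hL.const_mul (√(n : ℝ))⁻¹
  · have hle := integral_abs_pow_le_of_eLpNorm_le (hm j) hk (M := max 1 M) (by positivity)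
      ((hmom j).trans (ENNReal.ofReal_le_ofReal (le_max_right _ _)))
    simp only [abs_mul, abs_of_pos hsn, mul_pow, integral_const_mul] at hle
    rw [le_div_iff₀' (by positivity)]
    refine hle.trans ?_
    simpa [gaussianAbsMoment_zero] using
      pow_mul_gaussianAbsMoment_le_momentBound hk (Nat.zero_le q) M

namespace IsGaussianDesign

variable {G : Ω → Fin n → Fin p → ℝ}

lemma measurable_row (hG : IsGaussianDesign P Sig G) (i : Fin n) : Measurable fun ω => G ω i :=
  (measurable_pi_apply i).comp hG.measurable

lemma hasGaussianLaw (hG : IsGaussianDesign P Sig G) (i : Fin n) :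
    HasGaussianLaw (fun ω => WithLp.toLp 2 (G ω i)) P := by
  constructor
  rw [hG.law i]
  infer_instance

lemma measurable_toLp_row (hG : IsGaussianDesign P Sig G) (i : Fin n) :
    Measurable fun ω => WithLp.toLp 2 (G ω i) :=
  (by fun_prop : Measurable fun u : Fin p → ℝ => WithLp.toLp 2 u).comp (hG.measurable_row i)

lemma measurePreserving_eval (hG : IsGaussianDesign P Sig G) (hS : Sig.PosSemidef) (i : Fin n)
    (j : Fin p) :
    MeasurePreserving (fun ω => G ω i j) P (gaussianReal 0 (Sig j j / n).toNNReal) := by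
  have heval := measurePreserving_eval_multivariateGaussian (μ := 0)
    (hS.smul (by positivity : 0 ≤ 1 / (n : ℝ))) (i := j)
  rw [← hG.law i] at heval
  simpa [Function.comp_def, inv_mul_eq_div] using
    heval.comp ((hG.measurable_toLp_row i).measurePreserving P)

lemma memLp (hG : IsGaussianDesign P Sig G) (hS : Sig.PosSemidef) (i : Fin n)
    (j : Fin p) (k : ℕ) : MemLp (fun ω => G ω i j) k P :=
  (memLp_id_gaussianReal' (k : ℝ≥0∞) (by simp)).comp_measurePreserving
    (hG.measurePreserving_eval hS i j)

lemma integral_eq_zero (hG : IsGaussianDesign P Sig G) (hS : Sig.PosSemidef) (i : Fin n)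
    (j : Fin p) : ∫ ω, G ω i j ∂P = 0 := by
  have h := integral_id_gaussianReal (μ := 0) (v := (Sig j j / n).toNNReal)
  have hmp := hG.measurePreserving_eval hS i j
  rwa [← hmp.map_eq, integral_map hmp.measurable.aemeasurable (by fun_prop)] at h

lemma covariance_eq (hG : IsGaussianDesign P Sig G) (hS : Sig.PosSemidef) (i : Fin n)
    (j k : Fin p) : cov[fun ω => G ω i j, fun ω => G ω i k; P] = Sig j k / n := by
  have h := covariance_eval_multivariateGaussian (μ := 0)
    (hS.smul (by positivity : 0 ≤ 1 / (n : ℝ))) j k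
  rw [← hG.law i, covariance_map (by fun_prop) (by fun_prop)
    (hG.measurable_toLp_row i).aemeasurable] at h
  rw [Matrix.smul_apply, smul_eq_mul, one_div_mul_eq_div] at h
  exact h

lemma integral_abs_pow_le (hG : IsGaussianDesign P Sig G) (hS : Sig.PosSemidef) {M : ℝ}
    (i : Fin n) {j : Fin p} (hM : Sig j j ≤ M) {k q : ℕ} (hk : k ≤ q) :
    ∫ ω, |G ω i j| ^ k ∂P ≤ momentBound q M / √n ^ k := by
  have hn0 : (0 : ℝ) < n := by exact_mod_cast i.pos
  have hmp := hG.measurePreserving_eval hS i j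
  rw [← integral_map (f := fun x => |x| ^ k) hmp.measurable.aemeasurable (by fun_prop),
    hmp.map_eq, integral_abs_pow_gaussianReal]
  have hone : (1 : ℝ) ≤ max 1 M := le_max_left _ _
  have hsd : √((Sig j j / n).toNNReal : ℝ) ≤ max 1 M / √n := by
    rw [Real.coe_toNNReal', Real.sqrt_le_iff, div_pow, Real.sq_sqrt hn0.le]
    refine ⟨by positivity, max_le ?_ (by positivity)⟩
    gcongr
    exact hM.trans ((le_max_right _ _).trans (le_self_pow₀ hone two_ne_zero))
  calc √((Sig j j / n).toNNReal : ℝ) ^ k * gaussianAbsMoment k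
      ≤ (max 1 M / √n) ^ k * gaussianAbsMoment k := by
        have := gaussianAbsMoment_nonneg k
        gcongr
    _ = max 1 M ^ k * gaussianAbsMoment k / √n ^ k := by rw [div_pow]; ring
    _ ≤ momentBound q M / √n ^ k := by
        gcongr
        exact pow_mul_gaussianAbsMoment_le_momentBound hk hk M

lemma rowMoments [IsProbabilityMeasure P] (hG : IsGaussianDesign P Sig G) (hS : Sig.PosSemidef)
    {M : ℝ} (hM : ∀ j, Sig j j ≤ M) (q : ℕ) (i : Fin n) :
    RowMoments P ((1 / (n : ℝ)) • Sig) q (fun k => momentBound q M / √n ^ k) fun ω => G ω i := by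
  refine ⟨hG.measurable_row i, hG.integral_eq_zero hS i, fun j k => ?_,
    fun j => hG.memLp hS i j q, fun k hk j => hG.integral_abs_pow_le hS i (hM j) hk⟩
  have hcov := hG.covariance_eq hS i j k
  rw [covariance_eq_sub (hG.memLp hS i j 2) (hG.memLp hS i k 2), hG.integral_eq_zero hS,
    zero_mul, sub_zero] at hcov
  rw [Matrix.smul_apply, smul_eq_mul, one_div_mul_eq_div, ← hcov]
  rfl

/-- Cells that are independent in the covariate design are uncorrelated, hence independent in the
Gaussian design. -/
lemma iIndepFun_cells [IsProbabilityMeasure P] (hG : IsGaussianDesign P Sig G)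
    (hS : Sig.PosSemidef) {X : Ω → Fin n → Fin p → ℝ} (hX : IsCovariateDesign P Sig X)
    {B : Type*} [Finite B] (c : Fin p → B) (i : Fin n)
    (hcells : iIndepFun (fun (b : B) (ω : Ω) (j : {j : Fin p // c j = b}) => X ω i j) P) :
    iIndepFun (fun (b : B) (ω : Ω) (j : {j : Fin p // c j = b}) => G ω i j) P := by
  classical
  have := Fintype.ofFinite B
  have hXm : ∀ j, Measurable fun ω => X ω i j := fun j =>
    (measurable_pi_apply j).comp (hX.measurable_row i)
  refine HasGaussianLaw.iIndepFun_of_covariance_eval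
    (X := fun (b : B) (j : {j : Fin p // c j = b}) ω => G ω i j) ?_ fun b b' hbb j j' => ?_
  · let T : EuclideanSpace ℝ (Fin p) →L[ℝ] ((b : B) → {j : Fin p // c j = b} → ℝ) :=
      .pi fun b => .pi fun j => EuclideanSpace.proj (j : Fin p)
    exact (hG.hasGaussianLaw i).map_fun T
  · rw [hG.covariance_eq hS, ← (hX.second i j j').2]
    have hind : (fun ω => X ω i j) ⟂ᵢ[P] (fun ω => X ω i j') :=
      (hcells.indepFun hbb).comp (φ := fun r : {j : Fin p // c j = b} → ℝ => r j)
        (ψ := fun r : {j : Fin p // c j = b'} → ℝ => r j') (measurable_pi_apply j)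
        (measurable_pi_apply j')
    rw [hind.integral_fun_mul_eq_mul_integral (hXm _).aestronglyMeasurable
      (hXm _).aestronglyMeasurable, (hX.mean i j).2, zero_mul]

end IsGaussianDesign
end Designs

section FixedNoise

open scoped Matrix

section Average

variable {n : ℕ}

lemma Av_mono {f f' : Fin n → ℝ} (h : ∀ i, f i ≤ f' i) : Av f ≤ Av f' :=
  mul_le_mul_of_nonneg_left (Finset.sum_le_sum fun i _ => h i) (by positivity)

lemma Av_nonneg {f : Fin n → ℝ} (h : ∀ i, 0 ≤ f i) : 0 ≤ Av f :=
  mul_nonneg (by positivity) (Finset.sum_nonneg fun i _ => h i)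

lemma Av_const (hn : n ≠ 0) (b : ℝ) : Av (fun _ : Fin n => b) = b := by
  simp [Av, hn]

lemma Av_mul_const (f : Fin n → ℝ) (b : ℝ) : Av (fun i => f i * b) = Av f * b := by
  rw [Av, ← Finset.sum_mul, ← mul_assoc, Av]

lemma sum_eq_mul_Av (hn : n ≠ 0) (f : Fin n → ℝ) : ∑ i, f i = n * Av f := by
  rw [Av, ← mul_assoc, mul_one_div_cancel (Nat.cast_ne_zero.2 hn), one_mul]

lemma abs_Av_sub_le {f f' b : Fin n → ℝ} (h : ∀ i, |f i - f' i| ≤ b i) :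
    |Av f - Av f'| ≤ Av b := by
  rw [Av, Av, Av, ← mul_sub, ← Finset.sum_sub_distrib, abs_mul, abs_of_nonneg (by positivity)]
  gcongr
  exact (Finset.abs_sum_le_sum_abs _ _).trans (Finset.sum_le_sum fun i _ => h i)

end Average

lemma abs_sum_mul_le {p : ℕ} (x : Fin p → ℝ) {u : Fin p → ℝ} {L : ℝ} (hu : ∀ j, |u j| ≤ L) :
    |∑ j, x j * u j| ≤ L * ∑ j, |x j| := by
  rw [Finset.mul_sum]
  refine (Finset.abs_sum_le_sum_abs _ _).trans (Finset.sum_le_sum fun j _ => ?_)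
  rw [abs_mul, mul_comm]
  exact mul_le_mul_of_nonneg_right (hu j) (abs_nonneg _)

variable {n p k : ℕ} {ℓ' : Fin n → ℝ → ℝ} {A : Fin n → ℝ}

lemma abs_Av_score_sub_le (hA : ∀ i, 0 ≤ A i)
    (hmod : ∀ i z z', |ℓ' i z - ℓ' i z'| ≤ A i * |z - z'| * (1 + |z| + |z'|)) {L δ : ℝ}
    (hL : 1 ≤ L) (hδ : 0 ≤ δ) (x : Fin n → Fin p → ℝ) {u u' : Fin p → ℝ} (hu : ∀ j, |u j| ≤ L)
    (hu' : ∀ j, |u' j| ≤ L) (huu' : ∀ j, |u j - u' j| ≤ δ) :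
    |Av (fun i => ℓ' i (∑ j, x i j * u j)) - Av (fun i => ℓ' i (∑ j, x i j * u' j))|
      ≤ 3 * L * δ * Av fun i => A i * (1 + (∑ j, |x i j|) ^ 2) := by
  rw [mul_comm, ← Av_mul_const]
  refine abs_Av_sub_le fun i => (hmod i _ _).trans ?_
  have hsub : |∑ j, x i j * u j - ∑ j, x i j * u' j| ≤ δ * ∑ j, |x i j| := by
    simp only [← Finset.sum_sub_distrib, ← mul_sub]
    exact abs_sum_mul_le (x i) huu'
  have hsize := abs_sum_mul_le (x i) hu
  have hsize' := abs_sum_mul_le (x i) hu'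
  set N := ∑ j, |x i j|
  have : 0 ≤ N := Finset.sum_nonneg fun j _ => abs_nonneg _
  have hAi := hA i
  calc A i * |∑ j, x i j * u j - ∑ j, x i j * u' j|
        * (1 + |∑ j, x i j * u j| + |∑ j, x i j * u' j|)
      ≤ A i * (δ * N) * (1 + L * N + L * N) := by gcongr
    _ = A i * δ * (N + 2 * L * N ^ 2) := by ring
    _ ≤ A i * δ * (L * (1 + N ^ 2) + 2 * L * (1 + N ^ 2)) := by
        gcongr
        · nlinarith [sq_nonneg (N - 1)]
        · linarith
    _ = A i * (1 + N ^ 2) * (3 * L * δ) := by ring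

/-- Within a cell of side `δ` the average loss oscillates by at most the modulus term, so the
minimum over `S` reduces to a softmin over representatives of the cells. -/
lemma exists_abs_minRisk_sub_softmin_le (hn : n ≠ 0) (h0 : ∀ i z, 0 ≤ ℓ' i z)
    (hA : ∀ i, 0 ≤ A i)
    (hmod : ∀ i z z', |ℓ' i z - ℓ' i z'| ≤ A i * |z - z'| * (1 + |z| + |z'|)) {ℓ : Fin n → ℝ → ℝ}
    {ε : ℝ} (hε : ∀ i z, |ℓ i z - ℓ' i z| ≤ ε) {R : (Fin p → ℝ) → ℝ} {S : Set (Fin p → ℝ)}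
    (hSne : S.Nonempty) (hRS : BddBelow (R '' S)) {L : ℝ} (hL : 1 ≤ L)
    (hS : ∀ w ∈ S, ∀ j, w j ∈ Set.Icc (-L) L) {δ lam : ℝ} (hδ : 0 < δ) (hlam : 0 < lam)
    (c : Fin p → Fin k) :
    ∃ (T : Finset (Fin p → ℤ)) (w : T → Fin p → ℝ) (b : T → ℝ), Nonempty T ∧
      (∀ v j, |w v j| ≤ L) ∧ ∀ x : Fin n → Fin p → ℝ,
        |minRisk ℓ' R S x - softmin (n * lam)
            (blockRisk n ℓ b fun a : Fin n × Fin k => blockScore c w a.2 (x a.1))|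
          ≤ 3 * L * δ * Av (fun i => A i * (1 + (∑ j, |x i j|) ^ 2))
            + (ε + p * Real.log (2 * (L / δ) + 2) / (n * lam)) := by
  have : Nonempty S := hSne.to_subtype
  have hβ : 0 < n * lam := by positivity
  obtain ⟨T, cell, hcell, hdiam, hcard⟩ := exists_finite_cells hSne (by linarith) hS hδ
  have hbound (u : S) (j : Fin p) : |(u : Fin p → ℝ) j| ≤ L := abs_le.2 (hS u u.2 j)
  let rep : T → S := Function.surjInv hcell
  refine ⟨T, fun v => rep v, fun v => ⨅ u : {u // cell u = v}, R u, .map cell inferInstance,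
    fun v => hbound (rep v), fun x => ?_⟩
  have happrox := abs_iInf_add_sub_softmin_le (Function.surjInv_eq hcell) (R := fun u : S => R u)
    (h := fun u : S => Av fun i => ℓ' i (∑ j, x i j * (u : Fin p → ℝ) j))
    (h' := fun v => Av fun i => ℓ i (∑ j, x i j * (rep v : Fin p → ℝ) j))
    (by simpa [Set.image_eq_range] using hRS) (fun u => Av_nonneg fun i => h0 i _) hβ
    (fun u u' h => abs_Av_score_sub_le hA hmod hL hδ.le x (hbound u) (hbound u') (hdiam u u' h))
    (fun v => (abs_Av_sub_le fun i => hε i _).trans_eq (Av_const hn ε))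
  have hrisk (w : T → Fin p → ℝ) (b : T → ℝ) :
      blockRisk n ℓ b (fun a : Fin n × Fin k => blockScore c w a.2 (x a.1))
        = fun v => b v + Av fun i => ℓ i (∑ j, x i j * w v j) := by
    funext v
    simp only [blockRisk, Av, sum_blockScore, one_div_mul_eq_div]
  rw [hrisk]
  refine happrox.trans ?_
  rw [add_assoc, Fintype.card_coe]
  gcongr

lemma sum_score_moments_le (hn : n ≠ 0) (hA : ∀ i, 0 ≤ A i) {card : Fin k → ℝ} {s : ℝ}
    (hcard : ∑ b, card b = s) (hs : 0 ≤ s) {a₃ a' d θ L : ℝ} (ha₃ : 0 ≤ a₃) (hL : 1 ≤ L)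
    {m : ℕ} :
    ∑ b : Fin n × Fin k, A b.1 * (L ^ 3 * d ^ 2 * (card b.2 * a₃) * (1 + 2 ^ m * (2 * (θ * L) ^ m))
        + 2 ^ m * (L ^ (3 + m) * d ^ (2 + m) * (card b.2 * a')))
      ≤ n * (Av A * (L ^ (3 + m) * d ^ 2
        * (s * a₃ * (1 + 2 ^ m * (2 * θ ^ m)) + 2 ^ m * d ^ m * (s * a')))) := by
  have hsize : 1 + 2 ^ m * (2 * (θ * L) ^ m) ≤ L ^ m * (1 + 2 ^ m * (2 * θ ^ m)) := by
    rw [mul_pow]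
    linarith [one_le_pow₀ hL (n := m)]
  have hsum (r r' : ℝ) : ∑ b : Fin n × Fin k, A b.1 * (card b.2 * r + card b.2 * r')
      = n * (Av A * (s * (r + r'))) := by
    simp only [← mul_add]
    rw [Fintype.sum_prod_type, ← mul_assoc, ← sum_eq_mul_Av hn, ← hcard,
      Finset.sum_mul _ card, Finset.sum_mul_sum]
  have hAv := Av_nonneg hA
  calc _ = ∑ b : Fin n × Fin k, A b.1
          * (card b.2 * (L ^ 3 * d ^ 2 * a₃ * (1 + 2 ^ m * (2 * (θ * L) ^ m)))
            + card b.2 * (2 ^ m * (L ^ (3 + m) * d ^ (2 + m) * a'))) :=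
        Finset.sum_congr rfl fun b _ => by ring
    _ = n * (Av A * (s * (L ^ 3 * d ^ 2 * a₃ * (1 + 2 ^ m * (2 * (θ * L) ^ m))
          + 2 ^ m * (L ^ (3 + m) * d ^ (2 + m) * a')))) := hsum _ _
    _ ≤ n * (Av A * (s * (L ^ 3 * d ^ 2 * a₃ * (L ^ m * (1 + 2 ^ m * (2 * θ ^ m)))
          + 2 ^ m * (L ^ (3 + m) * d ^ (2 + m) * a')))) := by
        gcongr
    _ = _ := by ring

variable {Ω : Type*} [MeasurableSpace Ω] {P : Measure Ω}

/-- A random matrix with independent rows, whose rows have independent subvectors on the fibres of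
`c` and satisfy `RowMoments` with common parameters. -/
structure BlockDesign (P : Measure Ω) (C : Matrix (Fin p) (Fin p) ℝ) (q : ℕ) (a : ℕ → ℝ)
    (c : Fin p → Fin k) (X : Ω → Fin n → Fin p → ℝ) : Prop where
  measurable : Measurable X
  indep : iIndepFun (fun i ω => X ω i) P
  cells : ∀ i, iIndepFun (fun (b : Fin k) (ω : Ω) (j : {j : Fin p // c j = b}) => X ω i j) P
  rows : ∀ i, RowMoments P C q a fun ω => X ω i

namespace BlockDesign

variable [IsProbabilityMeasure P] {C : Matrix (Fin p) (Fin p) ℝ} {q : ℕ} {a : ℕ → ℝ}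
  {c : Fin p → Fin k} {X : Ω → Fin n → Fin p → ℝ}

lemma integral_Av_le (hX : BlockDesign P C q a c X) (hq : 2 ≤ q) (hA : ∀ i, 0 ≤ A i) :
    Integrable (fun ω => Av fun i => A i * (1 + (∑ j, |X ω i j|) ^ 2)) P ∧
      ∫ ω, Av (fun i => A i * (1 + (∑ j, |X ω i j|) ^ 2)) ∂P ≤ Av A * (1 + p ^ 2 * a 2) := by
  have hrow (i : Fin n) : Integrable (fun ω => (∑ j, |X ω i j|) ^ 2) P ∧
      ∫ ω, (∑ j, |X ω i j|) ^ 2 ∂P ≤ p ^ 2 * a 2 := by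
    have h := (hX.rows i).integral_pow_sum_abs_le (m := 1) (d := p) hq (F := Finset.univ) (by simp)
      zero_le_one
    simp only [one_mul, one_pow, pow_one, Finset.card_univ, Fintype.card_fin] at h
    exact ⟨h.1, h.2.trans_eq (by ring)⟩
  have hint (i : Fin n) : Integrable (fun ω => A i * (1 + (∑ j, |X ω i j|) ^ 2)) P :=
    ((integrable_const 1).add (hrow i).1).const_mul _
  refine ⟨(integrable_finsetSum _ fun i _ => hint i).const_mul _, ?_⟩
  rw [← Av_mul_const]
  simp only [Av]
  rw [integral_const_mul, integral_finsetSum _ fun i _ => hint i]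
  gcongr with i
  rw [integral_const_mul, integral_add (integrable_const 1) (hrow i).1]
  have := hA i
  gcongr
  · simp
  · exact (hrow i).2

omit [IsProbabilityMeasure P] in
lemma measurable_blockScore_row (hX : BlockDesign P C q a c X) {ι : Type*} (w : ι → Fin p → ℝ)
    (b : Fin n × Fin k) : Measurable fun ω => blockScore c w b.2 (X ω b.1) :=
  (measurable_blockScore c w b.2).comp ((measurable_pi_apply b.1).comp hX.measurable)

lemma abs_integral_comp_sub_le (hX : BlockDesign P C q a c X) (hq : 2 ≤ q) (hA : ∀ i, 0 ≤ A i)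
    {ι : Type*} {w : ι → Fin p → ℝ} {F : (Fin n → Fin p → ℝ) → ℝ}
    {f : (Fin n × Fin k → ι → ℝ) → ℝ} (hF : Measurable F) (hf : Measurable f) {r E : ℝ}
    (hr : 0 ≤ r) (h : ∀ x, |F x - f fun a => blockScore c w a.2 (x a.1)|
      ≤ r * Av (fun i => A i * (1 + (∑ j, |x i j|) ^ 2)) + E) {g : ℝ → ℝ} {K : ℝ≥0}
    (hgK : ∀ x, |g x| ≤ K) (hg : LipschitzWith K g) :
    |∫ ω, g (F (X ω)) ∂P
        - ∫ x, g (f x) ∂(Measure.pi fun b : Fin n × Fin k =>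
            P.map fun ω => blockScore c w b.2 (X ω b.1))|
      ≤ K * (r * (Av A * (1 + p ^ 2 * a 2)) + E) := by
  have hbm : Measurable fun ω (b : Fin n × Fin k) => blockScore c w b.2 (X ω b.1) :=
    measurable_pi_lambda _ fun b => hX.measurable_blockScore_row w b
  have hgm := hg.continuous.measurable
  have hint : Integrable (fun ω => g (F (X ω))) P :=
    integrable_of_measurable_of_abs_le (hgm.comp (hF.comp hX.measurable)) fun _ => hgK _
  have hint' : Integrable (fun ω => g (f fun b => blockScore c w b.2 (X ω b.1))) P :=
    integrable_of_measurable_of_abs_le (hgm.comp (hf.comp hbm)) fun _ => hgK _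
  obtain ⟨hmod, hmodle⟩ := hX.integral_Av_le hq hA
  have hbound := ((hmod.const_mul r).add (integrable_const E)).const_mul (K : ℝ)
  rw [← map_blockScore_eq_pi hX.measurable hX.indep c hX.cells,
    integral_map hbm.aemeasurable (f := fun x => g (f x))
      (hgm.comp hf).aestronglyMeasurable, ← integral_sub hint hint']
  refine (norm_integral_le_of_norm_le hbound (.of_forall fun ω =>
    (hg.norm_sub_le _ _).trans (mul_le_mul_of_nonneg_left (h (X ω)) K.2))).trans ?_
  simp only [Pi.add_apply]
  rw [integral_const_mul, integral_add (hmod.const_mul r) (integrable_const E), integral_const_mul]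
  gcongr
  simp

lemma isProbabilityMeasure_map_blockScore (hX : BlockDesign P C q a c X) {ι : Type*}
    (w : ι → Fin p → ℝ) (b : Fin n × Fin k) :
    IsProbabilityMeasure (P.map fun ω => blockScore c w b.2 (X ω b.1)) :=
  Measure.isProbabilityMeasure_map (hX.measurable_blockScore_row w b).aemeasurable

/-- The hypothesis on `θ` makes `θ * L` an `L⁴` bound for the scores. -/
lemma abs_integral_softmin_sub_le {G : Ω → Fin n → Fin p → ℝ} (hX : BlockDesign P C q a c X)
    (hG : BlockDesign P C q a c G) {σ : ℝ} (hσ : 0 ≤ σ)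
    (hC : ∀ w, w ⬝ᵥ C *ᵥ w ≤ σ * (w ⬝ᵥ w)) {d : ℕ}
    (hd : ∀ b, ({j | c j = b} : Finset (Fin p)).card ≤ d) {m : ℕ} (hm : m ≤ 4) (hmq : 3 + m ≤ q)
    (hq : 4 ≤ q) (ha : ∀ k, 0 ≤ a k) {θ : ℝ} (hθ : 0 < θ)
    (hθle : d ^ 3 * (p * a 4) + 3 * (σ * p) ^ 2 ≤ θ ^ 4)
    (hn : 1 ≤ n) {lam D K L : ℝ} (hlam : 1 ≤ lam) (hD : 1 ≤ D) (hL : 1 ≤ L)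
    {ℓ : Fin n → ℕ → ℝ → ℝ} {Dom : Fin n → ℝ → ℝ} (hℓ : SmoothLosses ℓ Dom D m A)
    {g : ℕ → ℝ → ℝ} (hg : IsJet 3 g) (hgK : ∀ k ≤ 3, ∀ x, |g k x| ≤ K)
    {ι : Type*} [Fintype ι] [Nonempty ι] (cost : ι → ℝ)
    {w : ι → Fin p → ℝ} (hw : ∀ v j, |w v j| ≤ L) :
    |∫ x, g 0 (softmin (n * lam) (blockRisk n (fun i => ℓ i 0) cost x))
          ∂(Measure.pi fun b : Fin n × Fin k => P.map fun ω => blockScore c w b.2 (X ω b.1))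
        - ∫ x, g 0 (softmin (n * lam) (blockRisk n (fun i => ℓ i 0) cost x))
          ∂(Measure.pi fun b : Fin n × Fin k => P.map fun ω => blockScore c w b.2 (G ω b.1))|
      ≤ 46 * K * D * lam ^ 2 * Av A * (L ^ (3 + m) * d ^ 2
        * (p * a 3 * (1 + 2 ^ m * (2 * θ ^ m)) + 2 ^ m * d ^ m * (p * a (3 + m)))) := by
  have := hX.isProbabilityMeasure_map_blockScore w
  have := hG.isProbabilityMeasure_map_blockScore w
  have hL0 : 0 ≤ L := by linarith
  let card : Fin k → ℝ := fun b => ({j | c j = b} : Finset (Fin p)).card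
  have hcard : ∑ b, card b = p := by
    simpa [card] using congrArg (Nat.cast (R := ℝ)) (sum_card_fibre c)
  have hfourth : ∑ b, L ^ 4 * d ^ 3 * (card b * a 4) + 3 * (∑ b, σ * (card b * L ^ 2)) ^ 2
      ≤ (θ * L) ^ 4 := by
    rw [← Finset.mul_sum, ← Finset.mul_sum, ← Finset.sum_mul, ← Finset.sum_mul, hcard]
    linear_combination L ^ 4 * hθle
  refine (abs_integral_softmin_blockRisk_sub_le _ _
    (fun b => (hX.rows b.1).quadratics_le_matchedFunctions (hG.rows b.1) (by omega) c w b.2)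
    (by exact_mod_cast hn) hlam hD hℓ hm hg hgK cost
    (fun b => (hX.rows b.1).blockMoments hσ hC hL0 hw c b.2 (hd b.2) hmq hq)
    (fun b => (hG.rows b.1).blockMoments hσ hC hL0 hw c b.2 (hd b.2) hmq hq)
    (mul_pos hθ (by linarith)) fun _ => hfourth).trans ?_
  have hK : 0 ≤ K := (abs_nonneg _).trans (hgK 0 (by norm_num) 0)
  calc _ ≤ 46 * K * D * lam ^ 2 / n * (n * (Av A * (L ^ (3 + m) * d ^ 2
        * (p * a 3 * (1 + 2 ^ m * (2 * θ ^ m)) + 2 ^ m * d ^ m * (p * a (3 + m)))))) := by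
        gcongr
        exact sum_score_moments_le (by omega) hℓ.nonneg hcard p.cast_nonneg (ha 3) hL
    _ = _ := by
        have : (n : ℝ) ≠ 0 := Nat.cast_ne_zero.2 (by omega)
        field_simp

end BlockDesign

lemma IsJet.lipschitzWith {r : ℕ} {f : ℕ → ℝ → ℝ} (hf : IsJet r f) (hr : 1 ≤ r) {K : ℝ≥0}
    (hK : ∀ t, |f 1 t| ≤ K) : LipschitzWith K (f 0) :=
  lipschitzWith_of_nnnorm_deriv_le (fun t => (hf 0 hr t).differentiableAt) fun t => by
    rw [(hf 0 hr t).deriv]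
    exact hK t

/-- Nonnegative losses `ℓ'` with a locally Lipschitz modulus that are within `ε` of the smooth
losses `ℓ`. -/
structure SmoothApprox {I : Type*} (ℓ' : I → ℝ → ℝ) (ℓ : I → ℕ → ℝ → ℝ) (Dom : I → ℝ → ℝ) (D : ℝ)
    (m : ℕ) (A : I → ℝ) (ε : ℝ) : Prop extends SmoothLosses ℓ Dom D m A where
  loss_nonneg : ∀ i z, 0 ≤ ℓ' i z
  modulus : ∀ i z z', |ℓ' i z - ℓ' i z'| ≤ A i * |z - z'| * (1 + |z| + |z'|)
  abs_sub_le : ∀ i z, |ℓ i 0 z - ℓ' i z| ≤ ε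

/-- An `L⁴` bound for the scores, relative to the size of the weights, when `p ≤ T * n`, the
absolute moments of the entries are at most `A₀ / √n ^ k`, and the spectrum of their covariance is
at most `M / n`. -/
noncomputable def scoreBound (T A₀ M : ℝ) : ℝ := 1 + T * A₀ + 3 * (M * T) ^ 2

/-- The constant in `abs_integral_minRisk_sub_le`. -/
noncomputable def comparisonConst (T A₀ M : ℝ) (m : ℕ) : ℝ :=
  6 * (1 + T ^ 2 * A₀) + 46 * (T * A₀) * (1 + 2 ^ m * (2 * scoreBound T A₀ M ^ m) + 2 ^ m)

section Arithmetic

variable {n p d : ℕ} {T A₀ M : ℝ}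

lemma one_add_sq_mul_le (hn : 1 ≤ n) (hA₀ : 0 ≤ A₀) (hp : p ≤ T * n) :
    1 + (p : ℝ) ^ 2 * (A₀ / √n ^ 2) ≤ (1 + T ^ 2 * A₀) * n := by
  have hn' : (1 : ℝ) ≤ n := by exact_mod_cast hn
  rw [Real.sq_sqrt n.cast_nonneg]
  calc 1 + (p : ℝ) ^ 2 * (A₀ / n) ≤ 1 + (T * n) ^ 2 * (A₀ / n) := by gcongr
    _ = 1 + T ^ 2 * A₀ * n := by field_simp
    _ ≤ (1 + T ^ 2 * A₀) * n := by linarith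

lemma mul_moment_three_add_le (hn : 1 ≤ n) (hA₀ : 0 ≤ A₀) (hp : p ≤ T * n) (m : ℕ)
    (hd : d ^ 2 ≤ n) : d ^ m * (p * (A₀ / √n ^ (3 + m))) ≤ T * A₀ / √n := by
  have : 0 < √(n : ℝ) := Real.sqrt_pos.2 (by exact_mod_cast hn)
  have hd' : (d : ℝ) ≤ √n := Real.le_sqrt_of_sq_le (by exact_mod_cast hd)
  have hsq : √(n : ℝ) ^ 2 = n := Real.sq_sqrt n.cast_nonneg
  calc d ^ m * (p * (A₀ / √n ^ (3 + m))) ≤ √n ^ m * (T * √n ^ 2 * (A₀ / √n ^ (3 + m))) := by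
        rw [hsq]
        gcongr
    _ = T * A₀ / √n := by
        field_simp
        ring

lemma fourth_moment_le_scoreBound_pow (hn : 1 ≤ n) (hA₀ : 0 ≤ A₀) (hM : 0 ≤ M) (hp : p ≤ T * n)
    (hd : d ^ 3 ≤ n) :
    (d : ℝ) ^ 3 * (p * (A₀ / √n ^ 4)) + 3 * (M / n * p) ^ 2 ≤ scoreBound T A₀ M ^ 4 := by
  have hn' : (0 : ℝ) < n := by exact_mod_cast hn
  have hT : 0 ≤ T := nonneg_of_mul_nonneg_left (p.cast_nonneg.trans hp) hn'
  have hsq : √(n : ℝ) ^ 4 = n ^ 2 := by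
    rw [show 4 = 2 * 2 from rfl, pow_mul, Real.sq_sqrt n.cast_nonneg]
  calc (d : ℝ) ^ 3 * (p * (A₀ / √n ^ 4)) + 3 * (M / n * p) ^ 2
      ≤ n * (T * n * (A₀ / n ^ 2)) + 3 * (M / n * (T * n)) ^ 2 := by
        rw [hsq]
        gcongr
        exact_mod_cast hd
    _ = T * A₀ + 3 * (M * T) ^ 2 := by field_simp
    _ ≤ scoreBound T A₀ M := by rw [scoreBound]; linarith
    _ ≤ scoreBound T A₀ M ^ 4 :=
        le_self_pow₀ (by rw [scoreBound]; nlinarith [mul_nonneg hT hA₀]) (by norm_num)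

/-- The two terms come from the passage to a softmin over a net and from the exchange of the two
designs. -/
lemma comparison_error_le (hn : 1 ≤ n) (hA₀ : 0 ≤ A₀) (hp : p ≤ T * n) (hd : d ^ 3 ≤ n) {m : ℕ}
    {K a L δ ε B lam D : ℝ} (hK : 0 ≤ K) (ha : 0 ≤ a) (hL : 0 ≤ L) (hδ : 0 ≤ δ) (hB : 0 ≤ B)
    (hlam : 0 < lam) (hD : 0 ≤ D) :
    2 * (K * (3 * L * δ * (a * (1 + p ^ 2 * (A₀ / √n ^ 2))) + (ε + p * B / (n * lam))))
      + 46 * K * D * lam ^ 2 * a * (L ^ (3 + m) * d ^ 2 * (p * (A₀ / √n ^ 3)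
        * (1 + 2 ^ m * (2 * scoreBound T A₀ M ^ m)) + 2 ^ m * d ^ m * (p * (A₀ / √n ^ (3 + m)))))
      ≤ 2 * K * (ε + T * B / lam) + comparisonConst T A₀ M m * K * a
        * (n * L * δ + D * lam ^ 2 * (L ^ (3 + m) * d ^ 2 / √n)) := by
  have hn' : (0 : ℝ) < n := by exact_mod_cast hn
  have hT : 0 ≤ T := nonneg_of_mul_nonneg_left (p.cast_nonneg.trans hp) hn'
  have hθ : 0 ≤ scoreBound T A₀ M := by unfold scoreBound; positivity
  have hd2 : d ^ 2 ≤ n := by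
    rcases d.eq_zero_or_pos with rfl | hd0
    · simp
    · exact (Nat.pow_le_pow_right hd0 (by norm_num)).trans hd
  have hlog : p * B / (n * lam) ≤ T * B / lam := by
    rw [mul_comm (n : ℝ), div_mul_eq_div_div_swap]
    gcongr
    rw [mul_div_right_comm]
    gcongr
    exact (div_le_iff₀ hn').2 hp
  have h3 := mul_moment_three_add_le hn hA₀ hp 0 hd2
  simp only [pow_zero, one_mul, add_zero] at h3
  have hm := mul_moment_three_add_le hn hA₀ hp m hd2
  rw [mul_assoc (2 ^ m) ((d : ℝ) ^ m)]
  calc _ ≤ 2 * (K * (3 * L * δ * (a * ((1 + T ^ 2 * A₀) * n)) + (ε + T * B / lam)))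
        + 46 * K * D * lam ^ 2 * a * (L ^ (3 + m) * d ^ 2 * (T * A₀ / √n
          * (1 + 2 ^ m * (2 * scoreBound T A₀ M ^ m)) + 2 ^ m * (T * A₀ / √n))) := by
        gcongr
        exact one_add_sq_mul_le hn hA₀ hp
    _ = 2 * K * (ε + T * B / lam) + K * a * (6 * (1 + T ^ 2 * A₀) * (n * L * δ)
          + 46 * (T * A₀) * (1 + 2 ^ m * (2 * scoreBound T A₀ M ^ m) + 2 ^ m)
            * (D * lam ^ 2 * (L ^ (3 + m) * d ^ 2 / √n))) := by ring
    _ ≤ _ := by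
        have hterms : 0 ≤ 6 * (1 + T ^ 2 * A₀) * (D * lam ^ 2 * (L ^ (3 + m) * d ^ 2 / √n))
          + 46 * (T * A₀) * (1 + 2 ^ m * (2 * scoreBound T A₀ M ^ m) + 2 ^ m) * (n * L * δ) := by
          positivity
        rw [comparisonConst]
        linear_combination mul_nonneg (mul_nonneg hK ha) hterms

end Arithmetic

theorem abs_integral_minRisk_sub_le [IsProbabilityMeasure P] {C : Matrix (Fin p) (Fin p) ℝ} {q : ℕ}
    {c : Fin p → Fin k} {A₀ M T : ℝ} (hA₀ : 0 ≤ A₀) (hM : 0 ≤ M) (hn : 1 ≤ n) (hp : p ≤ T * n)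
    (hC : ∀ w, w ⬝ᵥ C *ᵥ w ≤ M / n * (w ⬝ᵥ w)) {X G : Ω → Fin n → Fin p → ℝ}
    (hX : BlockDesign P C q (fun k => A₀ / √n ^ k) c X)
    (hG : BlockDesign P C q (fun k => A₀ / √n ^ k) c G) {d : ℕ}
    (hd : ∀ b, ({j | c j = b} : Finset (Fin p)).card ≤ d) (hdn : d ^ 3 ≤ n) {m : ℕ} (hm : m ≤ 4)
    (hmq : 3 + m ≤ q) (hq : 4 ≤ q) {ℓ : Fin n → ℕ → ℝ → ℝ} {Dom : Fin n → ℝ → ℝ} {D ε : ℝ}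
    (hℓ : SmoothApprox ℓ' ℓ Dom D m A ε) (hD : 1 ≤ D) {R : (Fin p → ℝ) → ℝ}
    {S : Set (Fin p → ℝ)} (hF : Measurable (minRisk ℓ' R S)) (hSne : S.Nonempty)
    (hRS : BddBelow (R '' S)) {L : ℝ} (hL : 1 ≤ L) (hS : ∀ w ∈ S, ∀ j, w j ∈ Set.Icc (-L) L)
    {δ lam : ℝ} (hδ : 0 < δ) (hlam : 1 ≤ lam) {g : ℕ → ℝ → ℝ} (hg : IsJet 3 g) {K : ℝ≥0}
    (hgK : ∀ k ≤ 3, ∀ x, |g k x| ≤ K) :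
    |∫ ω, g 0 (minRisk ℓ' R S (X ω)) ∂P - ∫ ω, g 0 (minRisk ℓ' R S (G ω)) ∂P|
      ≤ 2 * K * (ε + T * Real.log (2 * (L / δ) + 2) / lam) + comparisonConst T A₀ M m * K * Av A
        * (n * L * δ + D * lam ^ 2 * (L ^ (3 + m) * d ^ 2 / √n)) := by
  obtain ⟨W, w, b, _, hw, happrox⟩ := exists_abs_minRisk_sub_softmin_le (by omega) hℓ.loss_nonneg
    hℓ.nonneg hℓ.modulus hℓ.abs_sub_le hSne hRS hL hS hδ (by linarith : 0 < lam) c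
  have hf : Measurable fun x : Fin n × Fin k → W → ℝ =>
      softmin (n * lam) (blockRisk n (fun i => ℓ i 0) b x) :=
    measurable_softmin _ (measurable_blockRisk n hℓ.measurable b)
  have hT : 0 ≤ T := nonneg_of_mul_nonneg_left (p.cast_nonneg.trans hp) (by exact_mod_cast hn)
  have hθ : 0 < scoreBound T A₀ M := by unfold scoreBound; positivity
  have hr : 0 ≤ 3 * L * δ := by positivity
  have hgl := hg.lipschitzWith (by norm_num) fun t => hgK 1 (by norm_num) t
  have hnet := hX.abs_integral_comp_sub_le (by omega) hℓ.nonneg hF hf hr happrox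
    (hgK 0 (by norm_num)) hgl
  have hnet' := hG.abs_integral_comp_sub_le (by omega) hℓ.nonneg hF hf hr happrox
    (hgK 0 (by norm_num)) hgl
  have hswap := hX.abs_integral_softmin_sub_le hG (by positivity) hC hd hm hmq hq
    (fun k => by positivity) hθ
    (fourth_moment_le_scoreBound_pow hn hA₀ hM hp hdn) hn hlam hD hL hℓ.toSmoothLosses hg hgK b hw
  refine le_trans ?_ (comparison_error_le hn hA₀ hp hdn K.2 (Av_nonneg hℓ.nonneg)
    (by linarith) hδ.le (Real.log_nonneg (by linarith [div_nonneg (zero_le_one.trans hL) hδ.le]))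
    (by linarith) (by linarith))
  rw [abs_sub_comm] at hnet'
  refine (abs_sub_le _ _ _).trans ((add_le_add hnet ((abs_sub_le _ _ _).trans
    (add_le_add hswap hnet'))).trans_eq ?_)
  ring

end FixedNoise

section Smoothing

section MovingAverage

/-- The average of `f` over `[u, u + r]`. -/
noncomputable def movingAverage (r : ℝ) (f : ℝ → ℝ) (u : ℝ) : ℝ := ∫ t in (0 : ℝ)..1, f (u + r * t)

/-- The difference quotient of `f` with step `r`, which is the derivative of `movingAverage r f`. -/
noncomputable def diffQuotient (r : ℝ) (f : ℝ → ℝ) (u : ℝ) : ℝ := (f (u + r) - f u) / r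

variable {f : ℝ → ℝ} {K : ℝ≥0} {r : ℝ}

lemma intervalIntegrable_comp_add_mul (hf : Continuous f) (r u a b : ℝ) :
    IntervalIntegrable (fun t => f (u + r * t)) volume a b :=
  (hf.comp (by fun_prop : Continuous fun t => u + r * t)).intervalIntegrable _ _

lemma abs_movingAverage_sub_le {f' : ℝ → ℝ} (hf : Continuous f) {x y B : ℝ}
    (hf' : Continuous f') (h : ∀ t ∈ Set.Icc (0 : ℝ) 1, |f (x + r * t) - f' (y + r * t)| ≤ B) :
    |movingAverage r f x - movingAverage r f' y| ≤ B := by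
  rw [movingAverage, movingAverage, ← intervalIntegral.integral_sub
    (intervalIntegrable_comp_add_mul hf r x 0 1) (intervalIntegrable_comp_add_mul hf' r y 0 1)]
  have hnorm (t : ℝ) (ht : t ∈ Set.uIoc 0 1) : ‖f (x + r * t) - f' (y + r * t)‖ ≤ B := by
    rw [Set.uIoc_of_le zero_le_one] at ht
    exact h t (Set.Ioc_subset_Icc_self ht)
  exact (intervalIntegral.norm_integral_le_of_norm_le_const hnorm).trans_eq (by simp)

lemma lipschitzWith_movingAverage (hf : LipschitzWith K f) (r : ℝ) :
    LipschitzWith K (movingAverage r f) :=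
  .of_dist_le_mul fun x y => abs_movingAverage_sub_le hf.continuous hf.continuous fun t _ => by
    simpa [Real.dist_eq] using hf.norm_sub_le (x + r * t) (y + r * t)

lemma lipschitzWith_iterate_movingAverage (hf : LipschitzWith K f) (r : ℝ) (l : ℕ) :
    LipschitzWith K ((movingAverage r)^[l] f) :=
  Function.Iterate.rec _ hf (fun _ h => lipschitzWith_movingAverage h r) l

lemma abs_movingAverage_self_sub_le (hf : LipschitzWith K f) (hr : 0 ≤ r) (u : ℝ) :
    |movingAverage r f u - f u| ≤ K * r := by
  have hconst : movingAverage r (fun _ => f u) u = f u := by simp [movingAverage]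
  rw [← hconst]
  refine abs_movingAverage_sub_le hf.continuous continuous_const fun t ht => ?_
  refine (hf.norm_sub_le _ _).trans ?_
  rw [add_sub_cancel_left, Real.norm_of_nonneg (mul_nonneg hr ht.1)]
  gcongr
  exact mul_le_of_le_one_right hr ht.2

lemma abs_iterate_movingAverage_sub_le (hf : LipschitzWith K f) (hr : 0 ≤ r) (l : ℕ) (u : ℝ) :
    |(movingAverage r)^[l] f u - f u| ≤ l * (K * r) := by
  induction l with
  | zero => simp
  | succ l ih =>
    rw [Function.iterate_succ_apply']
    refine (abs_sub_le _ ((movingAverage r)^[l] f u) _).trans ?_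
    have := abs_movingAverage_self_sub_le (lipschitzWith_iterate_movingAverage hf r l) hr u
    push_cast
    linarith

lemma hasDerivAt_movingAverage (hr : r ≠ 0) (hf : Continuous f) (u : ℝ) :
    HasDerivAt (movingAverage r f) (diffQuotient r f u) u := by
  have hprimitive : movingAverage r f
      = fun u => r⁻¹ * ((∫ t in (0 : ℝ)..(u + r), f t) - ∫ t in (0 : ℝ)..u, f t) := by
    funext u
    rw [intervalIntegral.integral_interval_sub_left (hf.intervalIntegrable _ _)
      (hf.intervalIntegrable _ _), movingAverage, intervalIntegral.integral_comp_add_mul _ hr]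
    simp
  have h (v : ℝ) : HasDerivAt (fun u => ∫ t in (0 : ℝ)..u, f t) (f v) v :=
    hf.integral_hasStrictDerivAt 0 v |>.hasDerivAt
  rw [hprimitive]
  refine ((((h (u + r)).comp_add_const u r).sub (h u)).const_mul r⁻¹).congr_deriv ?_
  rw [diffQuotient, inv_mul_eq_div]

lemma hasDerivAt_diffQuotient {f' : ℝ → ℝ} (hf : ∀ u, HasDerivAt f (f' u) u) (u : ℝ) :
    HasDerivAt (diffQuotient r f) (diffQuotient r f' u) u :=
  (((hf (u + r)).comp_add_const u r).sub (hf u)).div_const r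

lemma hasDerivAt_iterate_diffQuotient {f' : ℝ → ℝ} (hf : ∀ u, HasDerivAt f (f' u) u) (k : ℕ) :
    ∀ u, HasDerivAt ((diffQuotient r)^[k] f) ((diffQuotient r)^[k] f' u) u := by
  induction k with
  | zero => exact hf
  | succ k ih =>
    simp only [Function.iterate_succ_apply']
    exact hasDerivAt_diffQuotient ih

lemma isJet_iterate_diffQuotient (hr : r ≠ 0) (hf : LipschitzWith K f) (N : ℕ) :
    IsJet N fun k => (diffQuotient r)^[k] ((movingAverage r)^[N - k] f) := by
  intro k hk t
  obtain ⟨l, rfl⟩ := Nat.exists_eq_add_of_lt hk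
  simp only [add_assoc, Nat.add_sub_cancel_left, Nat.add_sub_add_left, Nat.add_sub_cancel]
  rw [Function.iterate_succ_apply', Function.iterate_succ_apply]
  exact hasDerivAt_iterate_diffQuotient
    (hasDerivAt_movingAverage hr (lipschitzWith_iterate_movingAverage hf r l).continuous) k t

lemma abs_diffQuotient_le (hf : LipschitzWith K f) (hr : 0 < r) (u : ℝ) :
    |diffQuotient r f u| ≤ K := by
  rw [diffQuotient, abs_div, abs_of_pos hr, div_le_iff₀ hr]
  simpa [abs_of_pos hr] using hf.norm_sub_le (u + r) u

lemma abs_iterate_diffQuotient_le (hf : LipschitzWith K f) (hr : 0 < r) (k : ℕ) (u : ℝ) :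
    |(diffQuotient r)^[k + 1] f u| ≤ K * (2 / r) ^ k := by
  induction k generalizing u with
  | zero => simpa using abs_diffQuotient_le hf hr u
  | succ k ih =>
    rw [Function.iterate_succ_apply', diffQuotient, abs_div, abs_of_pos hr]
    calc _ ≤ (K * (2 / r) ^ k + K * (2 / r) ^ k) / r := by
          gcongr
          exact (abs_sub _ _).trans (add_le_add (ih _) (ih _))
      _ = K * (2 / r) ^ (k + 1) := by ring

end MovingAverage

/-- A nonnegative loss whose translates can be smoothed to accuracy `B * r` at the cost of
derivatives of size `B / r ^ 2`; the exponent `m` measures the growth of its derivative. -/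
structure SmoothableLoss (ell0 : ℝ → ℝ) (m : ℕ) (B : ℝ) : Prop where
  continuous : Continuous ell0
  nonneg : 0 ≤ ell0
  one_le : 1 ≤ B
  exists_smoothApprox : ∀ r, 0 < r → r ≤ 1 → ∃ (ℓ : ℝ → ℕ → ℝ → ℝ) (Dom : ℝ → ℝ → ℝ),
    SmoothApprox (fun ξ z => ell0 (z - ξ)) ℓ Dom (B / r ^ 2) m (fun ξ => B * (1 + |ξ|) ^ m) (B * r)

theorem SmoothableLoss.of_lipschitzWith {f : ℝ → ℝ} {K : ℝ≥0} (hf : LipschitzWith K f)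
    (hpos : 0 ≤ f) : SmoothableLoss f 0 (4 * (1 + K) ^ 3) where
  continuous := hf.continuous
  nonneg := hpos
  one_le := by linarith [one_le_pow₀ (n := 3) (by simp : (1 : ℝ) ≤ 1 + K)]
  exists_smoothApprox r hr hr1 := by
    have hK : (1 + K : ℝ) ≤ (1 + K) ^ 3 := le_self_pow₀ (by simp) (by norm_num)
    have hKr : K * r ≤ K := mul_le_of_le_one_right K.2 hr1
    set B : ℝ := 4 * (1 + K) ^ 3
    have hlip (l : ℕ) := lipschitzWith_iterate_movingAverage hf r l
    refine ⟨fun ξ k z => (diffQuotient r)^[k] ((movingAverage r)^[3 - k] f) (z - ξ),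
      fun _ _ => (1 + K) ^ 3, ?_⟩
    refine { isJet := ?_, abs_two_le := ?_, abs_three_le := ?_, pow_le := ?_, monovary := ?_,
             le := ?_, loss_nonneg := fun ξ z => hpos _, modulus := ?_, abs_sub_le := ?_ }
    · exact fun ξ k hk z =>
        (isJet_iterate_diffQuotient hr.ne' hf 3 k hk (z - ξ)).comp_sub_const z ξ
    · refine fun ξ z => (abs_iterate_diffQuotient_le (hlip 1) hr 1 (z - ξ)).trans ?_
      calc K * (2 / r) ^ 1 = 2 * (K * r) / r ^ 2 := by field_simp
        _ ≤ B / r ^ 2 := by gcongr; linarith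
    · refine fun ξ z => (abs_iterate_diffQuotient_le (hlip 0) hr 2 (z - ξ)).trans ?_
      calc K * (2 / r) ^ 2 = 4 * K / r ^ 2 := by ring
        _ ≤ B / r ^ 2 := by gcongr; linarith
    · intro ξ z
      gcongr
      simpa using abs_iterate_diffQuotient_le (hlip 2) hr 0 (z - ξ)
    · exact fun ξ x y _ => le_rfl
    · intro ξ z
      have : (0 : ℝ) ≤ (1 + K) ^ 3 := by positivity
      simp only [pow_zero]
      linarith
    · intro ξ z z'
      rw [pow_zero, mul_one, mul_assoc]
      calc |f (z - ξ) - f (z' - ξ)| ≤ K * |z - z'| := by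
            simpa using hf.norm_sub_le (z - ξ) (z' - ξ)
        _ ≤ B * (|z - z'| * (1 + |z| + |z'|)) := by
            gcongr
            · linarith
            · exact le_mul_of_one_le_right (abs_nonneg _) (by
                linarith [abs_nonneg z, abs_nonneg z'])
    · intro ξ z
      calc _ ≤ 3 * (K * r) := abs_iterate_movingAverage_sub_le hf hr.le 3 (z - ξ)
        _ = 3 * K * r := by ring
        _ ≤ B * r := by gcongr; linarith

lemma lipschitzWith_absoluteLoss : LipschitzWith 1 absoluteLoss :=
  lipschitzWith_one_norm

/-- Only slopes in `[-η, η]` occur, which is why the Huber loss is `η`-Lipschitz. -/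
lemma isGreatest_huberLoss {η : ℝ} (hη : 0 ≤ η) (u : ℝ) :
    IsGreatest ((fun s => s * u - s ^ 2 / 2) '' {s | |s| ≤ η}) (huberLoss η u) := by
  unfold huberLoss
  split_ifs with h
  · exact ⟨⟨u, h, by ring⟩, Set.forall_mem_image.2 fun s _ => by nlinarith [sq_nonneg (s - u)]⟩
  · push Not at h
    refine ⟨?_, Set.forall_mem_image.2 fun s (hs : |s| ≤ η) => ?_⟩
    · rcases le_total 0 u with hu | hu
      · exact ⟨η, (abs_of_nonneg hη).le, by rw [abs_of_nonneg hu]⟩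
      · exact ⟨-η, by simp [abs_of_nonneg hη], by rw [abs_of_nonpos hu]; ring⟩
    · have hsu : s * u ≤ |s| * |u| := (le_abs_self _).trans (abs_mul s u).le
      rw [← sq_abs s]
      nlinarith [mul_nonneg (sub_nonneg.2 hs) (sub_nonneg.2 h.le), sq_nonneg (η - |s|)]

lemma lipschitzWith_huberLoss (η : ℝ≥0) : LipschitzWith η (huberLoss η) := by
  refine .of_le_add_mul _ fun u v => ?_
  obtain ⟨s, hs, hsu⟩ := (isGreatest_huberLoss η.coe_nonneg u).1
  have hv := (isGreatest_huberLoss η.coe_nonneg v).2 ⟨s, hs, rfl⟩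
  have hslope : s * (u - v) ≤ η * |u - v| := (le_abs_self _).trans
    ((abs_mul _ _).le.trans (mul_le_mul_of_nonneg_right hs (abs_nonneg _)))
  simp only [Real.dist_eq] at hsu hv ⊢
  linarith

lemma huberLoss_nonneg {η : ℝ} (hη : 0 ≤ η) : 0 ≤ huberLoss η := fun u =>
  (isGreatest_huberLoss hη u).2 ⟨0, by simpa using hη, by simp⟩

lemma one_add_two_mul_abs_sub_pow_three_le (z ξ : ℝ) :
    (1 + 2 * |z - ξ|) ^ 3 ≤ 32 * (1 + |ξ|) ^ 3 * (1 + |z| ^ 3) := by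
  have hsub : |z - ξ| ≤ |z| + |ξ| := abs_sub _ _
  have hprod : 1 + 2 * |z - ξ| ≤ 2 * ((1 + |ξ|) * (1 + |z|)) := by
    nlinarith [mul_nonneg (abs_nonneg z) (abs_nonneg ξ)]
  calc (1 + 2 * |z - ξ|) ^ 3 ≤ (2 * ((1 + |ξ|) * (1 + |z|))) ^ 3 := by gcongr
    _ = 8 * (1 + |ξ|) ^ 3 * (1 + |z|) ^ 3 := by ring
    _ ≤ 8 * (1 + |ξ|) ^ 3 * (2 ^ 2 * (1 ^ 3 + |z| ^ 3)) := by
        gcongr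
        exact add_pow_le zero_le_one (abs_nonneg z) 3
    _ = 32 * (1 + |ξ|) ^ 3 * (1 + |z| ^ 3) := by ring

lemma abs_squaredLoss_sub_sub_le (z z' ξ : ℝ) :
    |squaredLoss (z - ξ) - squaredLoss (z' - ξ)|
      ≤ 32 * (1 + |ξ|) ^ 3 * |z - z'| * (1 + |z| + |z'|) := by
  have hfactor : squaredLoss (z - ξ) - squaredLoss (z' - ξ) = (z - z') * (z + z' - 2 * ξ) := by
    unfold squaredLoss; ring
  have hsub : |z + z' - 2 * ξ| ≤ |z| + |z'| + 2 * |ξ| := by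
    refine (abs_sub _ _).trans (add_le_add (abs_add_le _ _) ?_)
    rw [abs_mul, abs_two]
  have hprod : |z| + |z'| + 2 * |ξ| ≤ 32 * ((1 + |ξ|) * (1 + |z| + |z'|)) := by
    nlinarith [mul_nonneg (add_nonneg (abs_nonneg z) (abs_nonneg z')) (abs_nonneg ξ),
      abs_nonneg ξ, abs_nonneg z, abs_nonneg z']
  rw [hfactor, abs_mul]
  calc |z - z'| * |z + z' - 2 * ξ|
      ≤ |z - z'| * (32 * ((1 + |ξ|) ^ 3 * (1 + |z| + |z'|))) := by
        refine mul_le_mul_of_nonneg_left (hsub.trans (hprod.trans ?_)) (abs_nonneg _)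
        gcongr
        exact le_self_pow₀ (by simp) (by norm_num)
    _ = 32 * (1 + |ξ|) ^ 3 * |z - z'| * (1 + |z| + |z'|) := by ring

lemma smoothableLoss_squaredLoss : SmoothableLoss squaredLoss 3 32 where
  continuous := by unfold squaredLoss; fun_prop
  nonneg u := sq_nonneg u
  one_le := by norm_num
  exists_smoothApprox r hr hr1 := by
    have hr2 : (2 : ℝ) ≤ 32 / r ^ 2 := by
      rw [le_div_iff₀ (by positivity)]
      linarith [pow_le_one₀ hr.le hr1 (n := 2)]
    refine ⟨fun ξ k z => match k with
      | 0 => (z - ξ) ^ 2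
      | 1 => 2 * (z - ξ)
      | 2 => 2
      | _ => 0, fun ξ z => (1 + 2 * |z - ξ|) ^ 3, ?_⟩
    refine { isJet := ?_, abs_two_le := fun ξ z => by simpa using hr2,
             abs_three_le := fun ξ z => by simpa using zero_le_two.trans hr2,
             pow_le := fun ξ z => by simp [abs_mul], monovary := ?_,
             le := fun ξ z => one_add_two_mul_abs_sub_pow_three_le z ξ,
             loss_nonneg := fun ξ z => sq_nonneg _,
             modulus := fun ξ z z' => abs_squaredLoss_sub_sub_le z z' ξ,
             abs_sub_le := fun ξ z => by simp [squaredLoss, hr.le] }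
    · intro ξ k hk z
      have hid : HasDerivAt (fun z => z - ξ) 1 z := (hasDerivAt_id z).sub_const _
      interval_cases k
      · exact (hid.fun_pow 2).congr_deriv (by simp)
      · simpa using hid.const_mul 2
      · exact hasDerivAt_const z 2
    · intro ξ z z' h
      have := (sq_lt_sq.1 h).le
      dsimp only
      gcongr

lemma IsExampleLoss.exists_smoothableLoss {ell0 : ℝ → ℝ} (h : IsExampleLoss ell0) :
    ∃ m B, SmoothableLoss ell0 m B ∧ (m = 0 ∨ m = 3 ∧ ell0 = squaredLoss) := by
  rcases h with rfl | rfl | ⟨η, hη, rfl⟩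
  · exact ⟨_, _, smoothableLoss_squaredLoss, .inr ⟨rfl, rfl⟩⟩
  · exact ⟨_, _, .of_lipschitzWith lipschitzWith_absoluteLoss fun u => abs_nonneg u, .inl rfl⟩
  · lift η to ℝ≥0 using hη.le
    exact ⟨_, _, .of_lipschitzWith (lipschitzWith_huberLoss η) (huberLoss_nonneg η.2), .inl rfl⟩

end Smoothing

section SquaredLoss

lemma not_forall_rpow_le {a C : ℝ} (ha : 0 < a) : ¬ ∀ U : ℝ, 1 ≤ U → U ^ a ≤ C := by
  intro h
  obtain ⟨U, hU, hUC⟩ := (((tendsto_rpow_atTop ha).eventually_gt_atTop C).and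
    (eventually_ge_atTop 1)).exists
  exact (h U hUC).not_gt hU

lemma sq_le_of_abs_deriv_le_rpow {f : ℝ → ℝ} {D a U : ℝ} (hpos : 0 ≤ f) (hf : Differentiable ℝ f)
    (hsq : ∀ x, |f x - x ^ 2| ≤ 1) (hD : 0 ≤ D) (ha : 0 ≤ a)
    (hderiv : ∀ x, |deriv f x| ≤ D * (1 + f x ^ a)) (hU : 0 ≤ U) :
    U ^ 2 ≤ 2 + D * (1 + (U ^ 2 + 1) ^ a) * U := by
  have hbound (x : ℝ) (hx : x ∈ Set.Icc 0 U) :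
      ‖deriv f x‖ ≤ D * (1 + (U ^ 2 + 1) ^ a) := by
    refine (hderiv x).trans ?_
    have hfU : f x ≤ U ^ 2 + 1 := by
      linarith [(abs_le.1 (hsq x)).2, pow_le_pow_left₀ hx.1 hx.2 2]
    have := hpos x
    gcongr
  have hmean := (convex_Icc 0 U).norm_image_sub_le_of_norm_deriv_le (fun x _ => hf x) hbound
    (Set.left_mem_Icc.2 hU) (Set.right_mem_Icc.2 hU)
  rw [Real.norm_eq_abs, sub_zero, Real.norm_of_nonneg hU] at hmean
  linarith [(abs_le.1 hmean).2, (abs_le.1 (hsq U)).1, (abs_le.1 (hsq 0)).2]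

/-- A nonnegative function within `1` of the parabola has slope of order `√f`, so a bound on the
slope by a power of `f` needs the exponent to be at least `1 / 2`. -/
lemma half_le_of_abs_deriv_le_rpow {f : ℝ → ℝ} {D a : ℝ} (hpos : 0 ≤ f)
    (hf : Differentiable ℝ f) (hsq : ∀ x, |f x - x ^ 2| ≤ 1) (hD : 0 ≤ D) (ha : 0 ≤ a)
    (hderiv : ∀ x, |deriv f x| ≤ D * (1 + f x ^ a)) : 1 / 2 ≤ a := by
  by_contra! hlt
  refine not_forall_rpow_le (a := 1 - 2 * a) (C := 2 + 3 * D) (by linarith) fun U hU => ?_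
  have hU0 : 0 < U := by linarith
  have hUa : 1 ≤ U ^ (2 * a) := Real.one_le_rpow hU (by linarith)
  have hrpow : (U ^ 2 + 1) ^ a ≤ 2 * U ^ (2 * a) := by
    calc (U ^ 2 + 1) ^ a ≤ (2 * U ^ 2) ^ a := by gcongr; nlinarith
      _ = 2 ^ a * U ^ (2 * a) := by
        rw [Real.mul_rpow (by norm_num) (by positivity), Real.rpow_mul hU0.le, Real.rpow_two]
      _ ≤ 2 * U ^ (2 * a) := by
        gcongr
        exact Real.rpow_le_self_of_one_le one_le_two (by linarith)
  rw [Real.rpow_sub hU0, div_le_iff₀ (by positivity), Real.rpow_one]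
  refine le_of_mul_le_mul_right ?_ hU0
  calc U * U ≤ 2 + D * (1 + (U ^ 2 + 1) ^ a) * U := by
        rw [← sq]
        exact sq_le_of_abs_deriv_le_rpow hpos hf hsq hD ha hderiv hU0.le
    _ ≤ 2 * (U ^ (2 * a) * U) + D * (U ^ (2 * a) + 2 * U ^ (2 * a)) * U := by
        gcongr
        exact le_mul_of_one_le_right zero_le_two (one_le_mul_of_one_le_of_one_le hUa hU)
    _ = (2 + 3 * D) * U ^ (2 * a) * U := by ring

lemma qBar_add_four_le_qStar (q : Fin 4 → ℝ) : qBar q + 4 ≤ qStar q := by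
  obtain ⟨k, hk⟩ : ∃ k, qBar q = 2 * k := ⟨_, rfl⟩
  rw [qStar, hk, show (2 * k + 4) / 2 = k + 1 + 1 by omega, pow_succ]
  have := (k + 1).lt_two_pow_self
  omega

namespace LossAssumption

variable {n : ℕ} {ξ : Fin n → ℝ} {q : Fin 4 → ℝ} {Lc : Fin n → ℝ} {ρbar : ℝ}
  {Dℓ Mℓ : Set.Ioo (0 : ℝ) ρbar → ℝ}

lemma qBold_nonneg {ι : Type*} {ℓ : ι → ℝ → ℝ} {Lc : ι → ℝ}
    (h : LossAssumption ℓ q Lc ρbar Dℓ Mℓ) : 0 ≤ qBold q :=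
  le_max_of_le_left (mul_nonneg (by norm_num) (h.q_nonneg 1))

lemma sq_sub_le_of_squaredLoss
    (h : LossAssumption (noisyLoss squaredLoss ξ) q Lc ρbar Dℓ Mℓ) (i : Fin n) (x : ℝ) :
    (x - ξ i) ^ 2 ≤ Lc i * (1 + |x| ^ q 0) := by
  have hgrowth := h.growth i x
  rw [div_le_iff₀ (by positivity)] at hgrowth
  simpa [noisyLoss, squaredLoss] using hgrowth

lemma two_le_q_zero
    (h : LossAssumption (noisyLoss squaredLoss ξ) q Lc ρbar Dℓ Mℓ) (i : Fin n) : 2 ≤ q 0 := by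
  by_contra! hlt
  refine not_forall_rpow_le (a := 2 - q 0) (C := 4 * Lc i + 2 * ξ i ^ 2) (by linarith)
    fun U hU => ?_
  have hU0 : 0 < U := by linarith
  have hUq : 1 ≤ U ^ q 0 := Real.one_le_rpow hU (h.q_nonneg 0)
  have hgrowth := h.sq_sub_le_of_squaredLoss i U
  rw [abs_of_pos hU0] at hgrowth
  rw [Real.rpow_sub hU0, div_le_iff₀ (by positivity), Real.rpow_two]
  calc U ^ 2 ≤ 2 * (U - ξ i) ^ 2 + 2 * ξ i ^ 2 := by linarith [sq_nonneg (U - 2 * ξ i)]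
    _ ≤ 2 * (Lc i * (U ^ q 0 + U ^ q 0)) + 2 * ξ i ^ 2 * U ^ q 0 := by
        have := h.one_le_Lc i
        refine add_le_add ?_ (le_mul_of_one_le_right (by positivity) hUq)
        refine mul_le_mul_of_nonneg_left (hgrowth.trans ?_) zero_le_two
        gcongr
    _ = (4 * Lc i + 2 * ξ i ^ 2) * U ^ q 0 := by ring

lemma half_le_q_one
    (h : LossAssumption (noisyLoss squaredLoss ξ) q Lc ρbar Dℓ Mℓ) (i : Fin n) : 1 / 2 ≤ q 1 := by
  obtain ⟨ℓs, hℓs⟩ := h.approx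
  let ρ : Set.Ioo (0 : ℝ) ρbar := ⟨ρbar / 2, half_pos h.ρbar_pos, half_lt_self h.ρbar_pos⟩
  obtain ⟨hpos, hsmooth, happrox, hderiv⟩ := hℓs ρ i
  refine half_le_of_abs_deriv_le_rpow (f := fun x => ℓs ρ i (x + ξ i)) (fun x => hpos _)
    ((hsmooth.differentiable (by norm_num)).comp (by fun_prop)) (fun x => ?_)
    (zero_le_one.trans (h.one_le_D ρ)) (h.q_nonneg 1) fun x => ?_
  · simpa [noisyLoss, squaredLoss] using (happrox (x + ξ i)).trans (h.M_le_one ρ)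
  · have hderiv := hderiv 1 (by decide) (x + ξ i)
    rw [div_le_iff₀ (by positivity), abs_of_nonneg (hpos _)] at hderiv
    simpa [iteratedDeriv_one, deriv_comp_add_const] using hderiv

lemma three_halves_le_qBold
    (h : LossAssumption (noisyLoss squaredLoss ξ) q Lc ρbar Dℓ Mℓ) (i : Fin n) : 3 / 2 ≤ qBold q :=
  le_max_of_le_left (by linarith [h.half_le_q_one i])

lemma four_le_qBar
    (h : LossAssumption (noisyLoss squaredLoss ξ) q Lc ρbar Dℓ Mℓ) (i : Fin n) : 4 ≤ qBar q := by
  have hprod : 3 ≤ q 0 * qBold q := by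
    nlinarith [h.two_le_q_zero i, h.three_halves_le_qBold i]
  have hceil : 1 < ⌈q 0 * qBold q / 2⌉₊ := by
    rw [Nat.lt_ceil]; push_cast; linarith
  unfold qBar
  omega

lemma one_add_abs_pow_three_le
    (h : LossAssumption (noisyLoss squaredLoss ξ) q Lc ρbar Dℓ Mℓ) (i : Fin n) :
    (1 + |ξ i|) ^ 3 ≤ 8 * Lc i ^ qBold q := by
  have hL := h.one_le_Lc i
  have hξ : |ξ i| ≤ √(Lc i) := by
    have hgrowth := h.sq_sub_le_of_squaredLoss i 0
    rw [abs_zero, Real.zero_rpow (by linarith [h.two_le_q_zero i])] at hgrowth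
    exact Real.abs_le_sqrt (by simpa using hgrowth)
  calc (1 + |ξ i|) ^ 3 ≤ (√(Lc i) + √(Lc i)) ^ 3 := by
        gcongr
        exact Real.one_le_sqrt.2 hL
    _ = 8 * √(Lc i) ^ 3 := by ring
    _ = 8 * Lc i ^ (3 / 2 : ℝ) := by
        rw [Real.sqrt_eq_rpow, ← Real.rpow_mul_natCast (by linarith)]
        norm_num
    _ ≤ 8 * Lc i ^ qBold q := by
        gcongr
        exact h.three_halves_le_qBold i

end LossAssumption

end SquaredLoss

section RandomNoise

variable {Ω E F : Type*} [MeasurableSpace Ω] [MeasurableSpace E] [MeasurableSpace F]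
  {P : Measure Ω} [IsProbabilityMeasure P] {X : Ω → E} {ξ : Ω → F} {f : E × F → ℝ} {K : ℝ}

lemma integral_comp_prodMk_of_indepFun (hX : Measurable X) (hξ : Measurable ξ) (h : IndepFun X ξ P)
    (hf : Measurable f) (hK : ∀ z, |f z| ≤ K) :
    Integrable (fun y => ∫ ω, f (X ω, y) ∂P) (P.map ξ) ∧
      ∫ ω, f (X ω, ξ ω) ∂P = ∫ y, ∫ ω, f (X ω, y) ∂P ∂(P.map ξ) := by
  have := Measure.isProbabilityMeasure_map (μ := P) hX.aemeasurable
  have := Measure.isProbabilityMeasure_map (μ := P) hξ.aemeasurable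
  have hint : Integrable f ((P.map X).prod (P.map ξ)) :=
    integrable_of_measurable_of_abs_le hf hK
  have hmap (y : F) : ∫ x, f (x, y) ∂(P.map X) = ∫ ω, f (X ω, y) ∂P :=
    integral_map hX.aemeasurable (hf.comp measurable_prodMk_right).aestronglyMeasurable
  simp only [← hmap]
  refine ⟨hint.integral_prod_right, ?_⟩
  rw [← integral_prod_symm _ hint,
    ← (indepFun_iff_map_prod_eq_prod_map_map hX.aemeasurable hξ.aemeasurable).1 h,
    integral_map (hX.prodMk hξ).aemeasurable hf.aestronglyMeasurable]

/-- Condition on `ξ`, and use the trivial bound `2 * K` on the exceptional event. -/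
lemma abs_integral_comp_prodMk_sub_le {G : Ω → E} (hX : Measurable X) (hG : Measurable G)
    (hξ : Measurable ξ) (hXξ : IndepFun X ξ P) (hGξ : IndepFun G ξ P) (hf : Measurable f)
    (hK : ∀ z, |f z| ≤ K) {s : Set F} (hs : MeasurableSet s) {e : ℝ} (he : 0 ≤ e)
    (h : ∀ y ∉ s, |∫ ω, f (X ω, y) ∂P - ∫ ω, f (G ω, y) ∂P| ≤ e) :
    |∫ ω, f (X ω, ξ ω) ∂P - ∫ ω, f (G ω, ξ ω) ∂P| ≤ e + 2 * K * P.real (ξ ⁻¹' s) := by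
  have := Measure.isProbabilityMeasure_map (μ := P) hξ.aemeasurable
  obtain ⟨hXint, hXeq⟩ := integral_comp_prodMk_of_indepFun hX hξ hXξ hf hK
  obtain ⟨hGint, hGeq⟩ := integral_comp_prodMk_of_indepFun hG hξ hGξ hf hK
  have hbound (Y : Ω → E) (y : F) : |∫ ω, f (Y ω, y) ∂P| ≤ K := by
    simpa using (abs_integral_le_integral_abs (μ := P)).trans
      (integral_mono_of_nonneg (.of_forall fun _ => abs_nonneg _) (integrable_const K)
        (.of_forall fun ω => hK (Y ω, y)))
  have hind : Integrable (s.indicator fun _ => 2 * K) (P.map ξ) :=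
    (integrable_const _).indicator hs
  rw [hXeq, hGeq, ← integral_sub hXint hGint, ← Real.norm_eq_abs]
  calc _ ≤ ∫ y, e + s.indicator (fun _ => 2 * K) y ∂(P.map ξ) := by
        refine norm_integral_le_of_norm_le ((integrable_const e).add hind) (.of_forall fun y => ?_)
        rw [Real.norm_eq_abs]
        by_cases hy : y ∈ s
        · rw [Set.indicator_of_mem hy, two_mul]
          exact ((abs_sub _ _).trans (add_le_add (hbound X y) (hbound G y))).trans
            (le_add_of_nonneg_left he)
        · rw [Set.indicator_of_notMem hy, add_zero]
          exact h y hy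
    _ = e + 2 * K * P.real (ξ ⁻¹' s) := by
        rw [integral_add (integrable_const e) hind, integral_indicator_const _ hs,
          map_measureReal_apply hξ hs]
        simp [mul_comm]

end RandomNoise

section NoisyComparison

open scoped Matrix

lemma SmoothApprox.comp {I J : Type*} {ℓ' : I → ℝ → ℝ} {ℓ : I → ℕ → ℝ → ℝ} {Dom : I → ℝ → ℝ}
    {D : ℝ} {m : ℕ} {A : I → ℝ} {ε : ℝ} (h : SmoothApprox ℓ' ℓ Dom D m A ε) (σ : J → I) :
    SmoothApprox (fun j => ℓ' (σ j)) (fun j => ℓ (σ j)) (fun j => Dom (σ j)) D m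
      (fun j => A (σ j)) ε where
  isJet j := h.isJet (σ j)
  abs_two_le j := h.abs_two_le (σ j)
  abs_three_le j := h.abs_three_le (σ j)
  pow_le j := h.pow_le (σ j)
  monovary j := h.monovary (σ j)
  le j := h.le (σ j)
  loss_nonneg j := h.loss_nonneg (σ j)
  modulus j := h.modulus (σ j)
  abs_sub_le j := h.abs_sub_le (σ j)

lemma comparisonConst_nonneg {T A₀ : ℝ} (hT : 0 ≤ T) (hA₀ : 0 ≤ A₀) (M : ℝ) (m : ℕ) :
    0 ≤ comparisonConst T A₀ M m := by
  unfold comparisonConst scoreBound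
  positivity

variable {Ω : Type*} [MeasurableSpace Ω] {P : Measure Ω} [IsProbabilityMeasure P] {n p k : ℕ}

theorem abs_integral_minRisk_noisyLoss_sub_le {ell0 : ℝ → ℝ} {m : ℕ} {B : ℝ}
    (hell : SmoothableLoss ell0 m B) (hm : m ≤ 4) {C : Matrix (Fin p) (Fin p) ℝ} {q : ℕ}
    {c : Fin p → Fin k} {A₀ M T : ℝ} (hA₀ : 0 ≤ A₀) (hM : 0 ≤ M) (hn : 1 ≤ n) (hp : p ≤ T * n)
    (hC : ∀ w, w ⬝ᵥ C *ᵥ w ≤ M / n * (w ⬝ᵥ w)) {X G : Ω → Fin n → Fin p → ℝ} {ξ : Ω → Fin n → ℝ}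
    (hX : BlockDesign P C q (fun k => A₀ / √n ^ k) c X)
    (hG : BlockDesign P C q (fun k => A₀ / √n ^ k) c G) (hξ : Measurable ξ)
    (hXξ : IndepFun X ξ P) (hGξ : IndepFun G ξ P) {d : ℕ}
    (hd : ∀ b, ({j | c j = b} : Finset (Fin p)).card ≤ d) (hdn : d ^ 3 ≤ n)
    (hmq : 3 + m ≤ q) (hq : 4 ≤ q) {R : (Fin p → ℝ) → ℝ}
    {S : Set (Fin p → ℝ)} (hSne : S.Nonempty)
    (hRS : BddBelow (R '' S)) {L : ℝ} (hL : 1 ≤ L) (hS : ∀ w ∈ S, ∀ j, w j ∈ Set.Icc (-L) L)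
    {r δ lam : ℝ} (hr : 0 < r) (hr1 : r ≤ 1) (hδ : 0 < δ) (hlam : 1 ≤ lam) {a : ℝ} (ha : 0 ≤ a)
    {g : ℕ → ℝ → ℝ} (hg : IsJet 3 g) {K : ℝ≥0} (hgK : ∀ k ≤ 3, ∀ x, |g k x| ≤ K) :
    |∫ ω, g 0 (minRisk (noisyLoss ell0 (ξ ω)) R S (X ω)) ∂P
        - ∫ ω, g 0 (minRisk (noisyLoss ell0 (ξ ω)) R S (G ω)) ∂P|
      ≤ 2 * K * (B * r + T * Real.log (2 * (L / δ) + 2) / lam)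
        + comparisonConst T A₀ M m * K * (a * B)
          * (n * L * δ + B / r ^ 2 * lam ^ 2 * (L ^ (3 + m) * d ^ 2 / √n))
        + 2 * K * P.real {ω | a < Av fun i => (1 + |ξ ω i|) ^ m} := by
  have hT : 0 ≤ T := nonneg_of_mul_nonneg_left (p.cast_nonneg.trans hp) (by exact_mod_cast hn)
  have hconst := comparisonConst_nonneg hT hA₀ M m
  have hB := hell.one_le
  have hlog : 0 ≤ Real.log (2 * (L / δ) + 2) :=
    Real.log_nonneg (by linarith [div_nonneg (zero_le_one.trans hL) hδ.le])
  obtain ⟨ℓ, Dom, hℓ⟩ := hell.exists_smoothApprox r hr hr1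
  have hF := measurable_minRisk hell.continuous hell.nonneg hSne hRS (n := n)
  have hg0 := (hg.lipschitzWith (by norm_num) fun t => hgK 1 (by norm_num) t).continuous.measurable
  refine abs_integral_comp_prodMk_sub_le hX.measurable hG.measurable hξ hXξ hGξ (hg0.comp hF)
    (fun z => hgK 0 (by norm_num) _) (s := {y | a < Av fun i => (1 + |y i|) ^ m}) ?_
    (by positivity) fun y hy => ?_
  · exact measurableSet_lt measurable_const (by unfold Av; fun_prop)
  · have hAv : Av (fun i => B * (1 + |y i|) ^ m) ≤ a * B := by
      simp only [mul_comm B, Av_mul_const]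
      exact mul_le_mul_of_nonneg_right (not_lt.1 hy) (zero_le_one.trans hB)
    have hD : 1 ≤ B / r ^ 2 :=
      hB.trans (le_div_self (zero_le_one.trans hB) (by positivity) (pow_le_one₀ hr.le hr1))
    have hFy : Measurable (minRisk (noisyLoss ell0 y) R S) :=
      (hF.comp (measurable_prodMk_right (y := y)) :)
    have hℓy : SmoothApprox (noisyLoss ell0 y) (fun i => ℓ (y i)) (fun i => Dom (y i)) (B / r ^ 2) m
        (fun i => B * (1 + |y i|) ^ m) (B * r) := hℓ.comp y
    refine (abs_integral_minRisk_sub_le hA₀ hM hn hp hC hX hG hd hdn hm hmq hq hℓy hD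
      hFy hSne hRS hL hS hδ hlam hg hgK).trans ?_
    gcongr

end NoisyComparison

section Growth

lemma tendsto_log_natCast : Tendsto (fun n : ℕ => Real.log n) atTop atTop :=
  Real.tendsto_log_atTop.comp tendsto_natCast_atTop_atTop

lemma rpow_balance {Q α κ N ℓ : ℝ} {k : ℕ} (hN : 1 ≤ N) (hℓ : 1 ≤ ℓ) (hα : 0 ≤ α) (hκ : 0 ≤ κ)
    (hk : k ≤ Q + 3) :
    ℓ ^ 6 * (N ^ α * ℓ ^ κ) ^ k * (N ^ (1 / 4 - (Q + 3) * α / 2) / ℓ ^ (6 + (2 * Q + 6) * κ)) ^ 2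
      ≤ √N := by
  have hN0 : 0 < N := by linarith
  have hℓ0 : 0 < ℓ := by linarith
  have hpow : (N ^ α) ^ k * (N ^ (1 / 4 - (Q + 3) * α / 2)) ^ 2 ≤ √N := by
    rw [← Real.rpow_mul_natCast hN0.le, ← Real.rpow_mul_natCast hN0.le, ← Real.rpow_add hN0,
      Real.sqrt_eq_rpow]
    refine Real.rpow_le_rpow_of_exponent_le hN ?_
    push_cast
    linear_combination mul_le_mul_of_nonneg_left hk hα
  have hlog : ℓ ^ 6 * (ℓ ^ κ) ^ k ≤ (ℓ ^ (6 + (2 * Q + 6) * κ)) ^ 2 := by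
    rw [← Real.rpow_mul_natCast hℓ0.le, ← Real.rpow_mul_natCast hℓ0.le, ← Real.rpow_natCast ℓ 6,
      ← Real.rpow_add hℓ0]
    refine Real.rpow_le_rpow_of_exponent_le hℓ ?_
    push_cast
    linear_combination mul_le_mul_of_nonneg_left hk hκ
      + 3 * mul_nonneg (k.cast_nonneg.trans hk) hκ
  calc _ = (N ^ α) ^ k * (N ^ (1 / 4 - (Q + 3) * α / 2)) ^ 2
        * (ℓ ^ 6 * (ℓ ^ κ) ^ k / (ℓ ^ (6 + (2 * Q + 6) * κ)) ^ 2) := by ring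
    _ ≤ √N * 1 := by
        gcongr
        exact div_le_one_of_le₀ hlog (by positivity)
    _ = √N := mul_one _

variable {Q α κ : ℝ} {L : ℕ → ℝ} {d : ℕ → ℕ}

lemma isLittleO_natCast_of_isBigO (hα : α < 1)
    (hL : L =O[atTop] fun n : ℕ => (n : ℝ) ^ α * Real.log n ^ κ) :
    L =o[atTop] fun n : ℕ => (n : ℝ) := by
  have hlog := (isLittleO_log_rpow_rpow_atTop κ (sub_pos.2 hα)).comp_tendsto
    (tendsto_natCast_atTop_atTop (R := ℝ))
  refine hL.trans_isLittleO (((isBigO_refl (fun n : ℕ => (n : ℝ) ^ α) atTop).mul_isLittleO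
    hlog).congr' .rfl ?_)
  filter_upwards [eventually_ge_atTop 1] with n hn
  have hn0 : (0 : ℝ) < n := by exact_mod_cast hn
  simp only [Function.comp_apply]
  rw [← Real.rpow_add hn0, add_sub_cancel, Real.rpow_one]

lemma tendsto_log_pow_mul_div_sqrt (hα : 0 ≤ α) (hκ : 0 ≤ κ)
    (hL : L =O[atTop] fun n : ℕ => (n : ℝ) ^ α * Real.log n ^ κ)
    (hd : (fun n : ℕ => (d n : ℝ)) =o[atTop] fun n : ℕ =>
      (n : ℝ) ^ (1 / 4 - (Q + 3) * α / 2) / Real.log n ^ (6 + (2 * Q + 6) * κ))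
    {k : ℕ} (hk : k ≤ Q + 3) :
    Tendsto (fun n : ℕ => Real.log n ^ 6 * L n ^ k * d n ^ 2 / √n) atTop (𝓝 0) := by
  have hprod := ((isBigO_refl (fun n : ℕ => Real.log n ^ 6) atTop).mul (hL.pow k)).mul_isLittleO
    (hd.pow zero_lt_two)
  refine (hprod.trans_isBigO (.of_bound 1 ?_)).tendsto_div_nhds_zero
  filter_upwards [eventually_ge_atTop 1, tendsto_log_natCast.eventually_ge_atTop 1] with n hn hlog
  rw [Real.norm_of_nonneg (by positivity), Real.norm_of_nonneg (by positivity), one_mul]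
  exact rpow_balance (by exact_mod_cast hn) hlog hα hκ hk

lemma eventually_pow_three_le (hQ : 0 ≤ Q) (hα : 0 ≤ α) (hκ : 0 ≤ κ)
    (hd : (fun n : ℕ => (d n : ℝ)) =o[atTop] fun n : ℕ =>
      (n : ℝ) ^ (1 / 4 - (Q + 3) * α / 2) / Real.log n ^ (6 + (2 * Q + 6) * κ)) :
    ∀ᶠ n in atTop, d n ^ 3 ≤ n := by
  filter_upwards [hd.bound zero_lt_one, eventually_ge_atTop 1,
    tendsto_log_natCast.eventually_ge_atTop 1] with n h hn hlog
  have hn' : (1 : ℝ) ≤ n := by exact_mod_cast hn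
  rw [one_mul, Real.norm_of_nonneg (Nat.cast_nonneg _), Real.norm_of_nonneg (by positivity)] at h
  have hdn : (d n : ℝ) ≤ (n : ℝ) ^ (1 / 3 : ℝ) :=
    calc (d n : ℝ) ≤ (n : ℝ) ^ (1 / 4 - (Q + 3) * α / 2) :=
          h.trans (div_le_self (by positivity) (Real.one_le_rpow hlog (by positivity)))
      _ ≤ (n : ℝ) ^ (1 / 3 : ℝ) := Real.rpow_le_rpow_of_exponent_le hn'
          (by linarith [mul_nonneg (add_nonneg hQ zero_le_three) hα])
  have hpow : (d n : ℝ) ^ 3 ≤ n := by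
    refine (pow_le_pow_left₀ (Nat.cast_nonneg _) hdn 3).trans_eq ?_
    rw [← Real.rpow_mul_natCast n.cast_nonneg]
    norm_num
  exact_mod_cast hpow

lemma tendsto_log_div_log_sq (hL1 : ∀ n, 1 ≤ L n) (hL : L =o[atTop] fun n : ℕ => (n : ℝ)) :
    Tendsto (fun n : ℕ => Real.log (2 * (L n / ((n : ℝ) ^ 3)⁻¹) + 2) / Real.log n ^ 2) atTop
      (𝓝 0) := by
  have hup : Tendsto (fun n : ℕ => 5 * (Real.log n)⁻¹) atTop (𝓝 0) := by
    simpa using (tendsto_inv_atTop_zero.comp tendsto_log_natCast).const_mul 5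
  have harg (n : ℕ) : 0 ≤ 2 * (L n / ((n : ℝ) ^ 3)⁻¹) := by
    have := zero_le_one.trans (hL1 n)
    positivity
  refine squeeze_zero' (.of_forall fun n =>
    div_nonneg (Real.log_nonneg (by linarith [harg n])) (sq_nonneg _)) ?_ hup
  filter_upwards [eventually_ge_atTop 4, hL.bound zero_lt_one,
    tendsto_log_natCast.eventually_ge_atTop 1] with n hn hLn hlog
  have hn' : (4 : ℝ) ≤ n := by exact_mod_cast hn
  rw [one_mul, Real.norm_of_nonneg (zero_le_one.trans (hL1 n)), Real.norm_natCast] at hLn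
  have hpow : 2 * (L n / ((n : ℝ) ^ 3)⁻¹) + 2 ≤ (n : ℝ) ^ 5 := by
    rw [div_inv_eq_mul]
    calc 2 * (L n * (n : ℝ) ^ 3) + 2 ≤ 2 * (n * (n : ℝ) ^ 3) + 2 * (n : ℝ) ^ 4 := by
          gcongr
          linarith [one_le_pow₀ (n := 4) (by linarith : (1 : ℝ) ≤ n)]
      _ = 4 * (n : ℝ) ^ 4 := by ring
      _ ≤ n * (n : ℝ) ^ 4 := by gcongr
      _ = (n : ℝ) ^ 5 := by ring
  have hle : Real.log (2 * (L n / ((n : ℝ) ^ 3)⁻¹) + 2) ≤ 5 * Real.log n :=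
    (Real.log_le_log (by linarith [harg n]) hpow).trans_eq (by simp)
  calc _ ≤ 5 * Real.log n / Real.log n ^ 2 := by gcongr
    _ = 5 * (Real.log n)⁻¹ := by field_simp

lemma tendsto_mul_mul_inv_pow_three (hL1 : ∀ n, 1 ≤ L n) (hL : L =o[atTop] fun n : ℕ => (n : ℝ)) :
    Tendsto (fun n : ℕ => n * L n * ((n : ℝ) ^ 3)⁻¹) atTop (𝓝 0) := by
  refine squeeze_zero' (.of_forall fun n => ?_) ?_ hL.tendsto_div_nhds_zero
  · have := zero_le_one.trans (hL1 n)
    positivity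
  · filter_upwards [eventually_ge_atTop 1] with n hn
    have hn' : (1 : ℝ) ≤ n := by exact_mod_cast hn
    have := zero_le_one.trans (hL1 n)
    calc n * L n * ((n : ℝ) ^ 3)⁻¹ = L n / n * (n : ℝ)⁻¹ := by field_simp
      _ ≤ L n / n := mul_le_of_le_one_right (by positivity) (inv_le_one_of_one_le₀ hn')

/-- The error of `abs_integral_minRisk_noisyLoss_sub_le` for the window `r = 1 / log n`, the mesh
`δ = n⁻³` and the inverse temperature `n * lam` with `lam = (log n) ^ 2`. -/
lemma tendsto_comparison_error (hα : 0 ≤ α) (hα1 : α < 1) (hκ : 0 ≤ κ) (hL1 : ∀ n, 1 ≤ L n)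
    (hL : L =O[atTop] fun n : ℕ => (n : ℝ) ^ α * Real.log n ^ κ)
    (hd : (fun n : ℕ => (d n : ℝ)) =o[atTop] fun n : ℕ =>
      (n : ℝ) ^ (1 / 4 - (Q + 3) * α / 2) / Real.log n ^ (6 + (2 * Q + 6) * κ))
    {m : ℕ} (hm : m ≤ Q) (B T b b' : ℝ) :
    Tendsto (fun n : ℕ => b * (B * (Real.log n)⁻¹
        + T * Real.log (2 * (L n / ((n : ℝ) ^ 3)⁻¹) + 2) / Real.log n ^ 2)
      + b' * (n * L n * ((n : ℝ) ^ 3)⁻¹ + B / (Real.log n)⁻¹ ^ 2 * (Real.log n ^ 2) ^ 2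
        * (L n ^ (3 + m) * d n ^ 2 / √n))) atTop (𝓝 0) := by
  have hLn := isLittleO_natCast_of_isBigO hα1 hL
  have hsmooth := (tendsto_inv_atTop_zero.comp tendsto_log_natCast).const_mul B
  have hnet := (tendsto_log_div_log_sq hL1 hLn).const_mul T
  have hswap := (tendsto_log_pow_mul_div_sqrt hα hκ hL hd (k := 3 + m)
    (by push_cast; linarith)).const_mul B
  have hsum := ((hsmooth.add hnet).const_mul b).add
    (((tendsto_mul_mul_inv_pow_three hL1 hLn).add hswap).const_mul b')
  simp only [mul_zero, add_zero] at hsum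
  refine hsum.congr fun n => ?_
  simp only [Function.comp_apply, inv_pow, div_inv_eq_mul]
  ring

end Growth

section Limit

open scoped Matrix

theorem tendsto_abs_integral_minRisk_noisyLoss_sub {Ω : ℕ → Type*} [∀ n, MeasurableSpace (Ω n)]
    {P : ∀ n, Measure (Ω n)} [∀ n, IsProbabilityMeasure (P n)] {p k : ℕ → ℕ} {ell0 : ℝ → ℝ}
    {m : ℕ} {B : ℝ} (hell : SmoothableLoss ell0 m B) (hm : m ≤ 4)
    {C : ∀ n, Matrix (Fin (p n)) (Fin (p n)) ℝ} {q : ℕ} (hmq : 3 + m ≤ q) (hq : 4 ≤ q)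
    {c : ∀ n, Fin (p n) → Fin (k n)} {A₀ M T : ℝ} (hA₀ : 0 ≤ A₀) (hM : 0 ≤ M)
    (hp : ∀ n, 1 ≤ n → p n ≤ T * n) (hC : ∀ n w, w ⬝ᵥ C n *ᵥ w ≤ M / n * (w ⬝ᵥ w))
    {X G : ∀ n, Ω n → Fin n → Fin (p n) → ℝ} {ξ : ∀ n, Ω n → Fin n → ℝ}
    (hX : ∀ n, BlockDesign (P n) (C n) q (fun k => A₀ / √n ^ k) (c n) (X n))
    (hG : ∀ n, BlockDesign (P n) (C n) q (fun k => A₀ / √n ^ k) (c n) (G n))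
    (hξ : ∀ n, Measurable (ξ n)) (hXξ : ∀ n, IndepFun (X n) (ξ n) (P n))
    (hGξ : ∀ n, IndepFun (G n) (ξ n) (P n))
    (hnoise : ∀ ε : ℝ, 0 < ε → ∃ a : ℝ, ∀ᶠ n in atTop,
      P n {ω | a < Av fun i => (1 + |ξ n ω i|) ^ m} ≤ ENNReal.ofReal ε) {d : ℕ → ℕ}
    (hcard : ∀ n b, ({j | c n j = b} : Finset (Fin (p n))).card ≤ d n)
    {R : ∀ n, (Fin (p n) → ℝ) → ℝ} {S : ∀ n, Set (Fin (p n) → ℝ)} (hSne : ∀ n, (S n).Nonempty)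
    (hRS : ∀ n, BddBelow (R n '' S n)) {L : ℕ → ℝ} (hL1 : ∀ n, 1 ≤ L n)
    (hS : ∀ n, ∀ w ∈ S n, ∀ j, w j ∈ Set.Icc (-L n) (L n)) {Q α κ : ℝ} (hmQ : m ≤ Q) (hα : 0 ≤ α)
    (hα1 : α < 1) (hκ : 0 ≤ κ) (hL : L =O[atTop] fun n : ℕ => (n : ℝ) ^ α * Real.log n ^ κ)
    (hd : (fun n : ℕ => (d n : ℝ)) =o[atTop] fun n : ℕ =>
      (n : ℝ) ^ (1 / 4 - (Q + 3) * α / 2) / Real.log n ^ (6 + (2 * Q + 6) * κ))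
    {g : ℕ → ℝ → ℝ} (hg : IsJet 3 g) {K : ℝ≥0} (hgK : ∀ k ≤ 3, ∀ x, |g k x| ≤ K) :
    Tendsto (fun n => |∫ ω, g 0 (minRisk (noisyLoss ell0 (ξ n ω)) (R n) (S n) (X n ω)) ∂(P n)
      - ∫ ω, g 0 (minRisk (noisyLoss ell0 (ξ n ω)) (R n) (S n) (G n ω)) ∂(P n)|) atTop (𝓝 0) := by
  refine tendsto_order.2 ⟨fun b hb => .of_forall fun n => hb.trans_le (abs_nonneg _),
    fun η hη => ?_⟩
  have hK : 0 < 4 * (K : ℝ) + 1 := by positivity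
  obtain ⟨a, ha⟩ := hnoise (η / (4 * K + 1)) (div_pos hη hK)
  have herror := tendsto_comparison_error hα hα1 hκ hL1 hL hd hmQ B T (2 * K)
    (comparisonConst T A₀ M m * K * (max a 0 * B))
  filter_upwards [ha, herror.eventually (gt_mem_nhds (half_pos hη)), eventually_ge_atTop 1,
    tendsto_log_natCast.eventually_ge_atTop 1,
    eventually_pow_three_le (m.cast_nonneg.trans hmQ) hα hκ hd] with n hbad hn hn1 hlog hdn
  have hnoise_n : (P n).real {ω | max a 0 < Av fun i => (1 + |ξ n ω i|) ^ m} ≤ η / (4 * K + 1) :=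
    ENNReal.toReal_le_of_le_ofReal (div_pos hη hK).le
      ((measure_mono fun ω => (le_max_left a 0).trans_lt).trans hbad)
  have hcompare := abs_integral_minRisk_noisyLoss_sub_le hell hm hA₀ hM hn1 (hp n hn1) (hC n) (hX n)
    (hG n) (hξ n) (hXξ n) (hGξ n) (hcard n) hdn hmq hq (hSne n) (hRS n) (hL1 n) (hS n)
    (inv_pos.2 (zero_lt_one.trans_le hlog)) (inv_le_one_of_one_le₀ hlog)
    (inv_pos.2 (by positivity : (0 : ℝ) < (n : ℝ) ^ 3)) (one_le_pow₀ (n := 2) hlog)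
    (le_max_right a 0) hg hgK
  refine (hcompare.trans (add_le_add_right (mul_le_mul_of_nonneg_left hnoise_n
    (by positivity : (0 : ℝ) ≤ 2 * K)) _)).trans_lt ?_
  have hsmall : 2 * K * (η / (4 * K + 1)) ≤ η / 2 := by
    rw [mul_div_assoc', div_le_div_iff₀ hK zero_lt_two]
    linarith
  linarith

end Limit

section Corollary

open scoped Matrix

lemma isJet_iteratedDeriv {g : ℝ → ℝ} {r : ℕ} (hg : ContDiff ℝ r g) :
    IsJet r fun k => iteratedDeriv k g := fun k hk t => by
  simp only [iteratedDeriv_succ]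
  exact (hg.differentiable_iteratedDeriv k (by exact_mod_cast hk) t).hasDerivAt

lemma LossAssumption.one_add_abs_pow_le {ell0 : ℝ → ℝ} {m n : ℕ}
    (hm : m = 0 ∨ m = 3 ∧ ell0 = squaredLoss) {ξ : Fin n → ℝ} {q : Fin 4 → ℝ} {Lc : Fin n → ℝ}
    {ρbar : ℝ} {Dℓ Mℓ : Set.Ioo (0 : ℝ) ρbar → ℝ}
    (h : LossAssumption (noisyLoss ell0 ξ) q Lc ρbar Dℓ Mℓ) (i : Fin n) :
    (1 + |ξ i|) ^ m ≤ 8 * Lc i ^ qBold q := by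
  obtain rfl | ⟨rfl, rfl⟩ := hm
  · linarith [Real.one_le_rpow (h.one_le_Lc i) h.qBold_nonneg, pow_zero (1 + |ξ i|)]
  · exact h.one_add_abs_pow_three_le i

lemma LossAssumption.le_qBar {ell0 : ℝ → ℝ} {m n : ℕ}
    (hm : m = 0 ∨ m = 3 ∧ ell0 = squaredLoss) {ξ : Fin n → ℝ} {q : Fin 4 → ℝ} {Lc : Fin n → ℝ}
    {ρbar : ℝ} {Dℓ Mℓ : Set.Ioo (0 : ℝ) ρbar → ℝ}
    (h : LossAssumption (noisyLoss ell0 ξ) q Lc ρbar Dℓ Mℓ) (i : Fin n) : m ≤ qBar q := by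
  obtain rfl | ⟨rfl, rfl⟩ := hm
  · exact Nat.zero_le _
  · exact Nat.le_of_succ_le (h.four_le_qBar i)

variable {Ω : Type*} [MeasurableSpace Ω] {P : Measure Ω} [IsProbabilityMeasure P] {n p k : ℕ}
  {Sig : Matrix (Fin p) (Fin p) ℝ} {X G : Ω → Fin n → Fin p → ℝ} {c : Fin p → Fin k} {q : ℕ} {M : ℝ}

lemma IsCovariateDesign.blockDesign (hX : IsCovariateDesign P Sig X)
    (hcells : ∀ i, iIndepFun (fun (b : Fin k) ω (j : {j : Fin p // c j = b}) => X ω i j) P)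
    (hmom : ∀ i j, eLpNorm (fun ω => √(n : ℝ) * X ω i j) q P ≤ ENNReal.ofReal M) :
    BlockDesign P ((1 / (n : ℝ)) • Sig) q (fun k => momentBound q M / √n ^ k) c X :=
  ⟨hX.measurable, hX.indep, hcells, fun i => hX.rowMoments i (hmom i)⟩

lemma IsGaussianDesign.blockDesign (hG : IsGaussianDesign P Sig G) (hSig : Sig.PosSemidef)
    (hM : ∀ j, Sig j j ≤ M) (hX : IsCovariateDesign P Sig X)
    (hcells : ∀ i, iIndepFun (fun (b : Fin k) ω (j : {j : Fin p // c j = b}) => X ω i j) P) :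
    BlockDesign P ((1 / (n : ℝ)) • Sig) q (fun k => momentBound q M / √n ^ k) c G :=
  ⟨hG.measurable, hG.indep, fun i => hG.iIndepFun_cells hSig hX c i (hcells i),
    hG.rowMoments hSig hM q⟩

lemma integrable_comp_minRisk_noisyLoss {ell0 : ℝ → ℝ} (hc : Continuous ell0) (h0 : 0 ≤ ell0)
    {R : (Fin p → ℝ) → ℝ} {S : Set (Fin p → ℝ)} (hSne : S.Nonempty) (hRS : BddBelow (R '' S))
    (hX : Measurable X) {ξ : Ω → Fin n → ℝ} (hξ : Measurable ξ) {g : ℝ → ℝ} (hg : Measurable g)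
    {K : ℝ} (hK : ∀ x, |g x| ≤ K) :
    Integrable (fun ω => g (minRisk (noisyLoss ell0 (ξ ω)) R S (X ω))) P := by
  have hF := measurable_minRisk hc h0 hSne hRS (n := n)
  have hmeas : Measurable fun ω => g (minRisk (noisyLoss ell0 (ξ ω)) R S (X ω)) :=
    (hg.comp (hF.comp (hX.prodMk hξ)) :)
  exact integrable_of_measurable_of_abs_le hmeas fun _ => hK _

lemma apply_self_le_of_dotProduct_mulVec_le
    (h : ∀ w, w ⬝ᵥ Sig *ᵥ w ≤ M * (w ⬝ᵥ w)) (j : Fin p) : Sig j j ≤ M := by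
  simpa using h (Pi.single j 1)

theorem corollary1_general
    {Ω : ℕ → Type*} [∀ n, MeasurableSpace (Ω n)]
    (P : ∀ n, Measure (Ω n)) [∀ n, IsProbabilityMeasure (P n)]
    (p : ℕ → ℕ) (T : ℝ) (hp : ∀ n, 1 ≤ n → p n ≤ T * n)
    (ell0 : ℝ → ℝ) (hell : IsExampleLoss ell0)
    (ξ : ∀ n, Ω n → Fin n → ℝ) (hξ : ∀ n, Measurable (ξ n))
    (q : Fin 4 → ℝ) (Lc : ∀ n, Ω n → Fin n → ℝ)
    (ρbar : ℝ) (Dℓ Mℓ : Set.Ioo (0 : ℝ) ρbar → ℝ)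
    (hloss : ∀ n ω, LossAssumption (noisyLoss ell0 (ξ n ω)) q (Lc n ω) ρbar Dℓ Mℓ)
    (hAv : ∀ ε : ℝ, 0 < ε → ∃ C : ℝ, ∀ᶠ n in atTop,
      P n {ω | C < Av (fun i => Lc n ω i ^ qBold q)} ≤ ENNReal.ofReal ε)
    (R : ∀ n, (Fin (p n) → ℝ) → ℝ)
    (Sig : ∀ n, Matrix (Fin (p n)) (Fin (p n)) ℝ) (hSig : ∀ n, (Sig n).PosSemidef)
    (X G : ∀ n, Ω n → Fin n → Fin (p n) → ℝ)
    (hX : ∀ n, IsCovariateDesign (P n) (Sig n) (X n))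
    (hG : ∀ n, IsGaussianDesign (P n) (Sig n) (G n))
    (hXξ : ∀ n, IndepFun (X n) (ξ n) (P n))
    (hGξ : ∀ n, IndepFun (G n) (ξ n) (P n))
    (M : ℝ)
    (hmom : ∀ (n : ℕ) (i : Fin n) (j : Fin (p n)),
      eLpNorm (fun ω => √(n : ℝ) * X n ω i j) (qStar q : ℝ≥0∞) (P n) ≤ ENNReal.ofReal M)
    (heig : ∀ (n : ℕ) (j : Fin (p n)), (hSig n).isHermitian.eigenvalues j ≤ M)
    (d : ℕ → ℕ) (hblock : ∀ n, BlockDependent (P n) (d n) (X n))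
    (α κ : ℝ) (hα : α ∈ Set.Ico (0 : ℝ) 1) (hκ : 0 ≤ κ)
    (L : ℕ → ℝ) (hL1 : ∀ n, 1 ≤ L n)
    (hL : L =O[atTop] fun n : ℕ => (n : ℝ) ^ α * Real.log n ^ κ)
    (hd : (fun n : ℕ => (d n : ℝ)) =o[atTop] fun n : ℕ =>
      (n : ℝ) ^ (1 / 4 - ((qBar q : ℝ) + 3) * α / 2)
        / Real.log n ^ (6 + (2 * (qBar q : ℝ) + 6) * κ))
    (S : ∀ n, Set (Fin (p n) → ℝ)) (hSne : ∀ n, (S n).Nonempty)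
    (hRS : ∀ n, BddBelow (R n '' S n))
    (hS : ∀ n, ∀ w ∈ S n, ∀ j, w j ∈ Set.Icc (-L n) (L n))
    (g : ℝ → ℝ) (hg : ContDiff ℝ 3 g)
    (hgb : ∃ K : ℝ, ∀ k : ℕ, k ≤ 3 → ∀ x, |iteratedDeriv k g x| ≤ K) :
    (∀ n,
      Integrable
        (fun ω => g (minRisk (noisyLoss ell0 (ξ n ω)) (R n) (S n) (X n ω))) (P n) ∧
      Integrable
        (fun ω => g (minRisk (noisyLoss ell0 (ξ n ω)) (R n) (S n) (G n ω))) (P n)) ∧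
    Tendsto (fun n : ℕ =>
      |(∫ ω, g (minRisk (noisyLoss ell0 (ξ n ω)) (R n) (S n) (X n ω)) ∂(P n))
        - ∫ ω, g (minRisk (noisyLoss ell0 (ξ n ω)) (R n) (S n) (G n ω)) ∂(P n)|)
      atTop (𝓝 0) := by
  obtain ⟨m, B, hsmooth, hm⟩ := hell.exists_smoothableLoss
  obtain ⟨K, hgK⟩ : ∃ K : ℝ≥0, ∀ k ≤ 3, ∀ x, |iteratedDeriv k g x| ≤ K :=
    hgb.imp' Real.toNNReal fun K hK k hk x => (hK k hk x).trans (Real.le_coe_toNNReal K)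
  refine ⟨fun n => ?_, ?_⟩
  · have hint := fun {Y} (hY : Measurable Y) => integrable_comp_minRisk_noisyLoss (P := P n)
      hsmooth.continuous hsmooth.nonneg (hSne n) (hRS n) hY (hξ n) hg.continuous.measurable
      (hgK 0 (Nat.zero_le 3))
    exact ⟨hint (hX n).measurable, hint (hG n).measurable⟩
  have hquad (n : ℕ) := dotProduct_mulVec_le_of_eigenvalues_le (hSig n).isHermitian
    fun j => (heig n j).trans (le_max_left M 0)
  choose k _ c hcard hcells using hblock
  have hmQ : m ≤ qBar q :=
    (hloss 1 (nonempty_of_isProbabilityMeasure (P 1)).some).le_qBar hm 0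
  have hqStar := qBar_add_four_le_qStar q
  refine tendsto_abs_integral_minRisk_noisyLoss_sub (g := fun k => iteratedDeriv k g)
    (M := max M 0) (A₀ := momentBound (qStar q) (max M 0)) hsmooth (by omega) (q := qStar q)
    (by omega) (by omega)
    (zero_le_one.trans (one_le_momentBound _ _)) (le_max_right M 0) hp
    (C := fun n => (1 / (n : ℝ)) • Sig n) (fun n w => ?_)
    (fun n => (hX n).blockDesign (hcells n) fun i j => (hmom n i j).trans
      (ENNReal.ofReal_le_ofReal (le_max_left M 0)))
    (fun n => (hG n).blockDesign (hSig n) (apply_self_le_of_dotProduct_mulVec_le (hquad n))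
      (hX n) (hcells n)) hξ hXξ hGξ (fun ε hε => ?_) hcard hSne hRS hL1 hS
    (by exact_mod_cast hmQ) hα.1 hα.2 hκ hL hd (isJet_iteratedDeriv hg) hgK
  · rw [Matrix.smul_mulVec, dotProduct_smul, smul_eq_mul, one_div_mul_eq_div, div_mul_eq_mul_div]
    gcongr
    exact hquad n w
  · obtain ⟨a, ha⟩ := hAv ε hε
    refine ⟨a * 8, ha.mono fun n han => (measure_mono fun ω hω => ?_).trans han⟩
    have hle := Av_mono fun i => (hloss n ω).one_add_abs_pow_le hm i
    simp only [mul_comm (8 : ℝ), Av_mul_const] at hle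
    exact lt_of_mul_lt_mul_right (hω.trans_le hle) (by norm_num)

end Corollary

theorem corollary1
    -- probability spaces and dimensions, indexed by the sample size `n`
    {Ω : ℕ → Type*} [∀ n, MeasurableSpace (Ω n)]
    (P : ∀ n, Measure (Ω n)) [∀ n, IsProbabilityMeasure (P n)]
    (p : ℕ → ℕ) (τ : ℝ) (hτ : τ ∈ Set.Ioo (0 : ℝ) 1)
    (hreg : ∀ n : ℕ, 1 ≤ n → τ ≤ (p n : ℝ) / n ∧ (p n : ℝ) / n ≤ 1 / τ)
    -- the loss, the noise, and the regularity assumption on the losses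
    (ell0 : ℝ → ℝ) (hell : IsExampleLoss ell0)
    (ξ : ∀ n, Ω n → Fin n → ℝ) (hξ : ∀ n, Measurable (ξ n))
    (q : Fin 4 → ℝ) (Lc : ∀ n, Ω n → Fin n → ℝ)
    (ρbar : ℝ) (Dℓ Mℓ : Set.Ioo (0 : ℝ) ρbar → ℝ)
    (hloss : ∀ n ω, LossAssumption (noisyLoss ell0 (ξ n ω)) q (Lc n ω) ρbar Dℓ Mℓ)
    (hqbar : qBar q ≤ 6)
    (hAv : ∀ ε : ℝ, 0 < ε → ∃ C : ℝ, ∀ᶠ n in atTop,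
      P n {ω | C < Av (fun i => Lc n ω i ^ qBold q)} ≤ ENNReal.ofReal ε)
    -- the convex regularizer
    (R : ∀ n, (Fin (p n) → ℝ) → ℝ) (hR : ∀ n, ConvexOn ℝ Set.univ (R n))
    -- the covariates and their Gaussian analogue, both independent of the noise
    (Sig : ∀ n, Matrix (Fin (p n)) (Fin (p n)) ℝ) (hSig : ∀ n, (Sig n).PosDef)
    (X G : ∀ n, Ω n → Fin n → Fin (p n) → ℝ)
    (hX : ∀ n, IsCovariateDesign (P n) (Sig n) (X n))
    (hG : ∀ n, IsGaussianDesign (P n) (Sig n) (G n))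
    (hXξ : ∀ n, IndepFun (X n) (ξ n) (P n))
    (hGξ : ∀ n, IndepFun (G n) (ξ n) (P n))
    (M : ℝ)
    (hmom : ∀ (n : ℕ) (i : Fin n) (j : Fin (p n)),
      eLpNorm (fun ω => √(n : ℝ) * X n ω i j) (qStar q : ℝ≥0∞) (P n) ≤ ENNReal.ofReal M)
    (heig : ∀ (n : ℕ) (j : Fin (p n)), (hSig n).isHermitian.eigenvalues j ≤ M)
    -- block dependence and the growth conditions on `L_n` and `d`
    (d : ℕ → ℕ) (hblock : ∀ n, BlockDependent (P n) (d n) (X n))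
    (α κ : ℝ) (hα : α ∈ Set.Icc (0 : ℝ) (1 / (2 * (qBar q : ℝ) + 6))) (hκ : 0 ≤ κ)
    (L : ℕ → ℝ) (hL1 : ∀ n, 1 ≤ L n)
    (hL : L =O[atTop] fun n : ℕ => (n : ℝ) ^ α * Real.log n ^ κ)
    (hd : (fun n : ℕ => (d n : ℝ)) =o[atTop] fun n : ℕ =>
      (n : ℝ) ^ (1 / 4 - ((qBar q : ℝ) + 3) * α / 2)
        / Real.log n ^ (6 + (2 * (qBar q : ℝ) + 6) * κ))
    -- the constraint sets and the test function
    (S : ∀ n, Set (Fin (p n) → ℝ)) (hSne : ∀ n, (S n).Nonempty)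
    (hS : ∀ n, ∀ w ∈ S n, ∀ j, w j ∈ Set.Icc (-L n) (L n))
    (g : ℝ → ℝ) (hg : ContDiff ℝ 3 g)
    (hgb : ∃ K : ℝ, ∀ k : ℕ, k ≤ 3 → ∀ x, |iteratedDeriv k g x| ≤ K) :
    (∀ n,
      Integrable
        (fun ω => g (minRisk (noisyLoss ell0 (ξ n ω)) (R n) (S n) (X n ω))) (P n) ∧
      Integrable
        (fun ω => g (minRisk (noisyLoss ell0 (ξ n ω)) (R n) (S n) (G n ω))) (P n)) ∧
    Tendsto (fun n : ℕ =>
      |(∫ ω, g (minRisk (noisyLoss ell0 (ξ n ω)) (R n) (S n) (X n ω)) ∂(P n))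
        - ∫ ω, g (minRisk (noisyLoss ell0 (ξ n ω)) (R n) (S n) (G n ω)) ∂(P n)|)
      atTop (𝓝 0) :=
  corollary1_general P p (1 / τ) (fun n hn => (div_le_iff₀ (by exact_mod_cast hn)).1 (hreg n hn).2)
    ell0 hell ξ hξ q Lc ρbar Dℓ Mℓ hloss hAv R Sig (fun n => (hSig n).posSemidef) X G hX hG hXξ hGξ
    M hmom heig d hblock α κ
    ⟨hα.1, hα.2.trans_lt <| by rw [div_lt_one] <;> linarith [Nat.cast_nonneg (α := ℝ) (qBar q)]⟩
    hκ L hL1 hL hd S hSne (fun n => bddBelow_image_of_convexOn (hR n) (hS n)) hS g hg hgb
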